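/- Let $Q$ be a smooth finite-dimensional Hausdorff manifold and let $\tau:E\to Q$ be a Lie algebroid: a smooth vector bundle of finite rank with a Lie bracket $[\cdot,\cdot]$ on $\mathrm{Sec}(E)$ and an anchor, i.e. a smooth bundle map $\rho:E\to TQ$ over the identity, such that $[\sigma_1,f\sigma_2]=f[\sigma_1,\sigma_2]+(\rho(\sigma_1)f)\,\sigma_2$ for all $\sigma_1,\sigma_2\in\mathrm{Sec}(E)$, $f\in C^\infty(Q)$. For a smooth section $\mu$ of $\Lambda^lE^*$ ($l\ge 0$) put $$d\mu(\sigma_1,\dots,\sigma_{l+1})=\sum_{i}(-1)^{i+1}\rho(\sigma_i)\bigl(\mu(\sigma_1,\dots,\widehat{\sigma_i},\dots,\sigma_{l+1})\bigr)+\sum_{i<j}(-1)^{i+j}\mu([\sigma_i,\sigma_j],\sigma_1,\dots,\widehat{\sigma_i},\dots,\widehat{\sigma_j},\dots,\sigma_{l+1}).$$ A smooth vector bundle map $(\overline\Phi,\Phi)$ between Lie algebroids is a Lie algebroid morphism if $d\bigl((\overline\Phi,\Phi)^*\mu\bigr)=(\overline\Phi,\Phi)^*(d\mu)$ for every $l\ge0$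 and every smooth section $\mu$ of the $l$-th exterior power of the dual of the target, where $((\overline\Phi,\Phi)^*\mu)_x(v_1,\dots,v_l)=\mu_{\Phi(x)}(\overline\Phi v_1,\dots,\overline\Phi v_l)$. For a smooth vector bundle $\pi:P\to Q$, the prolongation $\mathcal T^EP\to P$ is the Lie algebroid with fibres $\mathcal T^E_pP=\{(e,v)\in E_{\pi(p)}\times T_pP:\rho(e)=T_p\pi(v)\}$, with anchor $(e,v)\mapsto v$, and with the bracket determined by the Leibniz rule and by $[(\sigma\circ\pi,X),(\sigma'\circ\pi,X')]=([\sigma,\sigma']\circ\pi,[X,X'])$ for $\sigma,\sigma'\in\mathrm{Sec}(E)$ and vector fields $X,X'$ on $P$ such that $(\sigma\circ\pi,X)$ and $(\sigma'\circ\pi,X')$ are sections of $\mathcal T^EP$. Let $k$ be a natural number, let $\oplus^kE$ and $\oplus^kE^*$ be the Whitney sums of $k$ copies of $E$ and of $E^*$, and let $L:\oplus^kE\to\mathbb R$ be a smooth function. For $1\le A\le k$, for $b=(b_1,\dots,b_k)\in\oplus^kE$ over $q\in Q$ and for $e\in E_q$, let $(e)^{V_A}_b\in T_b(\oplus^kE)$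 be the velocity at $s=0$ of the curve $s\mapsto(b_1,\dots,b_A+s\,e,\dots,b_k)$, and put $\tilde J^A(e,v)=(0,(e)^{V_A}_b)$ for $(e,v)\in\mathcal T^E_b(\oplus^kE)$. The Poincaré–Cartan sections are $$\Theta_L^A(b)(Z)=\rho^{\mathcal T}(\tilde J^AZ)\,L\quad(Z\in\mathcal T^E_b(\oplus^kE)),\qquad\Omega_L^A=-d\Theta_L^A,$$ where $\rho^{\mathcal T}$ is the anchor of $\mathcal T^E(\oplus^kE)$. The Liouville sections on $\mathcal T^E(\oplus^kE^*)$ are $$\Theta^A_{\beta}(e,v)=\beta_A(e)\quad(\beta=(\beta_1,\dots,\beta_k)\in\oplus^kE^*,\ (e,v)\in\mathcal T^E_\beta(\oplus^kE^*)),\qquad\Omega^A=-d\Theta^A.$$ The Legendre transformation $\mathrm{Leg}:\oplus^kE\to\oplus^kE^*$ and its prolongation $\mathcal T^E\mathrm{Leg}:\mathcal T^E(\oplus^kE)\to\mathcal T^E(\oplus^kE^*)$ are $$[\mathrm{Leg}(b)]^A(e)=\frac{d}{ds}\Big|_{s=0}L(b_1,\dots,b_A+s\,e,\dots,b_k),\qquad\mathcal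 T^E\mathrm{Leg}(e,v)=(e,T_b\mathrm{Leg}(v))\ \text{ for }(e,v)\in\mathcal T^E_b(\oplus^kE).$$ **Theorem.** The pair $(\mathcal T^E\mathrm{Leg},\mathrm{Leg})$ is a Lie algebroid morphism from $\mathcal T^E(\oplus^kE)$ to $\mathcal T^E(\oplus^kE^*)$. Moreover, for each $A=1,\dots,k$, $$(\mathcal T^E\mathrm{Leg},\mathrm{Leg})^*\Theta^A=\Theta_L^A\qquad\text{and}\qquad(\mathcal T^E\mathrm{Leg},\mathrm{Leg})^*\Omega^A=\Omega_L^A.$$ -/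

import Mathlib

open Set Bundle Topology Manifold ContDiff VectorField
set_option linter.unusedSectionVars false

/-! ### Whitney sums -/
section WhitneySum

/-- The fibres of the Whitney sum of `k` copies of a vector bundle. -/
def WhitneySum {Q : Type*} (k : ℕ) (V : Q → Type*) (q : Q) : Type _ := Fin k → V q

namespace WhitneySum

variable {Q : Type*} {k : ℕ} {V : Q → Type*}

instance [∀ q, AddCommGroup (V q)] (q : Q) : AddCommGroup (WhitneySum k V q) :=
  inferInstanceAs (AddCommGroup (Fin k → V q))
instance [∀ q, AddCommGroup (V q)] [∀ q, Module ℝ (V q)] (q : Q) :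
    Module ℝ (WhitneySum k V q) :=
  inferInstanceAs (Module ℝ (Fin k → V q))
instance [∀ q, TopologicalSpace (V q)] (q : Q) : TopologicalSpace (WhitneySum k V q) :=
  inferInstanceAs (TopologicalSpace (Fin k → V q))
instance [∀ q, TopologicalSpace (V q)] [∀ q, AddCommGroup (V q)]
    [∀ q, IsTopologicalAddGroup (V q)] (q : Q) : IsTopologicalAddGroup (WhitneySum k V q) :=
  inferInstanceAs (IsTopologicalAddGroup (Fin k → V q))
instance [∀ q, TopologicalSpace (V q)] [∀ q, AddCommGroup (V q)] [∀ q, Module ℝ (V q)]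
    [∀ q, ContinuousSMul ℝ (V q)] (q : Q) : ContinuousSMul ℝ (WhitneySum k V q) :=
  inferInstanceAs (ContinuousSMul ℝ (Fin k → V q))

variable [TopologicalSpace Q] {F : Type*} [NormedAddCommGroup F] [NormedSpace ℝ F]
  [∀ q, AddCommGroup (V q)] [∀ q, Module ℝ (V q)] [TopologicalSpace (TotalSpace F V)]

/-- The trivialization of a Whitney sum given by a trivialization of the bundle. -/
noncomputable def pretrivialization (k : ℕ) (e : Trivialization F (π F V)) [e.IsLinear ℝ] :
    Pretrivialization (Fin k → F) (π (Fin k → F) (WhitneySum k V)) where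
  toFun p := ⟨p.1, fun A ↦ e.linearMapAt ℝ p.1 (p.2 A)⟩
  invFun p := ⟨p.1, fun A ↦ e.symmₗ ℝ p.1 (p.2 A)⟩
  source := Bundle.TotalSpace.proj ⁻¹' e.baseSet
  target := e.baseSet ×ˢ Set.univ
  map_source' := fun ⟨_, _⟩ h ↦ ⟨h, Set.mem_univ _⟩
  map_target' := fun ⟨_, _⟩ h ↦ h.1
  left_inv' := fun ⟨x, L⟩ h ↦ by
    congr 1
    exact funext fun A ↦ e.symmₗ_linearMapAt h (L A)
  right_inv' := fun ⟨x, f⟩ ⟨h, _⟩ ↦ by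
    simp only [Prod.mk_right_inj]
    funext A
    exact e.linearMapAt_symmₗ h _
  open_target := e.open_baseSet.prod isOpen_univ
  baseSet := e.baseSet
  open_baseSet := e.open_baseSet
  source_eq := rfl
  target_eq := rfl
  proj_toFun _ _ := rfl

instance (e : Trivialization F (π F V)) [e.IsLinear ℝ] :
    (pretrivialization k e).IsLinear ℝ where
  linear x _ :=
    { map_add L L' := funext fun A ↦ (e.linearMapAt ℝ x).map_add (L A) (L' A)
      map_smul c L := funext fun A ↦ (e.linearMapAt ℝ x).map_smul c (L A) }

/-- Let a linear map act on each component of a `k`-tuple. -/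
noncomputable def diagonal (k : ℕ) (F : Type*) [NormedAddCommGroup F] [NormedSpace ℝ F] :
    (F →L[ℝ] F) →L[ℝ] ((Fin k → F) →L[ℝ] (Fin k → F)) :=
  ∑ A : Fin k, (ContinuousLinearMap.compL ℝ (Fin k → F) F (Fin k → F)
    (ContinuousLinearMap.single ℝ (fun _ : Fin k ↦ F) A)).comp
    ((ContinuousLinearMap.compL ℝ (Fin k → F) F F).flip (ContinuousLinearMap.proj A))

theorem diagonal_apply (f : F →L[ℝ] F) (v : Fin k → F) (A : Fin k) :
    diagonal k F f v A = f (v A) := by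
  simp [diagonal, Finset.sum_apply, Pi.single_apply]

theorem coordChange_apply (e e' : Trivialization F (π F V)) [e.IsLinear ℝ] [e'.IsLinear ℝ]
    {q : Q} (hq : q ∈ e.baseSet ∩ e'.baseSet) (v : Fin k → F) :
    diagonal k F (e.coordChangeL ℝ e' q : F →L[ℝ] F) v =
      ((pretrivialization k e') ⟨q, (pretrivialization k e).symm q v⟩).2 := by
  have h1 : (pretrivialization k e).symm q v = fun A ↦ e.symmₗ ℝ q (v A) :=
    Pretrivialization.symm_apply _ hq.1 v
  rw [h1]
  funext A
  change _ = e'.linearMapAt ℝ q (e.symmₗ ℝ q (v A))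
  rw [diagonal_apply, ContinuousLinearEquiv.coe_coe, e.coordChangeL_apply e' hq,
    e'.coe_linearMapAt_of_mem hq.2, e.coe_symmₗ hq.1]

variable [∀ q, TopologicalSpace (V q)] [FiberBundle F V] [VectorBundle ℝ F V]

variable (k F V) in
/-- The Whitney sum of `k` copies of a vector bundle, as a vector prebundle. -/
noncomputable def vectorPrebundle : VectorPrebundle ℝ (Fin k → F) (WhitneySum k V) where
  pretrivializationAtlas :=
    {e | ∃ (e₁ : Trivialization F (π F V)) (_ : MemTrivializationAtlas e₁),
        e = pretrivialization k e₁}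
  pretrivialization_linear' := by
    rintro _ ⟨e₁, he₁, rfl⟩
    infer_instance
  pretrivializationAt x := pretrivialization k (trivializationAt F V x)
  mem_base_pretrivializationAt x := mem_baseSet_trivializationAt F V x
  pretrivialization_mem_atlas x := ⟨trivializationAt F V x, inferInstance, rfl⟩
  exists_coordChange := by
    rintro _ ⟨e, he, rfl⟩ _ ⟨e', he', rfl⟩
    exact ⟨fun q ↦ diagonal k F (e.coordChangeL ℝ e' q),
      (diagonal k F).continuous.comp_continuousOn (continuousOn_coordChange ℝ e e'),
      fun b hb v ↦ coordChange_apply e e' hb v⟩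
  totalSpaceMk_isInducing := by
    intro b
    let L : V b ≃L[ℝ] F := (trivializationAt F V b).continuousLinearEquivAt ℝ b
      (mem_baseSet_trivializationAt _ _ _)
    let φ : (Fin k → V b) ≃L[ℝ] (Fin k → F) := ContinuousLinearEquiv.piCongrRight fun _ ↦ L
    have h : IsInducing fun x ↦ (b, φ x) := isInducing_const_prod.mpr φ.toHomeomorph.isInducing
    have h' : (fun x : WhitneySum k V b ↦ (b, φ x)) =
        (pretrivialization k (trivializationAt F V b)) ∘ TotalSpace.mk b := by
      funext x
      refine congrArg (Prod.mk b) ?_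
      funext A
      change L (x A) = (trivializationAt F V b).linearMapAt ℝ b (x A)
      rw [(trivializationAt F V b).coe_linearMapAt_of_mem (mem_baseSet_trivializationAt _ _ _)]
      rfl
    exact h' ▸ h

noncomputable instance : TopologicalSpace (TotalSpace (Fin k → F) (WhitneySum k V)) :=
  (vectorPrebundle k V F).totalSpaceTopology
noncomputable instance : FiberBundle (Fin k → F) (WhitneySum k V) :=
  (vectorPrebundle k V F).toFiberBundle
instance : VectorBundle ℝ (Fin k → F) (WhitneySum k V) :=
  (vectorPrebundle k V F).toVectorBundle

variable {B H : Type*} [NormedAddCommGroup B] [NormedSpace ℝ B] [TopologicalSpace H]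
  {I : ModelWithCorners ℝ B H} [ChartedSpace H Q]

instance [ContMDiffVectorBundle ∞ F V I] : (vectorPrebundle k V F).IsContMDiff I ∞ where
  exists_contMDiffCoordChange := by
    rintro _ ⟨e, he, rfl⟩ _ ⟨e', he', rfl⟩
    exact ⟨fun q ↦ diagonal k F (e.coordChangeL ℝ e' q),
      (diagonal k F).contMDiff.comp_contMDiffOn (contMDiffOn_coordChangeL e e'),
      fun b hb v ↦ coordChange_apply e e' hb v⟩

instance [ContMDiffVectorBundle ∞ F V I] :
    ContMDiffVectorBundle ∞ (Fin k → F) (WhitneySum k V) I :=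
  (vectorPrebundle k V F).contMDiffVectorBundle I

theorem trivializationAt_apply (q₀ : Q) (p : TotalSpace (Fin k → F) (WhitneySum k V)) :
    trivializationAt (Fin k → F) (WhitneySum k V) q₀ p =
      ⟨p.1, fun A ↦ (trivializationAt F V q₀).linearMapAt ℝ p.1 (p.2 A)⟩ := rfl

end WhitneySum
end WhitneySum

section LieAlgebroid

variable {B H : Type*} [NormedAddCommGroup B] [NormedSpace ℝ B] [TopologicalSpace H]
  (I : ModelWithCorners ℝ B H) {M : Type*} [TopologicalSpace M] [ChartedSpace H M]
  (F : Type*) [NormedAddCommGroup F] [NormedSpace ℝ F]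
  (V : M → Type*) [TopologicalSpace (TotalSpace F V)] [∀ x, AddCommGroup (V x)]
  [∀ x, Module ℝ (V x)] [∀ x, TopologicalSpace (V x)] [FiberBundle F V] [VectorBundle ℝ F V]

variable {I F V} in
/-- The product of a smooth function and a smooth section. -/
noncomputable def ContMDiffSection.funSMul (f : C^∞⟮I, M; 𝓘(ℝ), ℝ⟯) (σ : Cₛ^∞⟮I; F, V⟯) : Cₛ^∞⟮I; F, V⟯ :=
  ⟨fun x ↦ f x • σ x, f.contMDiff.smul_section σ.contMDiff⟩

/-- A Lie algebroid structure on a smooth vector bundle `V → M`: a Lie bracket on the space of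
smooth sections and a smooth bundle map `V → TM`, the anchor, related by the Leibniz rule. -/
structure LieAlgebroid [IsManifold I ∞ M] [ContMDiffVectorBundle ∞ F V I] where
  /-- the anchor map -/
  anchor : ∀ x, V x →L[ℝ] TangentSpace I x
  contMDiff_anchor : ContMDiff (I.prod 𝓘(ℝ, F)) I.tangent ∞
    fun e : TotalSpace F V ↦ (⟨e.1, anchor e.1 e.2⟩ : TangentBundle I M)
  /-- the Lie bracket of sections -/
  bracket : Cₛ^∞⟮I; F, V⟯ → Cₛ^∞⟮I; F, V⟯ → Cₛ^∞⟮I; F, V⟯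
  bracket_skew : ∀ σ τ, bracket σ τ = - bracket τ σ
  bracket_add : ∀ σ τ υ, bracket σ (τ + υ) = bracket σ τ + bracket σ υ
  bracket_smul : ∀ (c : ℝ) σ τ, bracket σ (c • τ) = c • bracket σ τ
  jacobi : ∀ σ τ υ,
    bracket (bracket σ τ) υ + bracket (bracket τ υ) σ + bracket (bracket υ σ) τ = 0
  leibniz : ∀ (f : C^∞⟮I, M; 𝓘(ℝ), ℝ⟯) σ τ (x : M), bracket σ (τ.funSMul f) x =
    f x • bracket σ τ x + mvfderiv I f x (anchor x (σ x)) • τ x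

end LieAlgebroid

/-- The total space of a fibre bundle with Hausdorff base and fibre is Hausdorff. -/
theorem t2Space_totalSpace {M : Type*} [TopologicalSpace M] [T2Space M] {F : Type*}
    [TopologicalSpace F] [T2Space F] {V : M → Type*} [TopologicalSpace (TotalSpace F V)]
    [∀ x, TopologicalSpace (V x)] [FiberBundle F V] : T2Space (TotalSpace F V) := by
  refine ⟨fun x y hxy ↦ ?_⟩
  by_cases h : x.1 = y.1
  · set e := trivializationAt F V x.1
    have hx : x ∈ e.source := FiberBundle.mem_trivializationAt_proj_source
    have hy : y ∈ e.source := e.mem_source.2 (h ▸ e.mem_source.1 hx)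
    obtain ⟨u, v, hu, hv, hxu, hyv, huv⟩ := t2_separation fun he ↦
      hxy (e.toOpenPartialHomeomorph.injOn hx hy he)
    refine ⟨_, _, e.toOpenPartialHomeomorph.isOpen_inter_preimage hu,
      e.toOpenPartialHomeomorph.isOpen_inter_preimage hv, ⟨hx, hxu⟩, ⟨hy, hyv⟩, ?_⟩
    rw [Set.disjoint_left] at huv ⊢
    exact fun z hz hz' ↦ huv hz.2 hz'.2
  · exact separated_by_continuous (FiberBundle.continuous_proj F V) h

section SectionThrough

variable {B H : Type*} [NormedAddCommGroup B] [NormedSpace ℝ B] [FiniteDimensional ℝ B]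
  [TopologicalSpace H]
  (I : ModelWithCorners ℝ B H) {M : Type*} [TopologicalSpace M] [ChartedSpace H M]
  [IsManifold I ∞ M] [T2Space M]
  (F : Type*) [NormedAddCommGroup F] [NormedSpace ℝ F]
  {V : M → Type*} [TopologicalSpace (TotalSpace F V)] [∀ x, AddCommGroup (V x)]
  [∀ x, Module ℝ (V x)] [∀ x, TopologicalSpace (V x)] [FiberBundle F V] [VectorBundle ℝ F V]
  [ContMDiffVectorBundle ∞ F V I]

/-- A smooth bump function at `x` supported in a given neighbourhood of `x`. -/
theorem exists_bump (x : M) {s : Set M} (hs : s ∈ 𝓝 x) :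
    ∃ f : SmoothBumpFunction I x, tsupport f ⊆ s := by
  obtain ⟨f, -, hf⟩ := (SmoothBumpFunction.nhds_basis_tsupport (I := I) x).mem_iff.1 hs
  exact ⟨f, hf⟩

variable (V) in
/-- A smooth bump function at `x` supported in the domain of the preferred trivialization. -/
noncomputable def bundleBump (x : M) : SmoothBumpFunction I x :=
  (exists_bump I x ((trivializationAt F V x).open_baseSet.mem_nhds
    (mem_baseSet_trivializationAt F V x))).choose

variable (V) in
theorem tsupport_bundleBump (x : M) :
    tsupport (bundleBump I F V x) ⊆ (trivializationAt F V x).baseSet :=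
  (exists_bump I x ((trivializationAt F V x).open_baseSet.mem_nhds
    (mem_baseSet_trivializationAt F V x))).choose_spec

variable (V) in
/-- A smooth section which is equal to `c : F` in the preferred trivialization near `x`. -/
noncomputable def constSection (x : M) (c : F) : Cₛ^∞⟮I; F, V⟯ :=
  ⟨(bundleBump I F V x : M → ℝ) • fun y ↦ (trivializationAt F V x).symm y c, by
    refine ContMDiffOn.smul_section_of_tsupport (bundleBump I F V x).contMDiff.contMDiffOn
      (trivializationAt F V x).open_baseSet (tsupport_bundleBump I F V x) ?_
    rw [(trivializationAt F V x).contMDiffOn_section_baseSet_iff]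
    exact contMDiffOn_const.congr fun y hy ↦ by
      rw [(trivializationAt F V x).apply_mk_symm hy]⟩

/-- A smooth section through a given vector `v`, which is constant in the preferred
trivialization near the base point of `v`. -/
noncomputable def sectionThrough {x : M} (v : V x) : Cₛ^∞⟮I; F, V⟯ :=
  constSection I F V x (trivializationAt F V x ⟨x, v⟩).2

theorem constSection_eventuallyEq (x : M) (c : F) :
    ∀ᶠ y in 𝓝 x, y ∈ (trivializationAt F V x).baseSet ∧
      constSection I F V x c y = (trivializationAt F V x).symm y c := by
  filter_upwards [(bundleBump I F V x).eventuallyEq_one, (trivializationAt F V x).open_baseSet.mem_nhds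
    (mem_baseSet_trivializationAt F V x)] with y hy hy'
  refine ⟨hy', ?_⟩
  change bundleBump I F V x y • (trivializationAt F V x).symm y c = _
  rw [hy]
  exact one_smul _ _

theorem sectionThrough_apply {x : M} (v : V x) : sectionThrough I F v x = v := by
  rw [sectionThrough, (constSection_eventuallyEq I F x _).self_of_nhds.2]
  simp [mem_baseSet_trivializationAt]

end SectionThrough

section TrivDeriv

variable {B H : Type*} [NormedAddCommGroup B] [NormedSpace ℝ B] [TopologicalSpace H]
  {I : ModelWithCorners ℝ B H} {Q : Type*} [TopologicalSpace Q] [ChartedSpace H Q]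
  [IsManifold I ∞ Q]
  {G : Type*} [NormedAddCommGroup G] [NormedSpace ℝ G]
  {W : Q → Type*} [TopologicalSpace (TotalSpace G W)] [∀ x, AddCommGroup (W x)]
  [∀ x, Module ℝ (W x)] [∀ x, TopologicalSpace (W x)] [FiberBundle G W] [VectorBundle ℝ G W]
  [ContMDiffVectorBundle ∞ G W I]

variable (I) in
theorem Bundle.Trivialization.mdifferentiable_aux (u : Trivialization G (π G W))
    [MemTrivializationAtlas u] :
    u.toOpenPartialHomeomorph.MDifferentiable (I.prod 𝓘(ℝ, G)) (I.prod 𝓘(ℝ, G)) :=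
  ⟨(u.contMDiffOn (n := ∞) (IB := I)).mdifferentiableOn (by norm_num),
    (u.contMDiffOn_symm (n := ∞) (IB := I)).mdifferentiableOn (by norm_num)⟩

variable (I) in
/-- The vertical component, in a trivialization `u` of `W`, of a tangent vector to the total
space of `W`: the derivative of the fibre coordinate. -/
noncomputable def Bundle.Trivialization.vert (u : Trivialization G (π G W)) (p : TotalSpace G W) :
    TangentSpace (I.prod 𝓘(ℝ, G)) p →L[ℝ] G :=
  mvfderiv (I.prod 𝓘(ℝ, G)) (fun p' : TotalSpace G W ↦ (u p').2) p

variable (I) in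
/-- The derivative of a trivialization `u` of `W`. -/
noncomputable def Bundle.Trivialization.tangentEquiv (u : Trivialization G (π G W))
    [MemTrivializationAtlas u] {p : TotalSpace G W} (hp : p ∈ u.source) :
    TangentSpace (I.prod 𝓘(ℝ, G)) p ≃L[ℝ] TangentSpace (I.prod 𝓘(ℝ, G)) (u p) :=
  (u.mdifferentiable_aux I).mfderiv hp

theorem Bundle.Trivialization.tangentEquiv_fst (u : Trivialization G (π G W))
    [MemTrivializationAtlas u] {p : TotalSpace G W} (hp : p ∈ u.source)
    (v : TangentSpace (I.prod 𝓘(ℝ, G)) p) :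
    (u.tangentEquiv I hp v).1 = mfderiv (I.prod 𝓘(ℝ, G)) I (π G W) p v := by
  have hu := (u.mdifferentiable_aux I).mdifferentiableAt hp
  have h1 : mfderiv (I.prod 𝓘(ℝ, G)) I (Prod.fst ∘ u) p =
      (mfderiv (I.prod 𝓘(ℝ, G)) I (Prod.fst : Q × G → Q) (u p)).comp
      (mfderiv (I.prod 𝓘(ℝ, G)) (I.prod 𝓘(ℝ, G)) u p) :=
    mfderiv_comp p mdifferentiableAt_fst hu
  have h2 : (Prod.fst ∘ u) =ᶠ[𝓝 p] (π G W) := by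
    filter_upwards [u.open_source.mem_nhds hp] with p' hp'
    exact u.coe_fst hp'
  rw [h2.mfderiv_eq, mfderiv_fst] at h1
  exact (DFunLike.congr_fun h1 v).symm

theorem Bundle.Trivialization.tangentEquiv_snd (u : Trivialization G (π G W))
    [MemTrivializationAtlas u] {p : TotalSpace G W} (hp : p ∈ u.source)
    (v : TangentSpace (I.prod 𝓘(ℝ, G)) p) :
    (u.tangentEquiv I hp v).2 = u.vert I p v := by
  have hu := (u.mdifferentiable_aux I).mdifferentiableAt hp
  have h1 : mfderiv (I.prod 𝓘(ℝ, G)) 𝓘(ℝ, G) (Prod.snd ∘ u) p =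
      (mfderiv (I.prod 𝓘(ℝ, G)) 𝓘(ℝ, G) (Prod.snd : Q × G → G) (u p)).comp
      (mfderiv (I.prod 𝓘(ℝ, G)) (I.prod 𝓘(ℝ, G)) u p) :=
    mfderiv_comp p mdifferentiableAt_snd hu
  rw [mfderiv_snd] at h1
  exact (DFunLike.congr_fun h1 v).symm

/-- The tangent vector at `p` with given base component and given vertical component. -/
noncomputable def Bundle.Trivialization.liftTangent (u : Trivialization G (π G W))
    [MemTrivializationAtlas u] {p : TotalSpace G W} (hp : p ∈ u.source) :
    TangentSpace I p.1 × G →L[ℝ] TangentSpace (I.prod 𝓘(ℝ, G)) p :=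
  { toFun := fun z ↦ (u.tangentEquiv I hp).symm z
    map_add' := fun z w ↦ (u.tangentEquiv I hp).symm.map_add z w
    map_smul' := fun c z ↦ (u.tangentEquiv I hp).symm.map_smul c z
    cont := (u.tangentEquiv I hp).symm.continuous }

theorem Bundle.Trivialization.mfderiv_proj_liftTangent (u : Trivialization G (π G W))
    [MemTrivializationAtlas u] {p : TotalSpace G W} (hp : p ∈ u.source)
    (X : TangentSpace I p.1) (w : G) :
    mfderiv (I.prod 𝓘(ℝ, G)) I (π G W) p (u.liftTangent hp (X, w)) = X := by
  rw [← u.tangentEquiv_fst hp]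
  exact congrArg Prod.fst ((u.tangentEquiv I hp).apply_symm_apply (X, w))

theorem Bundle.Trivialization.vert_liftTangent (u : Trivialization G (π G W))
    [MemTrivializationAtlas u] {p : TotalSpace G W} (hp : p ∈ u.source)
    (X : TangentSpace I p.1) (w : G) : u.vert I p (u.liftTangent hp (X, w)) = w := by
  rw [← u.tangentEquiv_snd hp]
  exact congrArg Prod.snd ((u.tangentEquiv I hp).apply_symm_apply (X, w))

theorem Bundle.Trivialization.liftTangent_eta (u : Trivialization G (π G W))
    [MemTrivializationAtlas u] {p : TotalSpace G W} (hp : p ∈ u.source)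
    (v : TangentSpace (I.prod 𝓘(ℝ, G)) p) :
    u.liftTangent hp (mfderiv (I.prod 𝓘(ℝ, G)) I (π G W) p v, u.vert I p v) = v := by
  rw [← u.tangentEquiv_fst hp, ← u.tangentEquiv_snd hp]
  exact (u.tangentEquiv I hp).symm_apply_apply v

variable {E' H' : Type*} [NormedAddCommGroup E'] [NormedSpace ℝ E'] [TopologicalSpace H']
  {J : ModelWithCorners ℝ E' H'} {N : Type*} [TopologicalSpace N] [ChartedSpace H' N]

/-- The vertical component depends smoothly on the tangent vector. -/
theorem Bundle.Trivialization.contMDiffAt_vert (u : Trivialization G (π G W))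
    [MemTrivializationAtlas u] {f : N → TangentBundle (I.prod 𝓘(ℝ, G)) (TotalSpace G W)} {n : N}
    (hf : ContMDiffAt J (I.prod 𝓘(ℝ, G)).tangent ∞ f n) (hn : (f n).1 ∈ u.source) :
    ContMDiffAt J 𝓘(ℝ, G) ∞ (fun n ↦ u.vert I (f n).1 (f n).2) n := by
  have h1 : ContMDiffOn (I.prod 𝓘(ℝ, G)) 𝓘(ℝ, G) ∞ (fun p : TotalSpace G W ↦ (u p).2) u.source :=
    contMDiff_snd.comp_contMDiffOn (u.contMDiffOn (n := ∞) (IB := I))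
  have h2 := h1.contMDiffOn_tangentMapWithin (m := ∞) (by norm_num)
    u.open_source.uniqueMDiffOn
  have hopen : IsOpen (π (B × G) (TangentSpace (I.prod 𝓘(ℝ, G)) (M := TotalSpace G W)) ⁻¹' u.source) :=
    u.open_source.preimage (FiberBundle.continuous_proj _ _)
  have h3 := (h2.contMDiffAt (hopen.mem_nhds hn)).comp n hf
  have h4 := (contMDiff_snd_tangentBundle_modelSpace G 𝓘(ℝ, G)).contMDiffAt.comp n h3
  refine h4.congr_of_eventuallyEq ?_
  have hc : ContinuousAt (fun n ↦ (f n).1) n :=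
    (FiberBundle.continuous_proj _ _).continuousAt.comp hf.continuousAt
  filter_upwards [hc (u.open_source.mem_nhds hn)] with m hm
  change mfderiv (I.prod 𝓘(ℝ, G)) 𝓘(ℝ, G) (fun p : TotalSpace G W ↦ (u p).2) (f m).1 (f m).2 =
    mfderivWithin (I.prod 𝓘(ℝ, G)) 𝓘(ℝ, G) (fun p : TotalSpace G W ↦ (u p).2) u.source (f m).1
      (f m).2
  rw [mfderivWithin_of_isOpen u.open_source hm]

/-- The tangent vector with given components depends smoothly on these components. -/
theorem Bundle.Trivialization.contMDiffAt_of_vert (u : Trivialization G (π G W))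
    [MemTrivializationAtlas u] {f : N → TangentBundle (I.prod 𝓘(ℝ, G)) (TotalSpace G W)} {n : N}
    (hn : (f n).1 ∈ u.source)
    (h1 : ContMDiffAt J (I.prod 𝓘(ℝ, G)) ∞ (fun n ↦ (f n).1) n)
    (h2 : ContMDiffAt J I.tangent ∞
      (fun n ↦ (⟨(f n).1.1, mfderiv (I.prod 𝓘(ℝ, G)) I (π G W) (f n).1 (f n).2⟩ :
        TangentBundle I Q)) n)
    (h3 : ContMDiffAt J 𝓘(ℝ, G) ∞ (fun n ↦ u.vert I (f n).1 (f n).2) n) :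
    ContMDiffAt J (I.prod 𝓘(ℝ, G)).tangent ∞ f n := by
  have hu := u.contMDiffOn_symm (n := ∞) (IB := I)
  have h4 := hu.contMDiffOn_tangentMapWithin (m := ∞) (by norm_num)
    u.open_target.uniqueMDiffOn
  have hopen : IsOpen (π (B × G) (TangentSpace (I.prod 𝓘(ℝ, G)) (M := Q × G)) ⁻¹' u.target) :=
    u.open_target.preimage (FiberBundle.continuous_proj _ _)
  have h5 : ContMDiffAt J 𝓘(ℝ, G) ∞ (fun n ↦ (u (f n).1).2) n :=
    contMDiffAt_snd.comp n
      (((u.contMDiffOn (n := ∞) (IB := I)).contMDiffAt (u.open_source.mem_nhds hn)).comp n h1)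
  have h6 : ContMDiffAt J 𝓘(ℝ, G).tangent ∞
      (fun n ↦ (⟨(u (f n).1).2, u.vert I (f n).1 (f n).2⟩ : TangentBundle 𝓘(ℝ, G) G)) n := by
    refine contMDiffAt_totalSpace.2 ⟨h5, ?_⟩
    convert! h3 with m
    simp
  have h7 := (contMDiff_equivTangentBundleProd_symm (n := ∞) (I := I) (M := Q) (I' := 𝓘(ℝ, G))
    (M' := G)).contMDiffAt.comp n (h2.prodMk h6)
  have hc : ContinuousAt (fun n ↦ (f n).1) n := h1.continuousAt
  have h8 : ∀ᶠ m in 𝓝 n, (f m).1 ∈ u.source := hc (u.open_source.mem_nhds hn)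
  have key : ∀ {p : TotalSpace G W} (hp : p ∈ u.source) (v : TangentSpace (I.prod 𝓘(ℝ, G)) p),
      tangentMap (I.prod 𝓘(ℝ, G)) (I.prod 𝓘(ℝ, G)) u ⟨p, v⟩ =
        (⟨(p.1, (u p).2), (mfderiv (I.prod 𝓘(ℝ, G)) I (π G W) p v, u.vert I p v)⟩ :
          TangentBundle (I.prod 𝓘(ℝ, G)) (Q × G)) := by
    intro p hp v
    refine TotalSpace.ext (Prod.ext (u.coe_fst hp) rfl) (heq_of_eq ?_)
    exact Prod.ext (u.tangentEquiv_fst hp v) (u.tangentEquiv_snd hp v)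
  have key2 : ∀ {p : TotalSpace G W} (hp : p ∈ u.source) (v : TangentSpace (I.prod 𝓘(ℝ, G)) p),
      tangentMapWithin (I.prod 𝓘(ℝ, G)) (I.prod 𝓘(ℝ, G)) u.toOpenPartialHomeomorph.symm u.target
        (tangentMap (I.prod 𝓘(ℝ, G)) (I.prod 𝓘(ℝ, G)) u ⟨p, v⟩) = ⟨p, v⟩ := by
    intro p hp v
    have hp' : u p ∈ u.target := u.toOpenPartialHomeomorph.map_source hp
    refine TotalSpace.ext (u.toOpenPartialHomeomorph.left_inv hp) (heq_of_eq ?_)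
    change mfderivWithin (I.prod 𝓘(ℝ, G)) (I.prod 𝓘(ℝ, G)) u.toOpenPartialHomeomorph.symm u.target
      (u p) _ = v
    rw [mfderivWithin_of_isOpen u.open_target hp']
    exact (u.tangentEquiv I hp).symm_apply_apply v
  have h9 : (((f n).1.1, (u (f n).1).2) : Q × G) ∈ u.target := by
    have := u.toOpenPartialHomeomorph.map_source hn
    rwa [show ((f n).1.1, (u (f n).1).2) = u (f n).1 from
      (Prod.ext (u.coe_fst hn) rfl : u (f n).1 = ((f n).1.1, (u (f n).1).2)).symm]
  refine ((h4.contMDiffAt (hopen.mem_nhds h9)).comp n h7).congr_of_eventuallyEq ?_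
  filter_upwards [h8] with m hm
  exact ((congrArg _ (key hm (f m).2).symm).trans (key2 hm (f m).2)).symm

/-- A family of continuous linear maps is smooth if all its values are. -/
theorem contMDiffOn_clm_of_apply {E₁ E₂ : Type*} [NormedAddCommGroup E₁] [NormedSpace ℝ E₁]
    [FiniteDimensional ℝ E₁] [NormedAddCommGroup E₂] [NormedSpace ℝ E₂] {f : N → E₁ →L[ℝ] E₂}
    {s : Set N} (h : ∀ y, ContMDiffOn J 𝓘(ℝ, E₂) ∞ (fun x ↦ f x y) s) :
    ContMDiffOn J 𝓘(ℝ, E₁ →L[ℝ] E₂) ∞ f s := by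
  let d := Module.finrank ℝ E₁
  have hd : d = Module.finrank ℝ (Fin d → ℝ) := (Module.finrank_fin_fun ℝ).symm
  let e₁ := ContinuousLinearEquiv.ofFinrankEq hd
  let e₂ := (e₁.arrowCongr (1 : E₂ ≃L[ℝ] E₂)).trans (ContinuousLinearEquiv.piRing (Fin d))
  rw [← Function.id_comp f, ← e₂.symm_comp_self]
  exact e₂.symm.contDiff.contMDiff.comp_contMDiffOn (contMDiffOn_pi_space.mpr fun i ↦ h _)

end TrivDeriv

section Prolongation

variable {B H : Type*} [NormedAddCommGroup B] [NormedSpace ℝ B] [TopologicalSpace H]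
  {I : ModelWithCorners ℝ B H} {Q : Type*} [TopologicalSpace Q] [ChartedSpace H Q]
  [IsManifold I ∞ Q]
  {F : Type*} [NormedAddCommGroup F] [NormedSpace ℝ F]
  {V : Q → Type*} [TopologicalSpace (TotalSpace F V)] [∀ x, AddCommGroup (V x)]
  [∀ x, Module ℝ (V x)] [∀ x, TopologicalSpace (V x)] [FiberBundle F V] [VectorBundle ℝ F V]
  [ContMDiffVectorBundle ∞ F V I]
  {G : Type*} [NormedAddCommGroup G] [NormedSpace ℝ G]
  {W : Q → Type*} [TopologicalSpace (TotalSpace G W)] [∀ x, AddCommGroup (W x)]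
  [∀ x, Module ℝ (W x)] [∀ x, TopologicalSpace (W x)] [FiberBundle G W] [VectorBundle ℝ G W]
  [ContMDiffVectorBundle ∞ G W I]

/-- The fibre at `p` of the prolongation of a Lie algebroid over a bundle `W`, as a subspace: the
pairs `(e, v)` with `e` in the fibre of the algebroid over the base point of `p`, with `v` a
tangent vector at `p`, and with the anchor of `e` equal to the projection of `v`. -/
noncomputable def prolongSubmodule (A : LieAlgebroid I F V) (p : TotalSpace G W) :
    Submodule ℝ (V p.1 × TangentSpace (I.prod 𝓘(ℝ, G)) p) :=
  LinearMap.eqLocus ((A.anchor p.1).toLinearMap ∘ₗ LinearMap.fst ℝ _ _)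
    ((mfderiv (I.prod 𝓘(ℝ, G)) I (π G W) p).toLinearMap ∘ₗ LinearMap.snd ℝ _ _)

variable (G W) in
/-- The fibres of the prolongation of a Lie algebroid over a bundle `W`. -/
def Prolong (A : LieAlgebroid I F V) (p : TotalSpace G W) : Type _ := prolongSubmodule A p

namespace Prolong

variable {A : LieAlgebroid I F V} {p : TotalSpace G W}

noncomputable instance : AddCommGroup (Prolong G W A p) :=
  inferInstanceAs (AddCommGroup (prolongSubmodule A p))
noncomputable instance : Module ℝ (Prolong G W A p) :=
  inferInstanceAs (Module ℝ (prolongSubmodule A p))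
instance : TopologicalSpace (Prolong G W A p) :=
  inferInstanceAs (TopologicalSpace (prolongSubmodule A p))

/-- The component of an element of the prolongation in the algebroid. -/
noncomputable def fst : Prolong G W A p →L[ℝ] V p.1 :=
  (ContinuousLinearMap.fst ℝ _ _).comp (prolongSubmodule A p).subtypeL

/-- The tangent component of an element of the prolongation. -/
noncomputable def snd : Prolong G W A p →L[ℝ] TangentSpace (I.prod 𝓘(ℝ, G)) p :=
  (ContinuousLinearMap.snd ℝ _ _).comp (prolongSubmodule A p).subtypeL

theorem anchor_fst (z : Prolong G W A p) :
    A.anchor p.1 z.fst = mfderiv (I.prod 𝓘(ℝ, G)) I (π G W) p z.snd := z.2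

/-- Construct an element of the prolongation from its components. -/
def mk (e : V p.1) (v : TangentSpace (I.prod 𝓘(ℝ, G)) p)
    (h : A.anchor p.1 e = mfderiv (I.prod 𝓘(ℝ, G)) I (π G W) p v) : Prolong G W A p :=
  ⟨(e, v), h⟩

@[simp] theorem fst_mk (e : V p.1) (v : TangentSpace (I.prod 𝓘(ℝ, G)) p)
    (h : A.anchor p.1 e = mfderiv (I.prod 𝓘(ℝ, G)) I (π G W) p v) :
    (mk (A := A) e v h).fst = e := rfl

@[simp] theorem snd_mk (e : V p.1) (v : TangentSpace (I.prod 𝓘(ℝ, G)) p)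
    (h : A.anchor p.1 e = mfderiv (I.prod 𝓘(ℝ, G)) I (π G W) p v) :
    (mk (A := A) e v h).snd = v := rfl

@[ext] theorem ext {z w : Prolong G W A p} (h₁ : z.fst = w.fst) (h₂ : z.snd = w.snd) :
    z = w := Subtype.ext (Prod.ext h₁ h₂)

/-- The element of the prolongation with given coordinates in trivializations `t`, `u`. -/
noncomputable def ofCoord (A : LieAlgebroid I F V) (t : Trivialization F (π F V))
    [MemTrivializationAtlas t] (u : Trivialization G (π G W)) [MemTrivializationAtlas u]
    {p : TotalSpace G W} (hp : p ∈ u.source) (c : F × G) : Prolong G W A p :=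
  mk (t.symmL ℝ p.1 c.1) (u.liftTangent hp (A.anchor p.1 (t.symmL ℝ p.1 c.1), c.2))
    (u.mfderiv_proj_liftTangent hp _ _).symm

variable (A) in
open Classical in
/-- The pretrivialization of the prolongation given by trivializations `t`, `u`. -/
noncomputable def pretrivialization (t : Trivialization F (π F V)) [MemTrivializationAtlas t]
    (u : Trivialization G (π G W)) [MemTrivializationAtlas u] :
    Pretrivialization (F × G) (π (F × G) (Prolong G W A)) where
  toFun z := (z.1, (t.continuousLinearMapAt ℝ z.1.1 z.2.fst, u.vert I z.1 z.2.snd))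
  invFun y := ⟨y.1, if h : y.1 ∈ u.source then ofCoord A t u h y.2 else 0⟩
  source := Bundle.TotalSpace.proj ⁻¹' (π G W ⁻¹' t.baseSet ∩ u.source)
  target := (π G W ⁻¹' t.baseSet ∩ u.source) ×ˢ Set.univ
  map_source' := fun ⟨_, _⟩ h ↦ ⟨h, Set.mem_univ _⟩
  map_target' := fun ⟨_, _⟩ h ↦ h.1
  left_inv' := fun ⟨p, z⟩ h ↦ by
    have h1 : p.1 ∈ t.baseSet := h.1
    have h2 : p ∈ u.source := h.2
    have h3 : t.symmL ℝ p.1 (t.continuousLinearMapAt ℝ p.1 z.fst) = z.fst := t.symmL_continuousLinearMapAt (R := ℝ) h1 z.fst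
    refine congrArg (TotalSpace.mk p) ?_
    rw [dif_pos h2]
    refine ext h3 ?_
    simp only [ofCoord, snd_mk]
    rw [h3, anchor_fst]
    exact u.liftTangent_eta h2 z.snd
  right_inv' := fun ⟨p, c⟩ ⟨h, _⟩ ↦ by
    have h1 : p.1 ∈ t.baseSet := h.1
    have h2 : p ∈ u.source := h.2
    refine congrArg (Prod.mk p) ?_
    rw [dif_pos h2]
    exact Prod.ext (t.continuousLinearMapAt_symmL (R := ℝ) h1 c.1) (u.vert_liftTangent h2 _ c.2)
  open_target := ((t.open_baseSet.preimage (FiberBundle.continuous_proj G W)).inter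
    u.open_source).prod isOpen_univ
  baseSet := π G W ⁻¹' t.baseSet ∩ u.source
  open_baseSet := (t.open_baseSet.preimage (FiberBundle.continuous_proj G W)).inter u.open_source
  source_eq := rfl
  target_eq := rfl
  proj_toFun _ _ := rfl

instance (t : Trivialization F (π F V)) [MemTrivializationAtlas t]
    (u : Trivialization G (π G W)) [MemTrivializationAtlas u] :
    (pretrivialization A t u).IsLinear ℝ where
  linear p _ :=
    { map_add z z' := by
        refine Prod.ext ?_ ?_
        · exact ((t.continuousLinearMapAt ℝ p.1).comp fst).map_add z z'
        · exact ((u.vert I p).comp snd).map_add z z'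
      map_smul c z := by
        refine Prod.ext ?_ ?_
        · exact ((t.continuousLinearMapAt ℝ p.1).comp fst).map_smul c z
        · exact ((u.vert I p).comp snd).map_smul c z }

variable {E' H' : Type*} [NormedAddCommGroup E'] [NormedSpace ℝ E'] [TopologicalSpace H']
  {J : ModelWithCorners ℝ E' H'} {N : Type*} [TopologicalSpace N] [ChartedSpace H' N]

theorem contMDiffAt_symm (t : Trivialization F (π F V)) [MemTrivializationAtlas t]
    {f : N → Q} {c : N → F} {n : N} (hf : ContMDiffAt J I ∞ f n) (hc : ContMDiffAt J 𝓘(ℝ, F) ∞ c n)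
    (hn : f n ∈ t.baseSet) :
    ContMDiffAt J (I.prod 𝓘(ℝ, F)) ∞
      (fun m ↦ (⟨f m, t.symmL ℝ (f m) (c m)⟩ : TotalSpace F V)) n := by
  have h := (t.contMDiffOn_symm (n := ∞) (IB := I)).contMDiffAt
    (t.open_target.mem_nhds (t.mem_target.2 hn : (f n, c n) ∈ t.target))
  refine (h.comp n (hf.prodMk hc)).congr_of_eventuallyEq ?_
  filter_upwards [hf.continuousAt (t.open_baseSet.mem_nhds hn)] with m hm
  change _ = t.toOpenPartialHomeomorph.symm (f m, c m)
  rw [← t.mk_symm hm (c m), t.symmL_apply hm]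

/-- A tangent vector which is the tangent component of an element of the prolongation with smooth
coordinates depends smoothly on the parameter. -/
theorem contMDiffAt_snd_ofCoord (t : Trivialization F (π F V)) [MemTrivializationAtlas t]
    (u : Trivialization G (π G W)) [MemTrivializationAtlas u]
    {f : N → TangentBundle (I.prod 𝓘(ℝ, G)) (TotalSpace G W)} {c : N → F × G} {n : N}
    (hf : ContMDiffAt J (I.prod 𝓘(ℝ, G)) ∞ (fun m ↦ (f m).1) n)
    (hc : ContMDiffAt J 𝓘(ℝ, F × G) ∞ c n)
    (ht : (f n).1.1 ∈ t.baseSet) (hu : (f n).1 ∈ u.source)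
    (h : ∀ m (hm : (f m).1 ∈ u.source), (f m).2 = (ofCoord A t u hm (c m)).snd) :
    ContMDiffAt J (I.prod 𝓘(ℝ, G)).tangent ∞ f n := by
  have hsrc : ∀ᶠ m in 𝓝 n, (f m).1 ∈ u.source := hf.continuousAt (u.open_source.mem_nhds hu)
  have hb : ContMDiffAt J I ∞ (fun m ↦ (f m).1.1) n :=
    (contMDiff_proj W (n := ∞)).contMDiffAt.comp n hf
  have hc1 : ContMDiffAt J 𝓘(ℝ, F) ∞ (fun m ↦ (c m).1) n :=
    (ContinuousLinearMap.fst ℝ F G).contMDiff.contMDiffAt.comp n hc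
  have hc2 : ContMDiffAt J 𝓘(ℝ, G) ∞ (fun m ↦ (c m).2) n :=
    (ContinuousLinearMap.snd ℝ F G).contMDiff.contMDiffAt.comp n hc
  refine u.contMDiffAt_of_vert hu hf ?_ ?_
  · refine ((A.contMDiff_anchor.contMDiffAt).comp n
      (contMDiffAt_symm t hb hc1 ht)).congr_of_eventuallyEq ?_
    filter_upwards [hsrc] with m hm
    refine congrArg (TotalSpace.mk (f m).1.1) ?_
    rw [h m hm]
    exact u.mfderiv_proj_liftTangent hm _ _
  · refine hc2.congr_of_eventuallyEq ?_
    filter_upwards [hsrc] with m hm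
    rw [h m hm]
    exact u.vert_liftTangent hm _ _

open Classical in
/-- The change of coordinates of the prolongation. -/
noncomputable def coordChange (A : LieAlgebroid I F V) (t t' : Trivialization F (π F V))
    [MemTrivializationAtlas t] [MemTrivializationAtlas t'] (u u' : Trivialization G (π G W))
    [MemTrivializationAtlas u] [MemTrivializationAtlas u'] (p : TotalSpace G W) :
    F × G →L[ℝ] F × G :=
  if h : p ∈ u.source then
    ((t.coordChangeL ℝ t' p.1 : F →L[ℝ] F).comp (ContinuousLinearMap.fst ℝ F G)).prod
      ((u'.vert I p).comp ((u.liftTangent h).comp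
        (((A.anchor p.1).comp ((t.symmL ℝ p.1).comp (ContinuousLinearMap.fst ℝ F G))).prod
          (ContinuousLinearMap.snd ℝ F G))))
  else 0

variable {t t' : Trivialization F (π F V)} [MemTrivializationAtlas t] [MemTrivializationAtlas t']
    {u u' : Trivialization G (π G W)} [MemTrivializationAtlas u] [MemTrivializationAtlas u']

theorem coordChange_apply {p : TotalSpace G W} (hu : p ∈ u.source) (ht : p.1 ∈ t.baseSet)
    (ht' : p.1 ∈ t'.baseSet) (c : F × G) :
    coordChange A t t' u u' p c =
      (t'.continuousLinearMapAt ℝ p.1 (ofCoord A t u hu c).fst, u'.vert I p (ofCoord A t u hu c).snd) := by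
  rw [coordChange, dif_pos hu]
  refine Prod.ext ?_ ?_
  swap
  · rfl
  change t.coordChangeL ℝ t' p.1 c.1 = t'.continuousLinearMapAt ℝ p.1 (t.symmL ℝ p.1 c.1)
  rw [t.coordChangeL_apply t' ⟨ht, ht'⟩, t'.continuousLinearMapAt_apply ℝ, t'.coe_linearMapAt_of_mem ht', t.symmL_apply ht]

theorem coordChange_eq {p : TotalSpace G W}
    (hp : p ∈ (π G W ⁻¹' t.baseSet ∩ u.source) ∩ (π G W ⁻¹' t'.baseSet ∩ u'.source)) (c : F × G) :
    coordChange A t t' u u' p c =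
      (pretrivialization A t' u' ⟨p, (pretrivialization A t u).symm p c⟩).2 := by
  rw [coordChange_apply hp.1.2 hp.1.1 hp.2.1]
  have h : (pretrivialization A t u).symm p c = ofCoord A t u hp.1.2 c := by
    rw [Pretrivialization.symm_apply (pretrivialization A t u)
      (show p ∈ (pretrivialization A t u).baseSet from hp.1) c]
    exact dif_pos hp.1.2
  rw [h]
  rfl

variable [FiniteDimensional ℝ F] [FiniteDimensional ℝ G]

open Classical in
theorem contMDiffOn_coordChange :
    ContMDiffOn (I.prod 𝓘(ℝ, G)) 𝓘(ℝ, F × G →L[ℝ] F × G) ∞ (coordChange A t t' u u')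
      ((π G W ⁻¹' t.baseSet ∩ u.source) ∩ (π G W ⁻¹' t'.baseSet ∩ u'.source)) := by
  refine contMDiffOn_clm_of_apply fun c p hp ↦ ContMDiffAt.contMDiffWithinAt ?_
  have hproj : ContMDiffAt (I.prod 𝓘(ℝ, G)) I ∞ (π G W) p := (contMDiff_proj W).contMDiffAt
  have h1 : ContMDiffAt (I.prod 𝓘(ℝ, G)) 𝓘(ℝ, F) ∞
      (fun p' : TotalSpace G W ↦ (t' ⟨p'.1, t.symmL ℝ p'.1 c.1⟩).2) p := by
    have := (t'.contMDiffOn (n := ∞) (IB := I)).contMDiffAt (t'.open_source.mem_nhds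
      (t'.mem_source.2 hp.2.1 : (⟨p.1, t.symmL ℝ p.1 c.1⟩ : TotalSpace F V) ∈ t'.source))
    exact contMDiffAt_snd.comp p (this.comp p (contMDiffAt_symm t hproj contMDiffAt_const hp.1.1))
  let f : TotalSpace G W → TangentBundle (I.prod 𝓘(ℝ, G)) (TotalSpace G W) := fun p' ↦
    ⟨p', if h : p' ∈ u.source then (ofCoord A t u h c).snd else 0⟩
  have hf : ContMDiffAt (I.prod 𝓘(ℝ, G)) (I.prod 𝓘(ℝ, G)).tangent ∞ f p :=
    contMDiffAt_snd_ofCoord t u (f := f) (c := fun _ ↦ c) contMDiffAt_id contMDiffAt_const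
      hp.1.1 hp.1.2 fun m hm ↦ dif_pos hm
  have h2 := u'.contMDiffAt_vert hf hp.2.2
  have h3 : ContMDiffAt (I.prod 𝓘(ℝ, G)) 𝓘(ℝ, F × G) ∞
      (fun p' ↦ ((t' ⟨p'.1, t.symmL ℝ p'.1 c.1⟩).2, u'.vert I p' (f p').2)) p :=
    h1.prodMk_space h2
  refine h3.congr_of_eventuallyEq ?_
  filter_upwards [((((t.open_baseSet.preimage (FiberBundle.continuous_proj G W)).inter
    u.open_source).inter ((t'.open_baseSet.preimage (FiberBundle.continuous_proj G W)).inter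
    u'.open_source)).mem_nhds hp)] with p' hp'
  rw [coordChange_apply hp'.1.2 hp'.1.1 hp'.2.1]
  refine Prod.ext ?_ ?_
  · change t'.continuousLinearMapAt ℝ p'.1 (t.symmL ℝ p'.1 c.1) = _
    rw [t'.continuousLinearMapAt_apply ℝ, t'.coe_linearMapAt_of_mem hp'.2.1]
  · change _ = u'.vert I p' (f p').2
    simp only [f, dif_pos hp'.1.2]

variable (A G W) in
/-- The prolongation, as a vector prebundle. -/
noncomputable def vectorPrebundle : VectorPrebundle ℝ (F × G) (Prolong G W A) where
  pretrivializationAtlas :=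
    {e | ∃ (t : Trivialization F (π F V)) (_ : MemTrivializationAtlas t)
      (u : Trivialization G (π G W)) (_ : MemTrivializationAtlas u), e = pretrivialization A t u}
  pretrivialization_linear' := by
    rintro _ ⟨t, ht, u, hu, rfl⟩
    infer_instance
  pretrivializationAt p :=
    pretrivialization A (trivializationAt F V p.1) (trivializationAt G W p.1)
  mem_base_pretrivializationAt p := ⟨mem_baseSet_trivializationAt F V p.1,
    FiberBundle.mem_trivializationAt_proj_source⟩
  pretrivialization_mem_atlas p := ⟨_, inferInstance, _, inferInstance, rfl⟩
  exists_coordChange := by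
    rintro _ ⟨t, ht, u, hu, rfl⟩ _ ⟨t', ht', u', hu', rfl⟩
    exact ⟨coordChange A t t' u u', contMDiffOn_coordChange.continuousOn,
      fun p hp c ↦ coordChange_eq hp c⟩
  totalSpaceMk_isInducing := by
    intro p
    let t := trivializationAt F V p.1
    let u := trivializationAt G W p.1
    have ht : p.1 ∈ t.baseSet := mem_baseSet_trivializationAt F V p.1
    have hu : p ∈ u.source := FiberBundle.mem_trivializationAt_proj_source
    let φ : Prolong G W A p → F × G := fun z ↦
      (t.continuousLinearMapAt ℝ p.1 z.fst, u.vert I p z.snd)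
    have hφ : Continuous φ :=
      ((t.continuousLinearMapAt ℝ p.1).continuous.comp fst.continuous).prodMk
        ((u.vert I p).continuous.comp snd.continuous)
    let ψ : F × G → Prolong G W A p := ofCoord A t u hu
    have hψ : Continuous ψ := by
      refine Continuous.subtype_mk (f := fun c : F × G ↦ ((t.symmL ℝ p.1 c.1,
        u.liftTangent hu (A.anchor p.1 (t.symmL ℝ p.1 c.1), c.2)) :
          V p.1 × TangentSpace (I.prod 𝓘(ℝ, G)) p)) ?_ _
      have h1 : Continuous fun c : F × G ↦ t.symmL ℝ p.1 c.1 :=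
        (t.symmL ℝ p.1).continuous.comp continuous_fst
      exact h1.prodMk ((u.liftTangent hu).continuous.comp
        (((A.anchor p.1).continuous.comp h1).prodMk continuous_snd))
    have hψφ : Function.LeftInverse ψ φ := by
      intro z
      have h3 : t.symmL ℝ p.1 (t.continuousLinearMapAt ℝ p.1 z.fst) = z.fst := t.symmL_continuousLinearMapAt (R := ℝ) ht z.fst
      refine ext h3 ?_
      change u.liftTangent hu (A.anchor p.1 (t.symmL ℝ p.1 (t.continuousLinearMapAt ℝ p.1 z.fst)),
        u.vert I p z.snd) = z.snd
      rw [h3, anchor_fst]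
      exact u.liftTangent_eta hu z.snd
    exact isInducing_const_prod.mpr (hψφ.isEmbedding hψ hφ).isInducing

noncomputable instance : TopologicalSpace (TotalSpace (F × G) (Prolong G W A)) :=
  (vectorPrebundle G W A).totalSpaceTopology
noncomputable instance : FiberBundle (F × G) (Prolong G W A) :=
  (vectorPrebundle G W A).toFiberBundle
instance : VectorBundle ℝ (F × G) (Prolong G W A) :=
  (vectorPrebundle G W A).toVectorBundle

instance : (vectorPrebundle G W A).IsContMDiff (I.prod 𝓘(ℝ, G)) ∞ where
  exists_contMDiffCoordChange := by
    rintro _ ⟨t, ht, u, hu, rfl⟩ _ ⟨t', ht', u', hu', rfl⟩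
    exact ⟨coordChange A t t' u u', contMDiffOn_coordChange, fun p hp c ↦ coordChange_eq hp c⟩

instance : ContMDiffVectorBundle ∞ (F × G) (Prolong G W A) (I.prod 𝓘(ℝ, G)) :=
  (vectorPrebundle G W A).contMDiffVectorBundle (I.prod 𝓘(ℝ, G))

theorem trivializationAt_apply (p₀ : TotalSpace G W) (z : TotalSpace (F × G) (Prolong G W A)) :
    trivializationAt (F × G) (Prolong G W A) p₀ z =
      (z.1, ((trivializationAt F V p₀.1).continuousLinearMapAt ℝ z.1.1 z.2.fst,
        (trivializationAt G W p₀.1).vert I z.1 z.2.snd)) := rfl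

/-- A map into the prolongation is smooth if and only if its components are. -/
theorem contMDiffAt_iff {f : N → TotalSpace (F × G) (Prolong G W A)} {n : N} :
    ContMDiffAt J ((I.prod 𝓘(ℝ, G)).prod 𝓘(ℝ, F × G)) ∞ f n ↔
      ContMDiffAt J (I.prod 𝓘(ℝ, F)) ∞ (fun m ↦ (⟨(f m).1.1, (f m).2.fst⟩ : TotalSpace F V)) n ∧
      ContMDiffAt J (I.prod 𝓘(ℝ, G)).tangent ∞
        (fun m ↦ (⟨(f m).1, (f m).2.snd⟩ : TangentBundle (I.prod 𝓘(ℝ, G)) (TotalSpace G W))) n := by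
  set t := trivializationAt F V (f n).1.1
  set u := trivializationAt G W (f n).1.1
  have ht : (f n).1.1 ∈ t.baseSet := mem_baseSet_trivializationAt F V _
  have hu : (f n).1 ∈ u.source := FiberBundle.mem_trivializationAt_proj_source
  have hev : ContinuousAt (fun m ↦ (f m).1) n → ∀ᶠ m in 𝓝 n, (f m).1.1 ∈ t.baseSet ∧
      (f m).1 ∈ u.source := fun h ↦
    h (((t.open_baseSet.preimage (FiberBundle.continuous_proj G W)).inter
      u.open_source).mem_nhds ⟨ht, hu⟩)
  constructor
  · intro h
    obtain ⟨h1, h2⟩ := contMDiffAt_totalSpace.1 h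
    change ContMDiffAt J 𝓘(ℝ, F × G) ∞ (fun m ↦ (t.continuousLinearMapAt ℝ (f m).1.1 (f m).2.fst,
      u.vert I (f m).1 (f m).2.snd)) n at h2
    have h3 : ContMDiffAt J 𝓘(ℝ, F) ∞ (fun m ↦ t.continuousLinearMapAt ℝ (f m).1.1 (f m).2.fst) n :=
      (ContinuousLinearMap.fst ℝ F G).contMDiff.contMDiffAt.comp n h2
    have h4 : ContMDiffAt J 𝓘(ℝ, G) ∞ (fun m ↦ u.vert I (f m).1 (f m).2.snd) n :=
      (ContinuousLinearMap.snd ℝ F G).contMDiff.contMDiffAt.comp n h2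
    have h5 : ContMDiffAt J (I.prod 𝓘(ℝ, F)) ∞
        (fun m ↦ (⟨(f m).1.1, (f m).2.fst⟩ : TotalSpace F V)) n := by
      refine contMDiffAt_totalSpace.2 ⟨(contMDiff_proj W (n := ∞)).contMDiffAt.comp n h1, ?_⟩
      refine h3.congr_of_eventuallyEq ?_
      filter_upwards [hev h1.continuousAt] with m hm
      exact (congrFun (t.coe_linearMapAt_of_mem hm.1) _).symm
    refine ⟨h5, u.contMDiffAt_of_vert hu h1 ?_ h4⟩
    refine (A.contMDiff_anchor.contMDiffAt.comp n h5).congr_of_eventuallyEq ?_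
    exact .of_forall fun m ↦ congrArg (TotalSpace.mk (f m).1.1) (anchor_fst (f m).2).symm
  · rintro ⟨h1, h2⟩
    have h3 : ContMDiffAt J (I.prod 𝓘(ℝ, G)) ∞ (fun m ↦ (f m).1) n := (contMDiffAt_totalSpace.1 h2).1
    refine contMDiffAt_totalSpace.2 ⟨h3, ?_⟩
    have h4 : ContMDiffAt J 𝓘(ℝ, F) ∞ (fun m ↦ t.continuousLinearMapAt ℝ (f m).1.1 (f m).2.fst) n := by
      refine (contMDiffAt_totalSpace.1 h1).2.congr_of_eventuallyEq ?_
      filter_upwards [hev h3.continuousAt] with m hm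
      exact congrFun (t.coe_linearMapAt_of_mem hm.1) _
    have h5 : ContMDiffAt J 𝓘(ℝ, G) ∞ (fun m ↦ u.vert I (f m).1 (f m).2.snd) n :=
      u.contMDiffAt_vert (f := fun m ↦ ⟨(f m).1, (f m).2.snd⟩) h2 hu
    have h6 : ContMDiffAt J 𝓘(ℝ, F × G) ∞ (fun m ↦ (t.continuousLinearMapAt ℝ (f m).1.1 (f m).2.fst,
      u.vert I (f m).1 (f m).2.snd)) n := h4.prodMk_space h5
    exact h6

end Prolong
end Prolongation

section Smooth

variable {B H : Type*} [NormedAddCommGroup B] [NormedSpace ℝ B]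
  [TopologicalSpace H]
  {I : ModelWithCorners ℝ B H} {M : Type*} [TopologicalSpace M] [ChartedSpace H M]
  [IsManifold I ∞ M]
  {E' H' : Type*} [NormedAddCommGroup E'] [NormedSpace ℝ E'] [TopologicalSpace H']
  {J : ModelWithCorners ℝ E' H'} {N : Type*} [TopologicalSpace N] [ChartedSpace H' N]

/-- The derivative of a smooth function in the direction of a smoothly varying vector is smooth. -/
theorem contMDiff_mvfderiv_apply {f : M → ℝ} (hf : ContMDiff I 𝓘(ℝ) ∞ f)
    {X : N → TangentBundle I M} (hX : ContMDiff J I.tangent ∞ X) :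
    ContMDiff J 𝓘(ℝ) ∞ (fun n ↦ mvfderiv I f (X n).1 (X n).2) :=
  (contMDiff_snd_tangentBundle_modelSpace ℝ 𝓘(ℝ)).comp
    ((hf.contMDiff_tangentMap (m := ∞) (by norm_num)).comp hX)

theorem ContMDiff.mdiffAt {F' : Type*} [NormedAddCommGroup F'] [NormedSpace ℝ F'] {f : M → F'}
    (hf : ContMDiff I 𝓘(ℝ, F') ∞ f) (x : M) : MDifferentiableAt I 𝓘(ℝ, F') f x :=
  (hf x).mdifferentiableAt (by norm_num)

variable [FiniteDimensional ℝ B] [T2Space M]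

/-- A smooth function defined near a point coincides near that point with a globally defined
smooth function. -/
theorem exists_contMDiffMap_eventuallyEq {g : M → ℝ} {x : M} {U : Set M} (hU : IsOpen U)
    (hx : x ∈ U) (hg : ContMDiffOn I 𝓘(ℝ) ∞ g U) :
    ∃ φ : C^∞⟮I, M; 𝓘(ℝ), ℝ⟯, ∀ᶠ y in 𝓝 x, φ y = g y := by
  obtain ⟨ψ, hψ⟩ := exists_bump I x (hU.mem_nhds hx)
  refine ⟨⟨fun y ↦ ψ y * g y, contMDiff_of_tsupport fun y hy ↦ ?_⟩, ?_⟩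
  · have hy' : y ∈ U := hψ (tsupport_mul_subset_left hy)
    exact ψ.contMDiff.contMDiffAt.mul (hg.contMDiffAt (hU.mem_nhds hy'))
  · filter_upwards [ψ.eventuallyEq_one] with y hy
    change ψ y * g y = g y
    rw [hy, Pi.one_apply, one_mul]

/-- A tangent vector which annihilates all smooth functions is zero. -/
theorem tangent_eq_zero {x : M} {v : TangentSpace I x}
    (h : ∀ φ : C^∞⟮I, M; 𝓘(ℝ), ℝ⟯, mvfderiv I φ x v = 0) : v = 0 := by
  have hinv : (mfderiv I 𝓘(ℝ, B) (extChartAt I x) x).IsInvertible :=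
    isInvertible_mfderiv_extChartAt (mem_extChartAt_source x)
  by_contra hv
  let w : B := mfderiv I 𝓘(ℝ, B) (extChartAt I x) x v
  have hw : w ≠ 0 := fun h0 ↦ hv (hinv.injective (h0.trans (map_zero _).symm))
  obtain ⟨l, hl⟩ : ∃ l : B →L[ℝ] ℝ, l w ≠ 0 := SeparatingDual.exists_ne_zero (R := ℝ) hw
  have hl' : ContMDiff 𝓘(ℝ, B) 𝓘(ℝ) ∞ l := l.contMDiff
  obtain ⟨φ, hφ⟩ := exists_contMDiffMap_eventuallyEq (I := I) (g := l ∘ extChartAt I x)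
    (isOpen_extChartAt_source (I := I) x) (mem_extChartAt_source x)
    (hl'.comp_contMDiffOn (by simpa using contMDiffOn_extChartAt (I := I) (x := x) (n := ∞)))
  have h1 : mvfderiv I φ x = l.comp (mfderiv I 𝓘(ℝ, B) (extChartAt I x) x) := by
    have h2 : mfderiv I 𝓘(ℝ) φ x = mfderiv I 𝓘(ℝ) (l ∘ extChartAt I x) x :=
      Filter.EventuallyEq.mfderiv_eq hφ
    have h3 : mfderiv I 𝓘(ℝ) (l ∘ extChartAt I x) x =
        (mfderiv 𝓘(ℝ, B) 𝓘(ℝ) l (extChartAt I x x)).comp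
          (mfderiv I 𝓘(ℝ, B) (extChartAt I x) x) :=
      mfderiv_comp x (hl'.mdiffAt _) (mdifferentiableAt_extChartAt (mem_chart_source H x))
    have h4 : mfderiv 𝓘(ℝ, B) 𝓘(ℝ) l (extChartAt I x x) = l := by
      rw [mfderiv_eq_fderiv]
      exact l.fderiv
    rw [h4] at h3
    exact h2.trans h3
  refine hl ?_
  have := h φ
  rw [h1] at this
  exact this

end Smooth

section Tensorial

variable {B H : Type*} [NormedAddCommGroup B] [NormedSpace ℝ B] [FiniteDimensional ℝ B]
  [TopologicalSpace H]
  {I : ModelWithCorners ℝ B H} {M : Type*} [TopologicalSpace M] [ChartedSpace H M]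
  [IsManifold I ∞ M] [T2Space M]
  {F : Type*} [NormedAddCommGroup F] [NormedSpace ℝ F] [FiniteDimensional ℝ F]
  {V : M → Type*} [TopologicalSpace (TotalSpace F V)] [∀ x, AddCommGroup (V x)]
  [∀ x, Module ℝ (V x)] [∀ x, TopologicalSpace (V x)] [FiberBundle F V] [VectorBundle ℝ F V]
  [ContMDiffVectorBundle ∞ F V I]

/-- Near a given point, a section is a combination of sections with constant coordinates. -/
theorem exists_expansion (x : M) (σ : Cₛ^∞⟮I; F, V⟯) :
    ∃ (ψ : C^∞⟮I, M; 𝓘(ℝ), ℝ⟯) (n : ℕ) (c : Fin n → F) (g : Fin n → C^∞⟮I, M; 𝓘(ℝ), ℝ⟯),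
      (∀ᶠ y in 𝓝 x, ψ y = 1) ∧
      σ.funSMul ψ = ∑ i, (constSection I F V x (c i)).funSMul (g i) := by
  set b := Module.finBasis ℝ F
  set t := trivializationAt F V x
  set θ := bundleBump I F V x
  have hθ : ContMDiff I 𝓘(ℝ) ∞ θ := θ.contMDiff
  have hg : ∀ i, ContMDiff I 𝓘(ℝ) ∞ fun y ↦ θ y * b.coord i (t ⟨y, σ y⟩).2 := by
    intro i
    refine contMDiff_of_tsupport fun y hy ↦ ?_
    have hy' : y ∈ t.baseSet := tsupport_bundleBump I F V x (tsupport_mul_subset_left hy)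
    refine hθ.contMDiffAt.mul ?_
    have h1 : ContMDiffAt I 𝓘(ℝ, F) ∞ (fun y ↦ (t ⟨y, σ y⟩).2) y :=
      (t.contMDiffAt_section_iff hy').1 (σ.contMDiff y)
    exact (LinearMap.toContinuousLinearMap (b.coord i)).contMDiff.contMDiffAt.comp y h1
  refine ⟨⟨fun y ↦ θ y * θ y, hθ.mul hθ⟩, _, b, fun i ↦ ⟨_, hg i⟩, ?_, ?_⟩
  · filter_upwards [θ.eventuallyEq_one] with y hy
    change θ y * θ y = 1
    rw [hy, Pi.one_apply, one_mul]
  · ext y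
    change (θ y * θ y) • σ y = _
    have hs : ∀ s : Fin (Module.finrank ℝ F) → Cₛ^∞⟮I; F, V⟯, (∑ i, s i) y = ∑ i, s i y := fun s ↦ by
      rw [← ContMDiffSection.coeAddHom_apply, map_sum, Finset.sum_apply]
      rfl
    rw [hs]
    change _ = ∑ i, (θ y * b.coord i (t ⟨y, σ y⟩).2) • (θ y • t.symm y (b i))
    by_cases hy : y ∈ t.baseSet
    · have h1 : ∀ i, t.symm y (b i) = t.symmL ℝ y (b i) := fun i ↦ (t.symmL_apply hy _).symm
      simp only [h1, smul_smul]
      rw [Finset.sum_congr rfl (g := fun i ↦ (θ y * θ y) •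
        t.symmL ℝ y ((b.repr (t ⟨y, σ y⟩).2 i) • b i))]
      · rw [← Finset.smul_sum, ← map_sum, b.sum_repr]
        congr 1
        rw [t.symmL_apply hy]
        exact (t.symm_apply_apply_mk hy (σ y)).symm
      · intro i _
        rw [map_smul, smul_smul]
        congr 1
        simp only [Module.Basis.coord_apply]
        ring
    · have h0 : θ y = 0 := by
        by_contra h
        exact hy (tsupport_bundleBump I F V x (subset_tsupport _ h))
      simp [h0]

/-- A tensorial operation which vanishes on sections with constant coordinates is zero. -/
theorem eq_zero_of_tensorial {N : Type*} [AddCommGroup N] [Module ℝ N]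
    (T : Cₛ^∞⟮I; F, V⟯ → N) (x : M) (hadd : ∀ σ τ, T (σ + τ) = T σ + T τ)
    (hsmul : ∀ (f : C^∞⟮I, M; 𝓘(ℝ), ℝ⟯) σ, T (σ.funSMul f) = f x • T σ)
    (h0 : ∀ c, T (constSection I F V x c) = 0) (σ : Cₛ^∞⟮I; F, V⟯) : T σ = 0 := by
  obtain ⟨ψ, n, c, g, hψ, h⟩ := exists_expansion x σ
  have h1 : T (σ.funSMul ψ) = T σ := by rw [hsmul, hψ.self_of_nhds, one_smul]
  rw [← h1, h]
  change AddMonoidHom.mk' T hadd _ = 0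
  rw [map_sum]
  refine Finset.sum_eq_zero fun i _ ↦ ?_
  change T _ = 0
  rw [hsmul, h0, smul_zero]

variable (I F) in
theorem constSection_add (x : M) (c d : F) :
    constSection I F V x (c + d) = constSection I F V x c + constSection I F V x d := by
  ext y
  change bundleBump I F V x y • (trivializationAt F V x).symm y (c + d) =
    bundleBump I F V x y • (trivializationAt F V x).symm y c +
    bundleBump I F V x y • (trivializationAt F V x).symm y d
  by_cases hy : y ∈ (trivializationAt F V x).baseSet
  · simp only [← (trivializationAt F V x).symmL_apply (R := ℝ) hy, map_add, smul_add]
  · have h0 : bundleBump I F V x y = 0 := by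
      by_contra h
      exact hy (tsupport_bundleBump I F V x (subset_tsupport _ h))
    simp [h0]

variable (I F) in
theorem constSection_smul (x : M) (r : ℝ) (c : F) :
    constSection I F V x (r • c) = r • constSection I F V x c := by
  ext y
  change bundleBump I F V x y • (trivializationAt F V x).symm y (r • c) =
    r • bundleBump I F V x y • (trivializationAt F V x).symm y c
  by_cases hy : y ∈ (trivializationAt F V x).baseSet
  · simp only [← (trivializationAt F V x).symmL_apply (R := ℝ) hy, map_smul]
    rw [smul_comm]
  · have h0 : bundleBump I F V x y = 0 := by
      by_contra h
      exact hy (tsupport_bundleBump I F V x (subset_tsupport _ h))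
    simp [h0]

variable (I F) in
theorem sectionThrough_add {x : M} (v w : V x) :
    sectionThrough I F (v + w) = sectionThrough I F v + sectionThrough I F w := by
  rw [sectionThrough, sectionThrough, sectionThrough, ← constSection_add]
  congr 1
  exact ((trivializationAt F V x).linear ℝ (mem_baseSet_trivializationAt F V x)).map_add v w

variable (I F) in
theorem sectionThrough_smul {x : M} (r : ℝ) (v : V x) :
    sectionThrough I F (r • v) = r • sectionThrough I F v := by
  rw [sectionThrough, sectionThrough, ← constSection_smul]
  congr 1
  exact ((trivializationAt F V x).linear ℝ (mem_baseSet_trivializationAt F V x)).map_smul r v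

theorem sectionThrough_constSection (x : M) (c : F) :
    sectionThrough I F (constSection I F V x c x) = constSection I F V x c := by
  have hx := mem_baseSet_trivializationAt F V x
  rw [sectionThrough, (constSection_eventuallyEq I F x c).self_of_nhds.2]
  congr 1
  rw [(trivializationAt F V x).apply_mk_symm hx]

end Tensorial

section LieAlgebroidLemmas

variable {B H : Type*} [NormedAddCommGroup B] [NormedSpace ℝ B]
  [TopologicalSpace H]
  {I : ModelWithCorners ℝ B H} {M : Type*} [TopologicalSpace M] [ChartedSpace H M]
  [IsManifold I ∞ M]
  {F : Type*} [NormedAddCommGroup F] [NormedSpace ℝ F]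
  {V : M → Type*} [TopologicalSpace (TotalSpace F V)] [∀ x, AddCommGroup (V x)]
  [∀ x, Module ℝ (V x)] [∀ x, TopologicalSpace (V x)] [FiberBundle F V] [VectorBundle ℝ F V]
  [ContMDiffVectorBundle ∞ F V I]

namespace LieAlgebroid

/-- The derivative of a smooth function along a section of a Lie algebroid. -/
noncomputable def deriv (A : LieAlgebroid I F V) (σ : Cₛ^∞⟮I; F, V⟯)
    (f : C^∞⟮I, M; 𝓘(ℝ), ℝ⟯) : C^∞⟮I, M; 𝓘(ℝ), ℝ⟯ :=
  ⟨fun x ↦ mvfderiv I f x (A.anchor x (σ x)),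
    contMDiff_mvfderiv_apply f.contMDiff (A.contMDiff_anchor.comp σ.contMDiff)⟩

variable (A : LieAlgebroid I F V) (σ τ υ : Cₛ^∞⟮I; F, V⟯)

theorem leibniz' (f : C^∞⟮I, M; 𝓘(ℝ), ℝ⟯) :
    A.bracket σ (τ.funSMul f) = (A.bracket σ τ).funSMul f + τ.funSMul (A.deriv σ f) := by
  ext x
  exact A.leibniz f σ τ x

theorem bracket_neg : A.bracket σ (-τ) = - A.bracket σ τ := by
  have := A.bracket_smul (-1) σ τ
  simpa using this

theorem jacobi' : A.bracket (A.bracket σ τ) υ =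
    A.bracket σ (A.bracket τ υ) - A.bracket τ (A.bracket σ υ) := by
  have h := A.jacobi σ τ υ
  rw [A.bracket_skew (A.bracket τ υ), A.bracket_skew υ, A.bracket_skew (-_), A.bracket_neg] at h
  rw [neg_neg, add_assoc] at h
  rw [eq_neg_of_add_eq_zero_left h]
  abel

/-- The anchor is a homomorphism of Lie algebras. -/
theorem deriv_bracket [FiniteDimensional ℝ B] [T2Space M] (f : C^∞⟮I, M; 𝓘(ℝ), ℝ⟯) (x : M) :
    A.deriv (A.bracket σ τ) f x = A.deriv σ (A.deriv τ f) x - A.deriv τ (A.deriv σ f) x := by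
  by_cases h : ∃ v : V x, v ≠ 0
  · obtain ⟨v, hv⟩ := h
    set υ : Cₛ^∞⟮I; F, V⟯ := sectionThrough I F v
    have h1 : υ x = v := sectionThrough_apply I F v
    have h2 := congrArg (fun s : Cₛ^∞⟮I; F, V⟯ ↦ s x) (A.jacobi' σ τ (υ.funSMul f))
    have h3 := congrArg (fun s : Cₛ^∞⟮I; F, V⟯ ↦ s x) (A.jacobi' σ τ υ)
    simp only [leibniz', A.bracket_add] at h2
    change f x • A.bracket (A.bracket σ τ) υ x + A.deriv (A.bracket σ τ) f x • υ x =
      ((f x • A.bracket σ (A.bracket τ υ) x + A.deriv σ f x • A.bracket τ υ x) +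
        (A.deriv τ f x • A.bracket σ υ x + A.deriv σ (A.deriv τ f) x • υ x)) -
      ((f x • A.bracket τ (A.bracket σ υ) x + A.deriv τ f x • A.bracket σ υ x) +
        (A.deriv σ f x • A.bracket τ υ x + A.deriv τ (A.deriv σ f) x • υ x)) at h2
    change A.bracket (A.bracket σ τ) υ x =
      A.bracket σ (A.bracket τ υ) x - A.bracket τ (A.bracket σ υ) x at h3
    rw [h3, h1] at h2
    have h4 : (A.deriv (A.bracket σ τ) f x - (A.deriv σ (A.deriv τ f) x -
        A.deriv τ (A.deriv σ f) x)) • v = 0 := by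
      rw [← sub_eq_zero] at h2
      rw [← h2]
      module
    exact sub_eq_zero.1 ((smul_eq_zero.1 h4).resolve_right hv)
  · push Not at h
    have h1 : ∀ (σ : Cₛ^∞⟮I; F, V⟯) (g : C^∞⟮I, M; 𝓘(ℝ), ℝ⟯), A.deriv σ g x = 0 := by
      intro σ g
      change mvfderiv I g x (A.anchor x (σ x)) = 0
      rw [h (σ x), map_zero, map_zero]
    simp [h1]

end LieAlgebroid

variable (I M) in
/-- The tangent bundle as a Lie algebroid. -/
noncomputable def tangentLieAlgebroid [CompleteSpace B] :
    LieAlgebroid I B (TangentSpace I : M → Type _) where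
  anchor _ := ContinuousLinearMap.id ℝ _
  contMDiff_anchor := contMDiff_id
  bracket X Y := ⟨mlieBracket I X Y, fun x ↦ by
    have : IsManifold I (((⊤ : ℕ∞) : WithTop ℕ∞) + 1) M := by
      change IsManifold I ∞ M; infer_instance
    have : IsManifold I (minSmoothness ℝ 2) M := by
      rw [minSmoothness_of_isRCLikeNormedField]
      exact IsManifold.of_le (n := ∞) (by norm_cast)
    exact ContMDiffAt.mlieBracket_vectorField (m := ⊤) (n := ⊤) (X.contMDiff x) (Y.contMDiff x)
      (by simp)⟩
  bracket_skew X Y := by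
    ext x
    exact mlieBracket_swap_apply
  bracket_add X Y Z := by
    ext x
    exact mlieBracket_add_right (Y.contMDiff.mdifferentiable (by norm_num) x)
      (Z.contMDiff.mdifferentiable (by norm_num) x)
  bracket_smul c X Y := by
    ext x
    exact mlieBracket_const_smul_right (Y.contMDiff.mdifferentiable (by norm_num) x)
  jacobi X Y Z := by
    ext x
    have : IsManifold I (minSmoothness ℝ 3) M := by
      rw [minSmoothness_of_isRCLikeNormedField]
      exact IsManifold.of_le (n := ∞) (by norm_cast)
    have h2 : minSmoothness ℝ 2 ≤ (∞ : WithTop ℕ∞) := by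
      rw [minSmoothness_of_isRCLikeNormedField]
      norm_cast
    have h := leibniz_identity_mlieBracket_apply ((X.contMDiff x).of_le h2)
      ((Y.contMDiff x).of_le h2) ((Z.contMDiff x).of_le h2)
    have : IsManifold I (((⊤ : ℕ∞) : WithTop ℕ∞) + 1) M := by
      change IsManifold I ∞ M; infer_instance
    have : IsManifold I (minSmoothness ℝ 2) M := by
      rw [minSmoothness_of_isRCLikeNormedField]
      exact IsManifold.of_le (n := ∞) (by norm_cast)
    have hXZ := (ContMDiffAt.mlieBracket_vectorField (m := ⊤) (n := ⊤) (X.contMDiff x)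
      (Z.contMDiff x) (by simp)).mdifferentiableAt (by norm_num)
    have h3 := mlieBracket_const_smul_right (V := Y) (c := (-1 : ℝ)) hXZ
    rw [neg_one_smul, neg_one_smul] at h3
    change mlieBracket I (mlieBracket I X Y) Z x + mlieBracket I (mlieBracket I Y Z) X x +
      mlieBracket I (mlieBracket I Z X) Y x = 0
    rw [mlieBracket_swap_apply (V := mlieBracket I Y Z), h,
      mlieBracket_swap_apply (V := mlieBracket I Z X), mlieBracket_swap (V := Z), h3]
    abel
  leibniz f X Y x := by
    have := mlieBracket_smul_right (I := I) (V := X) (W := Y) (f := f) (x := x)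
      (f.contMDiff.mdiffAt x) (Y.contMDiff.mdifferentiable (by norm_num) x)
    exact this.trans (add_comm _ _)

end LieAlgebroidLemmas

/-- The total space of a vector bundle over a Hausdorff base is Hausdorff. -/
instance {M : Type*} [TopologicalSpace M] [T2Space M] {F : Type*}
    [NormedAddCommGroup F] {V : M → Type*} [TopologicalSpace (TotalSpace F V)]
    [∀ x, TopologicalSpace (V x)] [FiberBundle F V] : T2Space (TotalSpace F V) :=
  t2Space_totalSpace

section CoordDeriv

variable {B H : Type*} [NormedAddCommGroup B] [NormedSpace ℝ B] [TopologicalSpace H]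
  {I : ModelWithCorners ℝ B H} {M : Type*} [TopologicalSpace M] [ChartedSpace H M]
  {F : Type*} [NormedAddCommGroup F] [NormedSpace ℝ F]
  {V : M → Type*} [TopologicalSpace (TotalSpace F V)] [∀ x, AddCommGroup (V x)]
  [∀ x, Module ℝ (V x)] [∀ x, TopologicalSpace (V x)] [FiberBundle F V] [VectorBundle ℝ F V]
  {E' H' : Type*} [NormedAddCommGroup E'] [NormedSpace ℝ E'] [TopologicalSpace H']
  (J : ModelWithCorners ℝ E' H') {N : Type*} [TopologicalSpace N] [ChartedSpace H' N]

variable (F) in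
/-- The derivative at `n` of the coordinates of a section `s` of `V` along a map `f : N → M`, in
the preferred trivialization of `V` at `f n`. -/
noncomputable def coordDeriv (f : N → M) (s : ∀ n, V (f n)) (n : N) : TangentSpace J n →L[ℝ] F :=
  mvfderiv J (fun m ↦ (trivializationAt F V (f n) ⟨f m, s m⟩).2) n

variable {J} {f : N → M} {s s' : ∀ n, V (f n)} {n : N}

theorem mdifferentiableAt_coord
    (hs : ContMDiff J (I.prod 𝓘(ℝ, F)) ∞ (fun n ↦ (⟨f n, s n⟩ : TotalSpace F V))) :
    MDifferentiableAt J 𝓘(ℝ, F) (fun m ↦ (trivializationAt F V (f n) ⟨f m, s m⟩).2) n :=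
  (contMDiffAt_totalSpace.1 (hs n)).2.mdifferentiableAt (by norm_num)

theorem eventually_mem_baseSet
    (hs : ContMDiff J (I.prod 𝓘(ℝ, F)) ∞ (fun n ↦ (⟨f n, s n⟩ : TotalSpace F V))) :
    ∀ᶠ m in 𝓝 n, f m ∈ (trivializationAt F V (f n)).baseSet :=
  (contMDiffAt_totalSpace.1 (hs n)).1.continuousAt
    ((trivializationAt F V (f n)).open_baseSet.mem_nhds (mem_baseSet_trivializationAt F V (f n)))

theorem coordDeriv_congr (h : ∀ᶠ m in 𝓝 n, s m = s' m) :
    coordDeriv F J f s n = coordDeriv F J f s' n := by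
  have h1 : (fun m ↦ (trivializationAt F V (f n) ⟨f m, s m⟩).2) =ᶠ[𝓝 n]
      fun m ↦ (trivializationAt F V (f n) ⟨f m, s' m⟩).2 := by
    filter_upwards [h] with m hm
    rw [hm]
  exact h1.mfderiv_eq

theorem coordDeriv_add
    (hs : ContMDiff J (I.prod 𝓘(ℝ, F)) ∞ (fun n ↦ (⟨f n, s n⟩ : TotalSpace F V)))
    (hs' : ContMDiff J (I.prod 𝓘(ℝ, F)) ∞ (fun n ↦ (⟨f n, s' n⟩ : TotalSpace F V))) :
    coordDeriv F J f (fun m ↦ s m + s' m) n = coordDeriv F J f s n + coordDeriv F J f s' n := by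
  rw [coordDeriv, coordDeriv, coordDeriv,
    ← mvfderiv_add (mdifferentiableAt_coord hs) (mdifferentiableAt_coord hs')]
  refine Filter.EventuallyEq.mfderiv_eq ?_
  filter_upwards [eventually_mem_baseSet hs (n := n)] with m hm
  exact ((trivializationAt F V (f n)).linear ℝ hm).map_add _ _

theorem coordDeriv_smul {g : N → ℝ} (hg : MDifferentiableAt J 𝓘(ℝ) g n)
    (hs : ContMDiff J (I.prod 𝓘(ℝ, F)) ∞ (fun n ↦ (⟨f n, s n⟩ : TotalSpace F V)))
    (v : TangentSpace J n) :
    coordDeriv F J f (fun m ↦ g m • s m) n v = g n • coordDeriv F J f s n v +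
      mvfderiv J g n v • (trivializationAt F V (f n)).continuousLinearMapAt ℝ (f n) (s n) := by
  have h1 : coordDeriv F J f (fun m ↦ g m • s m) n =
      mvfderiv J (g • fun m ↦ (trivializationAt F V (f n) ⟨f m, s m⟩).2) n := by
    refine Filter.EventuallyEq.mfderiv_eq ?_
    filter_upwards [eventually_mem_baseSet hs (n := n)] with m hm
    exact ((trivializationAt F V (f n)).linear ℝ hm).map_smul _ _
  rw [h1, mvfderiv_smul hg (mdifferentiableAt_coord hs), Trivialization.continuousLinearMapAt_apply,
    Trivialization.coe_linearMapAt_of_mem _ (mem_baseSet_trivializationAt F V (f n))]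
  rfl

theorem coordDeriv_comp {σ : ∀ x, V x}
    (hσ : ContMDiff I (I.prod 𝓘(ℝ, F)) ∞ (fun x ↦ (⟨x, σ x⟩ : TotalSpace F V)))
    (hf : MDifferentiableAt J I f n) (v : TangentSpace J n) :
    coordDeriv F J f (fun m ↦ σ (f m)) n v =
      coordDeriv F I (fun x ↦ x) σ (f n) (mfderiv J I f n v) := by
  have h := mfderiv_comp n (mdifferentiableAt_coord (f := fun x : M ↦ x) hσ (n := f n)) hf
  exact DFunLike.congr_fun h v

theorem symmL_continuousLinearMapAt_self {x : M} (v : V x) :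
    (trivializationAt F V x).symmL ℝ x ((trivializationAt F V x).continuousLinearMapAt ℝ x v) = v :=
  (trivializationAt F V x).symmL_continuousLinearMapAt (mem_baseSet_trivializationAt F V x) v

variable [FiniteDimensional ℝ B] [IsManifold I ∞ M] [T2Space M] [ContMDiffVectorBundle ∞ F V I]

theorem coordDeriv_constSection (x : M) (c : F) :
    coordDeriv F I (fun y ↦ y) (constSection I F V x c) x = 0 := by
  have h1 : coordDeriv F I (fun y ↦ y) (constSection I F V x c) x =
      mvfderiv I (fun _ : M ↦ c) x := by
    refine Filter.EventuallyEq.mfderiv_eq ?_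
    filter_upwards [constSection_eventuallyEq I F (V := V) x c] with y hy
    rw [hy.2, (trivializationAt F V x).apply_mk_symm hy.1]
  rw [h1, mvfderiv_const]

end CoordDeriv

section BracketFormula

variable {B H : Type*} [NormedAddCommGroup B] [NormedSpace ℝ B] [FiniteDimensional ℝ B]
  [TopologicalSpace H]
  {I : ModelWithCorners ℝ B H} {Q : Type*} [TopologicalSpace Q] [ChartedSpace H Q]
  [IsManifold I ∞ Q] [T2Space Q]
  {F : Type*} [NormedAddCommGroup F] [NormedSpace ℝ F] [FiniteDimensional ℝ F]
  {V : Q → Type*} [TopologicalSpace (TotalSpace F V)] [∀ x, AddCommGroup (V x)]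
  [∀ x, Module ℝ (V x)] [∀ x, TopologicalSpace (V x)] [FiberBundle F V] [VectorBundle ℝ F V]
  [ContMDiffVectorBundle ∞ F V I]

/-- The part of the bracket formula which does not depend on derivatives. -/
noncomputable def LieAlgebroid.constBracket (A : LieAlgebroid I F V) {x : Q} (v w : V x) : V x :=
  A.bracket (sectionThrough I F v) (sectionThrough I F w) x

namespace LieAlgebroid

variable (A : LieAlgebroid I F V)

theorem constBracket_skew {x : Q} (v w : V x) : A.constBracket v w = - A.constBracket w v := by
  rw [constBracket, A.bracket_skew]
  rfl

theorem constBracket_add {x : Q} (v w w' : V x) :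
    A.constBracket v (w + w') = A.constBracket v w + A.constBracket v w' := by
  rw [constBracket, sectionThrough_add, A.bracket_add]
  rfl

theorem constBracket_smul {x : Q} (r : ℝ) (v w : V x) :
    A.constBracket v (r • w) = r • A.constBracket v w := by
  rw [constBracket, sectionThrough_smul, A.bracket_smul]
  rfl

/-- The bracket of a Lie algebroid in terms of coordinates in a trivialization. -/
theorem bracket_eq (σ τ : Cₛ^∞⟮I; F, V⟯) (x : Q) :
    A.bracket σ τ x = A.constBracket (σ x) (τ x) + (trivializationAt F V x).symmL ℝ x
      (coordDeriv F I (fun y ↦ y) τ x (A.anchor x (σ x)) -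
        coordDeriv F I (fun y ↦ y) σ x (A.anchor x (τ x))) := by
  let R : Cₛ^∞⟮I; F, V⟯ → Cₛ^∞⟮I; F, V⟯ → V x := fun σ τ ↦
    A.bracket σ τ x - (A.constBracket (σ x) (τ x) + (trivializationAt F V x).symmL ℝ x
      (coordDeriv F I (fun y ↦ y) τ x (A.anchor x (σ x)) -
        coordDeriv F I (fun y ↦ y) σ x (A.anchor x (τ x))))
  have hskew : ∀ σ τ, R σ τ = - R τ σ := by
    intro σ τ
    have h1 : A.bracket σ τ x = - A.bracket τ σ x := by
      rw [A.bracket_skew]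
      rfl
    simp only [R]
    rw [h1, A.constBracket_skew (σ x), ← neg_sub (coordDeriv F I (fun y ↦ y) σ x _), map_neg]
    abel
  have hadd : ∀ σ τ τ', R σ (τ + τ') = R σ τ + R σ τ' := by
    intro σ τ τ'
    have h1 : coordDeriv F I (fun y ↦ y) (τ + τ' : Cₛ^∞⟮I; F, V⟯) x =
        coordDeriv F I (fun y ↦ y) τ x + coordDeriv F I (fun y ↦ y) τ' x :=
      coordDeriv_add τ.contMDiff τ'.contMDiff
    have h2 : (τ + τ' : Cₛ^∞⟮I; F, V⟯) x = τ x + τ' x := rfl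
    have h3 : A.bracket σ (τ + τ') x = A.bracket σ τ x + A.bracket σ τ' x := by
      rw [A.bracket_add]
      rfl
    simp only [R, h1, h2, h3, A.constBracket_add, map_add, map_sub, add_apply]
    abel
  have hsmul : ∀ σ (f : C^∞⟮I, Q; 𝓘(ℝ), ℝ⟯) τ, R σ (τ.funSMul f) = f x • R σ τ := by
    intro σ f τ
    have h1 := coordDeriv_smul (f := fun y : Q ↦ y) (f.contMDiff.mdiffAt x) τ.contMDiff
      (A.anchor x (σ x))
    have h2 : (τ.funSMul f) x = f x • τ x := rfl
    change coordDeriv F I (fun y ↦ y) (τ.funSMul f) x (A.anchor x (σ x)) = _ at h1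
    simp only [R, h1, h2, A.leibniz, A.constBracket_smul, map_add, map_sub, map_smul,
      symmL_continuousLinearMapAt_self]
    module
  have hconst : ∀ c d, R (constSection I F V x c) (constSection I F V x d) = 0 := by
    intro c d
    simp only [R, coordDeriv_constSection, constBracket, sectionThrough_constSection]
    simp
  have hR : R σ τ = 0 := by
    refine eq_zero_of_tensorial (R σ) x (hadd σ) (hsmul σ) (fun d ↦ ?_) τ
    rw [hskew, neg_eq_zero]
    exact eq_zero_of_tensorial (R _) x (hadd _) (hsmul _) (fun c ↦ hconst d c) σ
  exact sub_eq_zero.1 hR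

end LieAlgebroid

end BracketFormula

section SectionInduction

variable {B H : Type*} [NormedAddCommGroup B] [NormedSpace ℝ B] [FiniteDimensional ℝ B]
  [TopologicalSpace H]
  {I : ModelWithCorners ℝ B H} {M : Type*} [TopologicalSpace M] [ChartedSpace H M]
  [IsManifold I ∞ M] [T2Space M]
  {F : Type*} [NormedAddCommGroup F] [NormedSpace ℝ F] [FiniteDimensional ℝ F]
  {V : M → Type*} [TopologicalSpace (TotalSpace F V)] [∀ x, AddCommGroup (V x)]
  [∀ x, Module ℝ (V x)] [∀ x, TopologicalSpace (V x)] [FiberBundle F V] [VectorBundle ℝ F V]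
  [ContMDiffVectorBundle ∞ F V I]

/-- A local property of sections which is stable under sums and under products with functions
holds for all sections if it holds for sections with constant coordinates. -/
theorem section_induction (x : M) (S : Cₛ^∞⟮I; F, V⟯ → Prop)
    (hadd : ∀ σ τ, S σ → S τ → S (σ + τ))
    (hsmul : ∀ (f : C^∞⟮I, M; 𝓘(ℝ), ℝ⟯) σ, S σ → S (σ.funSMul f))
    (hloc : ∀ (ψ : C^∞⟮I, M; 𝓘(ℝ), ℝ⟯) σ, (∀ᶠ y in 𝓝 x, ψ y = 1) → S (σ.funSMul ψ) → S σ)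
    (hconst : ∀ c, S (constSection I F V x c)) (σ : Cₛ^∞⟮I; F, V⟯) : S σ := by
  obtain ⟨ψ, n, c, g, hψ, h⟩ := exists_expansion x σ
  refine hloc ψ σ hψ ?_
  rw [h]
  have h0 : S 0 := by
    have := hconst ((0 : ℝ) • 0)
    rwa [constSection_smul, zero_smul] at this
  exact Finset.sum_induction _ S hadd h0 fun i _ ↦ hsmul _ _ (hconst _)

/-- The Jacobi identity is tensorial. -/
theorem jacobi_of_const (br : Cₛ^∞⟮I; F, V⟯ → Cₛ^∞⟮I; F, V⟯ → Cₛ^∞⟮I; F, V⟯)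
    (D : Cₛ^∞⟮I; F, V⟯ → C^∞⟮I, M; 𝓘(ℝ), ℝ⟯ → C^∞⟮I, M; 𝓘(ℝ), ℝ⟯)
    (hskew : ∀ σ τ, br σ τ = - br τ σ) (hadd : ∀ σ τ υ, br σ (τ + υ) = br σ τ + br σ υ)
    (hneg : ∀ σ τ, br σ (-τ) = - br σ τ)
    (hleib : ∀ σ τ f, br σ (τ.funSMul f) = (br σ τ).funSMul f + τ.funSMul (D σ f))
    (hD : ∀ σ τ f x, D (br σ τ) f x = D σ (D τ f) x - D τ (D σ f) x)
    (hconst : ∀ x c₁ c₂ c₃, (br (br (constSection I F V x c₁) (constSection I F V x c₂))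
        (constSection I F V x c₃) +
      br (br (constSection I F V x c₂) (constSection I F V x c₃)) (constSection I F V x c₁) +
      br (br (constSection I F V x c₃) (constSection I F V x c₁)) (constSection I F V x c₂)) x = 0)
    (σ τ υ : Cₛ^∞⟮I; F, V⟯) :
    br (br σ τ) υ + br (br τ υ) σ + br (br υ σ) τ = 0 := by
  let j : Cₛ^∞⟮I; F, V⟯ → Cₛ^∞⟮I; F, V⟯ → Cₛ^∞⟮I; F, V⟯ → Cₛ^∞⟮I; F, V⟯ := fun σ τ υ ↦
    br (br σ τ) υ + br (br τ υ) σ + br (br υ σ) τ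
  have hcyc : ∀ σ τ υ, j σ τ υ = j τ υ σ := by
    intro σ τ υ
    simp only [j]
    abel
  have hj : ∀ σ τ υ, j σ τ υ = br (br σ τ) υ - br σ (br τ υ) + br τ (br σ υ) := by
    intro σ τ υ
    simp only [j]
    rw [hskew (br τ υ), hskew (br υ σ), hskew υ σ, hneg]
    abel
  have hja : ∀ σ τ υ υ', j σ τ (υ + υ') = j σ τ υ + j σ τ υ' := by
    intro σ τ υ υ'
    simp only [hj, hadd]
    abel
  have hjs : ∀ σ τ (f : C^∞⟮I, M; 𝓘(ℝ), ℝ⟯) υ x, j σ τ (υ.funSMul f) x = f x • j σ τ υ x := by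
    intro σ τ f υ x
    simp only [hj, hleib, hadd]
    change (f x • br (br σ τ) υ x + D (br σ τ) f x • υ x) -
      ((f x • br σ (br τ υ) x + D σ f x • br τ υ x) +
        (D τ f x • br σ υ x + D σ (D τ f) x • υ x)) +
      ((f x • br τ (br σ υ) x + D τ f x • br σ υ x) +
        (D σ f x • br τ υ x + D τ (D σ f) x • υ x)) =
      f x • (br (br σ τ) υ x - br σ (br τ υ) x + br τ (br σ υ) x)
    rw [hD]
    module
  have key : ∀ x σ τ, (∀ c, j σ τ (constSection I F V x c) x = 0) → ∀ υ, j σ τ υ x = 0 := by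
    intro x σ τ h
    exact eq_zero_of_tensorial (fun υ ↦ j σ τ υ x) x
      (fun υ υ' ↦ by simp only [hja]; rfl) (fun f υ ↦ hjs σ τ f υ x) h
  ext x
  refine key x σ τ (fun c₁ ↦ ?_) υ
  rw [← hcyc]
  refine key x _ σ (fun c₂ ↦ ?_) τ
  rw [← hcyc]
  refine key x _ _ (fun c₃ ↦ ?_) σ
  exact hconst x c₂ c₁ c₃

end SectionInduction

section Along

variable {B H : Type*} [NormedAddCommGroup B] [NormedSpace ℝ B] [TopologicalSpace H]
  {I : ModelWithCorners ℝ B H} {M : Type*} [TopologicalSpace M] [ChartedSpace H M]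
  {F : Type*} [NormedAddCommGroup F] [NormedSpace ℝ F]
  {V : M → Type*} [TopologicalSpace (TotalSpace F V)] [∀ x, AddCommGroup (V x)]
  [∀ x, Module ℝ (V x)] [∀ x, TopologicalSpace (V x)] [FiberBundle F V] [VectorBundle ℝ F V]
  {E' H' : Type*} [NormedAddCommGroup E'] [NormedSpace ℝ E'] [TopologicalSpace H']
  {J : ModelWithCorners ℝ E' H'} {N : Type*} [TopologicalSpace N] [ChartedSpace H' N]
  {f : N → M} {s s' : ∀ n, V (f n)} {n : N}

theorem contMDiffAt_along_add
    (hs : ContMDiffAt J (I.prod 𝓘(ℝ, F)) ∞ (fun n ↦ (⟨f n, s n⟩ : TotalSpace F V)) n)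
    (hs' : ContMDiffAt J (I.prod 𝓘(ℝ, F)) ∞ (fun n ↦ (⟨f n, s' n⟩ : TotalSpace F V)) n) :
    ContMDiffAt J (I.prod 𝓘(ℝ, F)) ∞ (fun n ↦ (⟨f n, s n + s' n⟩ : TotalSpace F V)) n := by
  rw [contMDiffAt_totalSpace] at hs hs' ⊢
  refine ⟨hs.1, (hs.2.add hs'.2).congr_of_eventuallyEq ?_⟩
  filter_upwards [hs.1.continuousAt ((trivializationAt F V (f n)).open_baseSet.mem_nhds
    (mem_baseSet_trivializationAt F V (f n)))] with m hm
  exact ((trivializationAt F V (f n)).linear ℝ hm).map_add _ _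

theorem contMDiffAt_along_smul {g : N → ℝ} (hg : ContMDiffAt J 𝓘(ℝ) ∞ g n)
    (hs : ContMDiffAt J (I.prod 𝓘(ℝ, F)) ∞ (fun n ↦ (⟨f n, s n⟩ : TotalSpace F V)) n) :
    ContMDiffAt J (I.prod 𝓘(ℝ, F)) ∞ (fun n ↦ (⟨f n, g n • s n⟩ : TotalSpace F V)) n := by
  rw [contMDiffAt_totalSpace] at hs ⊢
  refine ⟨hs.1, (hg.smul hs.2).congr_of_eventuallyEq ?_⟩
  filter_upwards [hs.1.continuousAt ((trivializationAt F V (f n)).open_baseSet.mem_nhds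
    (mem_baseSet_trivializationAt F V (f n)))] with m hm
  exact ((trivializationAt F V (f n)).linear ℝ hm).map_smul _ _

end Along

section ProlongBracket

variable {B H : Type*} [NormedAddCommGroup B] [NormedSpace ℝ B] [FiniteDimensional ℝ B]
  [TopologicalSpace H]
  {I : ModelWithCorners ℝ B H} {Q : Type*} [TopologicalSpace Q] [ChartedSpace H Q]
  [IsManifold I ∞ Q] [T2Space Q]
  {F : Type*} [NormedAddCommGroup F] [NormedSpace ℝ F] [FiniteDimensional ℝ F]
  {V : Q → Type*} [TopologicalSpace (TotalSpace F V)] [∀ x, AddCommGroup (V x)]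
  [∀ x, Module ℝ (V x)] [∀ x, TopologicalSpace (V x)] [FiberBundle F V] [VectorBundle ℝ F V]
  [ContMDiffVectorBundle ∞ F V I]
  {G : Type*} [NormedAddCommGroup G] [NormedSpace ℝ G] [FiniteDimensional ℝ G]
  {W : Q → Type*} [TopologicalSpace (TotalSpace G W)] [∀ x, AddCommGroup (W x)]
  [∀ x, Module ℝ (W x)] [∀ x, TopologicalSpace (W x)] [FiberBundle G W] [VectorBundle ℝ G W]
  [ContMDiffVectorBundle ∞ G W I]

namespace Prolong

variable {A : LieAlgebroid I F V}

theorem contMDiff_fst (Z : Cₛ^∞⟮I.prod 𝓘(ℝ, G); F × G, Prolong G W A⟯) :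
    ContMDiff (I.prod 𝓘(ℝ, G)) (I.prod 𝓘(ℝ, F)) ∞
      fun p ↦ (⟨p.1, (Z p).fst⟩ : TotalSpace F V) :=
  fun p ↦ (contMDiffAt_iff.1 (Z.contMDiff p)).1

/-- The vector field underlying a section of the prolongation. -/
noncomputable def vectorField (Z : Cₛ^∞⟮I.prod 𝓘(ℝ, G); F × G, Prolong G W A⟯) :
    Cₛ^∞⟮I.prod 𝓘(ℝ, G); B × G, (TangentSpace (I.prod 𝓘(ℝ, G)) : TotalSpace G W → Type _)⟯ :=
  ⟨fun p ↦ (Z p).snd, fun p ↦ (contMDiffAt_iff.1 (Z.contMDiff p)).2⟩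

/-- The component in the algebroid of the bracket of two sections of the prolongation. With
respect to a frame `e i` of the algebroid, the bracket of `(∑ f i • e i, X)` and
`(∑ f' j • e j, X')` has the component
`∑ (f i * f' j) • [e i, e j] + ∑ (X (f' j)) • e j - ∑ (X' (f i)) • e i`. -/
noncomputable def bracketFst (Z Z' : Cₛ^∞⟮I.prod 𝓘(ℝ, G); F × G, Prolong G W A⟯)
    (p : TotalSpace G W) : V p.1 :=
  A.constBracket (Z p).fst (Z' p).fst + (trivializationAt F V p.1).symmL ℝ p.1
    (coordDeriv F (I.prod 𝓘(ℝ, G)) (π G W) (fun p' ↦ (Z' p').fst) p (Z p).snd -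
      coordDeriv F (I.prod 𝓘(ℝ, G)) (π G W) (fun p' ↦ (Z p').fst) p (Z' p).snd)

variable (Z Z' Z'' : Cₛ^∞⟮I.prod 𝓘(ℝ, G); F × G, Prolong G W A⟯)

theorem bracketFst_skew (p : TotalSpace G W) : bracketFst Z Z' p = - bracketFst Z' Z p := by
  rw [bracketFst, bracketFst, A.constBracket_skew (Z p).fst, neg_add, ← map_neg, neg_sub]

theorem bracketFst_add (p : TotalSpace G W) :
    bracketFst Z (Z' + Z'') p = bracketFst Z Z' p + bracketFst Z Z'' p := by
  have h1 : coordDeriv F (I.prod 𝓘(ℝ, G)) (π G W) (fun p' ↦ ((Z' + Z'') p').fst) p =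
      coordDeriv F (I.prod 𝓘(ℝ, G)) (π G W) (fun p' ↦ (Z' p').fst) p +
      coordDeriv F (I.prod 𝓘(ℝ, G)) (π G W) (fun p' ↦ (Z'' p').fst) p :=
    coordDeriv_add (contMDiff_fst Z') (contMDiff_fst Z'')
  have h2 : (Z' + Z'') p = Z' p + Z'' p := rfl
  simp only [bracketFst, h1, h2, A.constBracket_add, map_add, map_sub, add_apply]
  abel

theorem bracketFst_funSMul (f : C^∞⟮I.prod 𝓘(ℝ, G), TotalSpace G W; 𝓘(ℝ), ℝ⟯)
    (p : TotalSpace G W) : bracketFst Z (Z'.funSMul f) p = f p • bracketFst Z Z' p +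
      mvfderiv (I.prod 𝓘(ℝ, G)) f p (Z p).snd • (Z' p).fst := by
  have h1 : coordDeriv F (I.prod 𝓘(ℝ, G)) (π G W) (fun p' ↦ ((Z'.funSMul f) p').fst) p (Z p).snd =
      _ := coordDeriv_smul (f.contMDiff.mdiffAt p) (contMDiff_fst Z') (Z p).snd
  have h2 : (Z'.funSMul f) p = f p • Z' p := rfl
  simp only [bracketFst, h1, h2, A.constBracket_smul, map_add, map_sub, map_smul,
    symmL_continuousLinearMapAt_self]
  module

theorem bracketFst_congr {Z Z' : Cₛ^∞⟮I.prod 𝓘(ℝ, G); F × G, Prolong G W A⟯} {p : TotalSpace G W}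
    (h : ∀ᶠ p' in 𝓝 p, Z p' = Z' p') : bracketFst Z'' Z p = bracketFst Z'' Z' p := by
  have h1 : coordDeriv F (I.prod 𝓘(ℝ, G)) (π G W) (fun p' ↦ (Z p').fst) p =
      coordDeriv F (I.prod 𝓘(ℝ, G)) (π G W) (fun p' ↦ (Z' p').fst) p :=
    coordDeriv_congr (by filter_upwards [h] with p' hp'; rw [hp'])
  rw [bracketFst, bracketFst, h1, h.self_of_nhds]

/-- The bracket of projectable sections. -/
theorem bracketFst_of_projectable {σ σ' : Cₛ^∞⟮I; F, V⟯} {p : TotalSpace G W}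
    (h : ∀ᶠ p' in 𝓝 p, (Z p').fst = σ p'.1) (h' : ∀ᶠ p' in 𝓝 p, (Z' p').fst = σ' p'.1) :
    bracketFst Z Z' p = A.bracket σ σ' p.1 := by
  have hp : MDifferentiableAt (I.prod 𝓘(ℝ, G)) I (π G W) p :=
    ((contMDiff_proj W (n := ∞)) p).mdifferentiableAt (by norm_num)
  have key : ∀ {Z : Cₛ^∞⟮I.prod 𝓘(ℝ, G); F × G, Prolong G W A⟯} {σ : Cₛ^∞⟮I; F, V⟯},
      (∀ᶠ p' in 𝓝 p, (Z p').fst = σ p'.1) → ∀ v, coordDeriv F (I.prod 𝓘(ℝ, G)) (π G W)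
        (fun p' ↦ (Z p').fst) p v = coordDeriv F I (fun x ↦ x) σ p.1
          (mfderiv (I.prod 𝓘(ℝ, G)) I (π G W) p v) := by
    intro Z σ h v
    have h1 : coordDeriv F (I.prod 𝓘(ℝ, G)) (π G W) (fun p' ↦ (Z p').fst) p =
        coordDeriv F (I.prod 𝓘(ℝ, G)) (π G W) (fun p' : TotalSpace G W ↦ σ p'.1) p :=
      coordDeriv_congr h
    rw [h1]
    exact coordDeriv_comp σ.contMDiff hp v
  rw [bracketFst, A.bracket_eq, key h, key h', ← anchor_fst, ← anchor_fst, h.self_of_nhds,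
    h'.self_of_nhds]

theorem fst_constSection (p : TotalSpace G W) (c : F × G) : ∀ᶠ p' in 𝓝 p,
    (constSection (I.prod 𝓘(ℝ, G)) (F × G) (Prolong G W A) p c p').fst =
      constSection I F V p.1 c.1 p'.1 := by
  have h1 : ∀ᶠ p' in 𝓝 p, _ := (FiberBundle.continuous_proj G W).continuousAt.eventually
    (constSection_eventuallyEq I F (V := V) p.1 c.1)
  filter_upwards [constSection_eventuallyEq (I.prod 𝓘(ℝ, G)) (F × G) (V := Prolong G W A) p c, h1]
    with p' hp' hp''
  rw [hp'.2, hp''.2]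
  have h2 := (trivializationAt (F × G) (Prolong G W A) p).apply_mk_symm hp'.1 c
  rw [trivializationAt_apply] at h2
  have h3 := congrArg (fun z ↦ z.2.1) h2
  change (trivializationAt F V p.1).continuousLinearMapAt ℝ p'.1 _ = c.1 at h3
  rw [← (trivializationAt F V p.1).symmL_apply (R := ℝ) hp''.1, ← h3,
    (trivializationAt F V p.1).symmL_continuousLinearMapAt hp''.1]

theorem anchor_bracketFst (p : TotalSpace G W) :
    A.anchor p.1 (bracketFst Z Z' p) = mfderiv (I.prod 𝓘(ℝ, G)) I (π G W) p
      ((tangentLieAlgebroid (I.prod 𝓘(ℝ, G)) (TotalSpace G W)).bracket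
        (vectorField Z) (vectorField Z') p) := by
  set T := tangentLieAlgebroid (I.prod 𝓘(ℝ, G)) (TotalSpace G W)
  have hproj : ContMDiff (I.prod 𝓘(ℝ, G)) I ∞ (π G W) := contMDiff_proj W
  let R : Cₛ^∞⟮I.prod 𝓘(ℝ, G); F × G, Prolong G W A⟯ →
      Cₛ^∞⟮I.prod 𝓘(ℝ, G); F × G, Prolong G W A⟯ → TangentSpace I p.1 := fun Z Z' ↦
    A.anchor p.1 (bracketFst Z Z' p) - mfderiv (I.prod 𝓘(ℝ, G)) I (π G W) p
      (T.bracket (vectorField Z) (vectorField Z') p)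
  have hskew : ∀ Z Z', R Z Z' = - R Z' Z := by
    intro Z Z'
    have h1 : T.bracket (vectorField Z) (vectorField Z') p =
        - T.bracket (vectorField Z') (vectorField Z) p := by
      rw [T.bracket_skew]
      rfl
    simp only [R]
    rw [h1, bracketFst_skew, map_neg, map_neg]
    abel
  have hadd : ∀ Z Z' Z'', R Z (Z' + Z'') = R Z Z' + R Z Z'' := by
    intro Z Z' Z''
    have h1 : T.bracket (vectorField Z) (vectorField (Z' + Z'')) p =
        T.bracket (vectorField Z) (vectorField Z') p +
          T.bracket (vectorField Z) (vectorField Z'') p := by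
      rw [show vectorField (Z' + Z'') = vectorField Z' + vectorField Z'' from rfl, T.bracket_add]
      rfl
    simp only [R]
    rw [h1, bracketFst_add, map_add, map_add]
    abel
  have hsmul : ∀ Z (f : C^∞⟮I.prod 𝓘(ℝ, G), TotalSpace G W; 𝓘(ℝ), ℝ⟯) Z',
      R Z (Z'.funSMul f) = f p • R Z Z' := by
    intro Z f Z'
    have h1 := T.leibniz f (vectorField Z) (vectorField Z') p
    have h2 : vectorField (Z'.funSMul f) = (vectorField Z').funSMul f := rfl
    simp only [R]
    rw [h2, h1, bracketFst_funSMul, map_add, map_add, map_smul, map_smul, map_smul, map_smul,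
      anchor_fst]
    change _ + mvfderiv _ f p (Z p).snd • _ - (_ + mvfderiv _ f p (Z p).snd •
      mfderiv (I.prod 𝓘(ℝ, G)) I (π G W) p (Z' p).snd) = _
    module
  have hconst : ∀ c d, R (constSection (I.prod 𝓘(ℝ, G)) (F × G) (Prolong G W A) p c)
      (constSection (I.prod 𝓘(ℝ, G)) (F × G) (Prolong G W A) p d) = 0 := by
    intro c d
    set Z := constSection (I.prod 𝓘(ℝ, G)) (F × G) (Prolong G W A) p c
    set Z' := constSection (I.prod 𝓘(ℝ, G)) (F × G) (Prolong G W A) p d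
    set σ := constSection I F V p.1 c.1
    set σ' := constSection I F V p.1 d.1
    have hZ : ∀ᶠ p' in 𝓝 p, (Z p').fst = σ p'.1 := fst_constSection p c
    have hZ' : ∀ᶠ p' in 𝓝 p, (Z' p').fst = σ' p'.1 := fst_constSection p d
    refine tangent_eq_zero fun φ ↦ ?_
    let φ' : C^∞⟮I.prod 𝓘(ℝ, G), TotalSpace G W; 𝓘(ℝ), ℝ⟯ := ⟨fun p ↦ φ p.1,
      φ.contMDiff.comp hproj⟩
    have hφ : ∀ (g : C^∞⟮I, Q; 𝓘(ℝ), ℝ⟯) p v,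
        mvfderiv (I.prod 𝓘(ℝ, G)) (fun p : TotalSpace G W ↦ g p.1) p v =
        mvfderiv I g p.1 (mfderiv (I.prod 𝓘(ℝ, G)) I (π G W) p v) := fun g p v ↦
      mvfderiv_comp_apply p (g.contMDiff.mdiffAt _)
        ((hproj p).mdifferentiableAt (by norm_num)) v
    have hder : ∀ {Z Z' : Cₛ^∞⟮I.prod 𝓘(ℝ, G); F × G, Prolong G W A⟯} {σ σ' : Cₛ^∞⟮I; F, V⟯},
        (∀ᶠ p' in 𝓝 p, (Z p').fst = σ p'.1) → (∀ᶠ p' in 𝓝 p, (Z' p').fst = σ' p'.1) →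
        T.deriv (vectorField Z) (T.deriv (vectorField Z') φ') p =
          A.deriv σ (A.deriv σ' φ) p.1 := by
      intro Z Z' σ σ' hZ hZ'
      have h1 : ∀ᶠ p' in 𝓝 p, T.deriv (vectorField Z') φ' p' = A.deriv σ' φ p'.1 := by
        filter_upwards [hZ'] with p' hp'
        refine (hφ φ p' (Z' p').snd).trans ?_
        rw [← anchor_fst, hp']
        rfl
      have h2 : mvfderiv (I.prod 𝓘(ℝ, G)) (T.deriv (vectorField Z') φ') p =
          mvfderiv (I.prod 𝓘(ℝ, G)) (fun p ↦ A.deriv σ' φ p.1) p :=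
        Filter.EventuallyEq.mfderiv_eq h1
      change mvfderiv (I.prod 𝓘(ℝ, G)) (T.deriv (vectorField Z') φ') p (Z p).snd = _
      rw [h2, hφ, ← anchor_fst, hZ.self_of_nhds]
      rfl
    simp only [R]
    rw [map_sub, ← hφ, bracketFst_of_projectable Z Z' hZ hZ', sub_eq_zero]
    refine (A.deriv_bracket σ σ' φ p.1).trans ?_
    rw [← hder hZ hZ', ← hder hZ' hZ]
    exact (T.deriv_bracket (vectorField Z) (vectorField Z') φ' p).symm
  have hR : R Z Z' = 0 := by
    refine eq_zero_of_tensorial (R Z) p (hadd Z) (hsmul Z) (fun d ↦ ?_) Z'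
    rw [hskew, neg_eq_zero]
    exact eq_zero_of_tensorial (R _) p (hadd _) (hsmul _) (fun c ↦ hconst d c) Z
  exact sub_eq_zero.1 hR

theorem contMDiff_bracketFst : ContMDiff (I.prod 𝓘(ℝ, G)) (I.prod 𝓘(ℝ, F)) ∞
    fun p ↦ (⟨p.1, bracketFst Z Z' p⟩ : TotalSpace F V) := by
  intro p
  let S : Cₛ^∞⟮I.prod 𝓘(ℝ, G); F × G, Prolong G W A⟯ →
      Cₛ^∞⟮I.prod 𝓘(ℝ, G); F × G, Prolong G W A⟯ → Prop := fun Z Z' ↦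
    ContMDiffAt (I.prod 𝓘(ℝ, G)) (I.prod 𝓘(ℝ, F)) ∞
      (fun p ↦ (⟨p.1, bracketFst Z Z' p⟩ : TotalSpace F V)) p
  have hskew : ∀ Z Z', S Z Z' → S Z' Z := by
    intro Z Z' h
    have h1 := contMDiffAt_along_smul (g := fun _ ↦ (-1 : ℝ)) contMDiffAt_const h
    simp only [neg_one_smul, ← bracketFst_skew] at h1
    exact h1
  have hind : ∀ Z, (∀ c, S Z (constSection (I.prod 𝓘(ℝ, G)) (F × G) (Prolong G W A) p c)) →
      ∀ Z', S Z Z' := by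
    intro Z hc Z'
    refine section_induction p (S Z) ?_ ?_ ?_ hc Z'
    · intro Z₁ Z₂ h₁ h₂
      have h3 := contMDiffAt_along_add h₁ h₂
      simp only [← bracketFst_add] at h3
      exact h3
    · intro f Z₁ h₁
      have h3 := contMDiffAt_along_add (contMDiffAt_along_smul (f.contMDiff p) h₁)
        (contMDiffAt_along_smul (contMDiff_mvfderiv_apply f.contMDiff
          (vectorField Z).contMDiff p) (contMDiff_fst Z₁ p))
      refine h3.congr_of_eventuallyEq (.of_forall fun p ↦ ?_)
      exact congrArg (TotalSpace.mk p.1) (bracketFst_funSMul Z Z₁ f p)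
    · intro ψ Z₁ hψ h₁
      refine ContMDiffAt.congr_of_eventuallyEq h₁ ?_
      filter_upwards [hψ.eventually_nhds] with p' hp'
      refine congrArg (TotalSpace.mk p'.1) (bracketFst_congr Z ?_)
      filter_upwards [hp'] with p'' hp''
      change Z₁ p'' = ψ p'' • Z₁ p''
      rw [hp'', one_smul]
  refine hind Z (fun c ↦ hskew _ _ (hind _ (fun d ↦ ?_) Z)) Z'
  have h1 := (A.bracket (constSection I F V p.1 c.1) (constSection I F V p.1 d.1)).contMDiff.comp
    (contMDiff_proj (F := G) W (n := ∞) (IB := I))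
  refine (h1 p).congr_of_eventuallyEq ?_
  filter_upwards [(fst_constSection (A := A) (W := W) p c).eventually_nhds,
    (fst_constSection (A := A) (W := W) p d).eventually_nhds] with p' hc hd
  exact congrArg (TotalSpace.mk p'.1) (bracketFst_of_projectable _ _ hc hd)

/-- The bracket of sections of the prolongation. -/
noncomputable def bracket : Cₛ^∞⟮I.prod 𝓘(ℝ, G); F × G, Prolong G W A⟯ :=
  ⟨fun p ↦ mk (bracketFst Z Z' p) ((tangentLieAlgebroid (I.prod 𝓘(ℝ, G)) (TotalSpace G W)).bracket
    (vectorField Z) (vectorField Z') p) (anchor_bracketFst Z Z' p), fun p ↦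
      contMDiffAt_iff.2 ⟨contMDiff_bracketFst Z Z' p,
        ((tangentLieAlgebroid (I.prod 𝓘(ℝ, G)) (TotalSpace G W)).bracket
          (vectorField Z) (vectorField Z')).contMDiff p⟩⟩

theorem bracket_skew : bracket Z Z' = - bracket Z' Z := by
  refine ContMDiffSection.ext fun p ↦ ext (bracketFst_skew Z Z' p) ?_
  exact congrArg (fun X ↦ X p)
    ((tangentLieAlgebroid (I.prod 𝓘(ℝ, G)) (TotalSpace G W)).bracket_skew _ _)

theorem bracket_add : bracket Z (Z' + Z'') = bracket Z Z' + bracket Z Z'' := by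
  refine ContMDiffSection.ext fun p ↦ ext (bracketFst_add Z Z' Z'' p) ?_
  exact congrArg (fun X ↦ X p)
    ((tangentLieAlgebroid (I.prod 𝓘(ℝ, G)) (TotalSpace G W)).bracket_add (vectorField Z) (vectorField Z') (vectorField Z''))

theorem bracket_funSMul (f : C^∞⟮I.prod 𝓘(ℝ, G), TotalSpace G W; 𝓘(ℝ), ℝ⟯)
    (p : TotalSpace G W) : bracket Z (Z'.funSMul f) p = f p • bracket Z Z' p +
      mvfderiv (I.prod 𝓘(ℝ, G)) f p (Z p).snd • Z' p := by
  refine ext (bracketFst_funSMul Z Z' f p) ?_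
  exact (tangentLieAlgebroid (I.prod 𝓘(ℝ, G)) (TotalSpace G W)).leibniz f (vectorField Z)
    (vectorField Z') p

theorem bracket_smul (r : ℝ) : bracket Z (r • Z') = r • bracket Z Z' := by
  refine ContMDiffSection.ext fun p ↦ ?_
  have h := bracket_funSMul Z Z' ⟨fun _ ↦ r, contMDiff_const⟩ p
  have h1 : mvfderiv (I.prod 𝓘(ℝ, G)) (fun _ : TotalSpace G W ↦ r) p = 0 := mvfderiv_const r
  refine h.trans ?_
  change r • _ + mvfderiv (I.prod 𝓘(ℝ, G)) (fun _ : TotalSpace G W ↦ r) p _ • _ = _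
  rw [h1, zero_apply, zero_smul, add_zero]
  rfl

theorem jacobi : bracket (bracket Z Z') Z'' + bracket (bracket Z' Z'') Z +
    bracket (bracket Z'' Z) Z' = 0 := by
  set T := tangentLieAlgebroid (I.prod 𝓘(ℝ, G)) (TotalSpace G W)
  refine jacobi_of_const bracket (fun Z f ↦ T.deriv (vectorField Z) f) bracket_skew bracket_add
    ?_ ?_ ?_ ?_ Z Z' Z''
  · intro Z Z'
    have := bracket_smul Z Z' (-1)
    rwa [neg_one_smul, neg_one_smul] at this
  · exact fun Z Z' f ↦ ContMDiffSection.ext fun p ↦ bracket_funSMul Z Z' f p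
  · exact fun Z Z' f p ↦ T.deriv_bracket (vectorField Z) (vectorField Z') f p
  · intro p c₁ c₂ c₃
    have key : ∀ c d e : F × G,
        bracketFst (bracket (constSection (I.prod 𝓘(ℝ, G)) (F × G) (Prolong G W A) p c)
          (constSection (I.prod 𝓘(ℝ, G)) (F × G) (Prolong G W A) p d))
          (constSection (I.prod 𝓘(ℝ, G)) (F × G) (Prolong G W A) p e) p =
        A.bracket (A.bracket (constSection I F V p.1 c.1) (constSection I F V p.1 d.1))
          (constSection I F V p.1 e.1) p.1 := by
      intro c d e
      refine bracketFst_of_projectable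
        (bracket (constSection (I.prod 𝓘(ℝ, G)) (F × G) (Prolong G W A) p c)
          (constSection (I.prod 𝓘(ℝ, G)) (F × G) (Prolong G W A) p d))
        (constSection (I.prod 𝓘(ℝ, G)) (F × G) (Prolong G W A) p e) ?_ (fst_constSection (A := A) (W := W) p e)
      filter_upwards [(fst_constSection (A := A) (W := W) p c).eventually_nhds,
        (fst_constSection (A := A) (W := W) p d).eventually_nhds] with p' hc hd
      exact bracketFst_of_projectable
        (constSection (I.prod 𝓘(ℝ, G)) (F × G) (Prolong G W A) p c)
        (constSection (I.prod 𝓘(ℝ, G)) (F × G) (Prolong G W A) p d) hc hd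
    refine ext ?_ ?_
    · refine (congrArg₂ (· + ·) (congrArg₂ (· + ·) (key c₁ c₂ c₃) (key c₂ c₃ c₁))
        (key c₃ c₁ c₂)).trans ?_
      exact congrArg (fun s : Cₛ^∞⟮I; F, V⟯ ↦ s p.1) (A.jacobi (constSection I F V p.1 c₁.1)
        (constSection I F V p.1 c₂.1) (constSection I F V p.1 c₃.1))
    · exact congrArg (fun X ↦ X p) (T.jacobi
        (vectorField (constSection (I.prod 𝓘(ℝ, G)) (F × G) (Prolong G W A) p c₁))
        (vectorField (constSection (I.prod 𝓘(ℝ, G)) (F × G) (Prolong G W A) p c₂))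
        (vectorField (constSection (I.prod 𝓘(ℝ, G)) (F × G) (Prolong G W A) p c₃)))

end Prolong

variable (G W) in
/-- The prolongation of a Lie algebroid over a vector bundle `W`, as a Lie algebroid over the
total space of `W`. -/
noncomputable def prolongation (A : LieAlgebroid I F V) :
    LieAlgebroid (I.prod 𝓘(ℝ, G)) (F × G) (Prolong G W A) where
  anchor _ := Prolong.snd
  contMDiff_anchor z := (Prolong.contMDiffAt_iff.1 (contMDiffAt_id (x := z))).2
  bracket := Prolong.bracket
  bracket_skew := Prolong.bracket_skew
  bracket_add := Prolong.bracket_add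
  bracket_smul r Z Z' := Prolong.bracket_smul Z Z' r
  jacobi := Prolong.jacobi
  leibniz f Z Z' p := Prolong.bracket_funSMul Z Z' f p

end ProlongBracket

section Forms

variable {B H : Type*} [NormedAddCommGroup B] [NormedSpace ℝ B] [FiniteDimensional ℝ B]
  [TopologicalSpace H]
  {I : ModelWithCorners ℝ B H} {M : Type*} [TopologicalSpace M] [ChartedSpace H M]
  [IsManifold I ∞ M] [T2Space M]
  {F : Type*} [NormedAddCommGroup F] [NormedSpace ℝ F]
  {V : M → Type*} [TopologicalSpace (TotalSpace F V)] [∀ x, AddCommGroup (V x)]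
  [∀ x, Module ℝ (V x)] [∀ x, TopologicalSpace (V x)] [FiberBundle F V] [VectorBundle ℝ F V]
  [ContMDiffVectorBundle ∞ F V I]
  {B' H' : Type*} [NormedAddCommGroup B'] [NormedSpace ℝ B'] [FiniteDimensional ℝ B']
  [TopologicalSpace H']
  {I' : ModelWithCorners ℝ B' H'} {M' : Type*} [TopologicalSpace M'] [ChartedSpace H' M']
  [IsManifold I' ∞ M'] [T2Space M']
  {F' : Type*} [NormedAddCommGroup F'] [NormedSpace ℝ F']
  {V' : M' → Type*} [TopologicalSpace (TotalSpace F' V')] [∀ x, AddCommGroup (V' x)]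
  [∀ x, Module ℝ (V' x)] [∀ x, TopologicalSpace (V' x)] [FiberBundle F' V'] [VectorBundle ℝ F' V']
  [ContMDiffVectorBundle ∞ F' V' I']

variable (I F) in
/-- A family of alternating `l`-forms on the fibres of a vector bundle `V` is a smooth section of
the bundle of alternating `l`-forms. -/
def IsSmoothForm {l : ℕ} (μ : ∀ x, V x [⋀^Fin l]→ₗ[ℝ] ℝ) : Prop :=
  ∀ σ : Fin l → Cₛ^∞⟮I; F, V⟯, ContMDiff I 𝓘(ℝ) ∞ fun x ↦ μ x fun i ↦ σ i x

/-- The Koszul formula for the value of the exterior derivative of the `l`-form `μ` on sections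
`σ 0, …, σ l`. The term of the pair `i < j` contains the bracket of `σ i` and `σ j` in the place of
`σ i`, rather than in the first place: this accounts for the sign `(-1) ^ j` instead
of `(-1) ^ (i + j)`. -/
noncomputable def LieAlgebroid.koszul (A : LieAlgebroid I F V) {l : ℕ}
    (μ : ∀ x, V x [⋀^Fin l]→ₗ[ℝ] ℝ) (σ : Fin (l + 1) → Cₛ^∞⟮I; F, V⟯) (x : M) : ℝ :=
  ∑ i : Fin (l + 1), (-1) ^ (i : ℕ) *
      mvfderiv I (fun y ↦ μ y fun a ↦ σ (i.succAbove a) y) x (A.anchor x (σ i x)) +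
    ∑ i : Fin (l + 1), ∑ j ∈ Finset.Ioi i, (-1) ^ (j : ℕ) *
      μ x fun a ↦ Function.update σ i (A.bracket (σ i) (σ j)) (j.succAbove a) x

/-- The exterior derivative of an `l`-form on a Lie algebroid: its value on `v 0, …, v l` is given
by the Koszul formula for sections through these vectors. (The Koszul formula is tensorial in the
sections, thus the choice of these sections is irrelevant.) -/
noncomputable def LieAlgebroid.extDeriv (A : LieAlgebroid I F V) {l : ℕ}
    (μ : ∀ x, V x [⋀^Fin l]→ₗ[ℝ] ℝ) (x : M) (v : Fin (l + 1) → V x) : ℝ :=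
  A.koszul μ (fun i ↦ sectionThrough I F (v i)) x

/-- The pullback of a form by a bundle map `Φ` which covers `φ`. -/
def pullbackForm {φ : M → M'} (Φ : ∀ x, V x →ₗ[ℝ] V' (φ x)) {l : ℕ}
    (μ : ∀ y, V' y [⋀^Fin l]→ₗ[ℝ] ℝ) (x : M) : V x [⋀^Fin l]→ₗ[ℝ] ℝ :=
  (μ (φ x)).compLinearMap (Φ x)

/-- A bundle map `Φ` which covers `φ` is a morphism of Lie algebroids if it is smooth and the
pullback of forms commutes with the exterior derivatives. -/
def IsLieAlgebroidMorphism (A : LieAlgebroid I F V) (A' : LieAlgebroid I' F' V') {φ : M → M'}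
    (Φ : ∀ x, V x →ₗ[ℝ] V' (φ x)) : Prop :=
  ContMDiff (I.prod 𝓘(ℝ, F)) (I'.prod 𝓘(ℝ, F')) ∞
    (fun e : TotalSpace F V ↦ (⟨φ e.1, Φ e.1 e.2⟩ : TotalSpace F' V')) ∧
  ∀ (l : ℕ) (μ : ∀ y, V' y [⋀^Fin l]→ₗ[ℝ] ℝ), IsSmoothForm I' F' μ →
    ∀ (x : M) (v : Fin (l + 1) → V x),
      A.extDeriv (pullbackForm Φ μ) x v = A'.extDeriv μ (φ x) fun i ↦ Φ x (v i)

/-- A linear form, as an alternating form in one variable. -/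
def oneForm {E : Type*} [AddCommGroup E] [Module ℝ E] (f : E →ₗ[ℝ] ℝ) : E [⋀^Fin 1]→ₗ[ℝ] ℝ :=
  AlternatingMap.ofSubsingleton ℝ E ℝ (0 : Fin 1) f

end Forms

section VerticalLift

variable {B H : Type*} [NormedAddCommGroup B] [NormedSpace ℝ B] [TopologicalSpace H]
  {I : ModelWithCorners ℝ B H} {Q : Type*} [TopologicalSpace Q] [ChartedSpace H Q]
  [IsManifold I ∞ Q]
  {G : Type*} [NormedAddCommGroup G] [NormedSpace ℝ G]
  {W : Q → Type*} [TopologicalSpace (TotalSpace G W)] [∀ x, AddCommGroup (W x)]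
  [∀ x, Module ℝ (W x)] [∀ x, TopologicalSpace (W x)] [FiberBundle G W] [VectorBundle ℝ G W]
  [ContMDiffVectorBundle ∞ G W I]

/-- The straight line in a fibre which starts at `p` with velocity `w`. -/
def fibreLine (p : TotalSpace G W) (w : W p.1) (s : ℝ) : TotalSpace G W := ⟨p.1, p.2 + s • w⟩

theorem fibreLine_zero (p : TotalSpace G W) (w : W p.1) : fibreLine p w 0 = p :=
  congrArg (TotalSpace.mk p.1) (by rw [zero_smul, add_zero])

theorem trivialization_fibreLine (u : Trivialization G (π G W)) [MemTrivializationAtlas u]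
    {p : TotalSpace G W} (hp : p ∈ u.source) (w : W p.1) (s : ℝ) :
    (u (fibreLine p w s)).2 = (u p).2 + s • (u ⟨p.1, w⟩).2 := by
  have hp' : p.1 ∈ u.baseSet := u.mem_source.1 hp
  have h1 := (u.linear ℝ hp').map_add p.2 (s • w)
  have h2 := (u.linear ℝ hp').map_smul s w
  exact h1.trans (congrArg _ h2)

variable (I) in
theorem contMDiff_fibreLine (p : TotalSpace G W) (w : W p.1) :
    ContMDiff 𝓘(ℝ) (I.prod 𝓘(ℝ, G)) ∞ (fibreLine p w) := by
  intro s
  refine contMDiffAt_totalSpace.2 ⟨contMDiffAt_const, ?_⟩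
  have h1 : ContMDiff 𝓘(ℝ) 𝓘(ℝ, G) ∞ fun s : ℝ ↦
      (trivializationAt G W p.1 p).2 + s • (trivializationAt G W p.1 ⟨p.1, w⟩).2 :=
    (contDiff_const.add (contDiff_id.smul contDiff_const)).contMDiff
  refine (h1 s).congr_of_eventuallyEq (.of_forall fun s ↦ ?_)
  exact trivialization_fibreLine _ FiberBundle.mem_trivializationAt_proj_source w s

variable (I) in
/-- The vertical lift of `w` at `p`: the velocity at `s = 0` of the line `s ↦ p + s • w`. -/
noncomputable def verticalVector (p : TotalSpace G W) (w : W p.1) :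
    TangentSpace (I.prod 𝓘(ℝ, G)) p :=
  mfderiv 𝓘(ℝ) (I.prod 𝓘(ℝ, G)) (fibreLine p w) 0 (1 : ℝ)

theorem mvfderiv_verticalVector {E : Type*} [NormedAddCommGroup E] [NormedSpace ℝ E]
    {f : TotalSpace G W → E} {p : TotalSpace G W}
    (hf : MDifferentiableAt (I.prod 𝓘(ℝ, G)) 𝓘(ℝ, E) f p) (w : W p.1) :
    mvfderiv (I.prod 𝓘(ℝ, G)) f p (verticalVector I p w) =
      deriv (fun s ↦ f (fibreLine p w s)) 0 := by
  have h1 : MDifferentiableAt 𝓘(ℝ) (I.prod 𝓘(ℝ, G)) (fibreLine p w) 0 :=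
    (contMDiff_fibreLine I p w 0).mdifferentiableAt (by norm_num)
  have h2 := mfderiv_comp_of_eq hf h1 (fibreLine_zero p w)
  have h3 : ∀ b, b = p → ∀ v : B × G, (mfderiv (I.prod 𝓘(ℝ, G)) 𝓘(ℝ, E) f b v : E) =
      (mfderiv (I.prod 𝓘(ℝ, G)) 𝓘(ℝ, E) f p v : E) := by
    rintro _ rfl v
    rfl
  have h4 : mfderiv 𝓘(ℝ) 𝓘(ℝ, E) (f ∘ fibreLine p w) 0 = fderiv ℝ (f ∘ fibreLine p w) 0 :=
    mfderiv_eq_fderiv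
  rw [h4] at h2
  have h5 := DFunLike.congr_fun h2 (1 : ℝ)
  have h6 : (fderiv ℝ (f ∘ fibreLine p w) 0 : ℝ →L[ℝ] E) 1 = deriv (f ∘ fibreLine p w) 0 :=
    fderiv_apply_one_eq_deriv
  exact ((h3 _ (fibreLine_zero p w) _).symm.trans h5.symm).trans h6

theorem mfderiv_proj_verticalVector (p : TotalSpace G W) (w : W p.1) :
    mfderiv (I.prod 𝓘(ℝ, G)) I (π G W) p (verticalVector I p w) = 0 := by
  have h1 : MDifferentiableAt 𝓘(ℝ) (I.prod 𝓘(ℝ, G)) (fibreLine p w) 0 :=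
    (contMDiff_fibreLine I p w 0).mdifferentiableAt (by norm_num)
  have h0 : MDifferentiableAt (I.prod 𝓘(ℝ, G)) I (π G W) p :=
    ((contMDiff_proj W (n := ∞)) p).mdifferentiableAt (by norm_num)
  have h2 := mfderiv_comp_of_eq h0 h1 (fibreLine_zero p w)
  have h3 : ∀ b, b = p → ∀ v : B × G, (mfderiv (I.prod 𝓘(ℝ, G)) I (π G W) b v : B) =
      (mfderiv (I.prod 𝓘(ℝ, G)) I (π G W) p v : B) := by
    rintro _ rfl v
    rfl
  have h4 : mfderiv 𝓘(ℝ) I ((π G W) ∘ fibreLine p w) 0 = 0 := mfderiv_const (c := p.1)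
  rw [h4] at h2
  have h5 := DFunLike.congr_fun h2 (1 : ℝ)
  exact (h3 _ (fibreLine_zero p w) _).symm.trans h5.symm

theorem vert_verticalVector (u : Trivialization G (π G W)) [MemTrivializationAtlas u]
    {p : TotalSpace G W} (hp : p ∈ u.source) (w : W p.1) :
    u.vert I p (verticalVector I p w) = u.continuousLinearMapAt ℝ p.1 w := by
  have h0 : MDifferentiableAt (I.prod 𝓘(ℝ, G)) 𝓘(ℝ, G) (fun p' : TotalSpace G W ↦ (u p').2) p :=
    mdifferentiableAt_snd.comp p ((u.mdifferentiable_aux I).mdifferentiableAt hp)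
  refine (mvfderiv_verticalVector h0 w).trans ?_
  simp only [trivialization_fibreLine u hp]
  rw [u.continuousLinearMapAt_apply ℝ, u.coe_linearMapAt_of_mem (u.mem_source.1 hp)]
  rw [deriv_const_add]
  simpa using ((hasDerivAt_id (0 : ℝ)).smul_const (u ⟨p.1, w⟩).2).deriv

theorem verticalVector_eq (u : Trivialization G (π G W)) [MemTrivializationAtlas u]
    {p : TotalSpace G W} (hp : p ∈ u.source) (w : W p.1) :
    verticalVector I p w = u.liftTangent hp (0, u.continuousLinearMapAt ℝ p.1 w) := by
  rw [← u.liftTangent_eta hp (verticalVector I p w), mfderiv_proj_verticalVector,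
    vert_verticalVector u hp]

variable (I) in
/-- The vertical lift at `p`, as a linear map. -/
noncomputable def verticalLift (p : TotalSpace G W) :
    W p.1 →L[ℝ] TangentSpace (I.prod 𝓘(ℝ, G)) p where
  toFun := verticalVector I p
  map_add' w w' := by
    have hp : p ∈ (trivializationAt G W p.1).source :=
      FiberBundle.mem_trivializationAt_proj_source
    simp only [verticalVector_eq (trivializationAt G W p.1) hp]
    rw [← map_add, map_add]
    congr 1
    exact Prod.ext (add_zero _).symm rfl
  map_smul' r w := by
    have hp : p ∈ (trivializationAt G W p.1).source :=
      FiberBundle.mem_trivializationAt_proj_source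
    simp only [verticalVector_eq (trivializationAt G W p.1) hp]
    rw [RingHom.id_apply, ← map_smul, map_smul]
    congr 1
    exact Prod.ext (smul_zero _).symm rfl
  cont := by
    have hp : p ∈ (trivializationAt G W p.1).source :=
      FiberBundle.mem_trivializationAt_proj_source
    have h : verticalVector I p = fun w ↦ (trivializationAt G W p.1).liftTangent (I := I) hp
        (0, (trivializationAt G W p.1).continuousLinearMapAt ℝ p.1 w) :=
      funext fun w ↦ verticalVector_eq (trivializationAt G W p.1) hp w
    change Continuous (verticalVector I p)
    rw [h]
    exact ((trivializationAt G W p.1).liftTangent hp).continuous.comp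
      (continuous_const.prodMk (ContinuousLinearMap.continuous _))

variable {E' H' : Type*} [NormedAddCommGroup E'] [NormedSpace ℝ E'] [TopologicalSpace H']
  {J : ModelWithCorners ℝ E' H'} {N : Type*} [TopologicalSpace N] [ChartedSpace H' N]

theorem contMDiffAt_verticalLift {f : N → TotalSpace G W} {w : ∀ n, W (f n).1} {n : N}
    (hf : ContMDiffAt J (I.prod 𝓘(ℝ, G)) ∞ f n)
    (hw : ContMDiffAt J (I.prod 𝓘(ℝ, G)) ∞ (fun m ↦ (⟨(f m).1, w m⟩ : TotalSpace G W)) n) :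
    ContMDiffAt J (I.prod 𝓘(ℝ, G)).tangent ∞ (fun m ↦ (⟨f m, verticalLift I (f m) (w m)⟩ :
      TangentBundle (I.prod 𝓘(ℝ, G)) (TotalSpace G W))) n := by
  set u := trivializationAt G W (f n).1
  have hu : f n ∈ u.source := FiberBundle.mem_trivializationAt_proj_source
  have hb : ContMDiffAt J I ∞ (fun m ↦ (f m).1) n :=
    (contMDiff_proj W (n := ∞)).contMDiffAt.comp n hf
  refine u.contMDiffAt_of_vert (f := fun m ↦ ⟨f m, verticalLift I (f m) (w m)⟩) hu hf ?_ ?_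
  · have h1 := (contMDiff_zeroSection ℝ (TangentSpace I : Q → Type _) (n := ∞) (F := B)
      (IB := I)).contMDiffAt.comp n hb
    refine h1.congr_of_eventuallyEq (.of_forall fun m ↦ ?_)
    exact congrArg (TotalSpace.mk (f m).1) (mfderiv_proj_verticalVector (f m) (w m))
  · refine (contMDiffAt_totalSpace.1 hw).2.congr_of_eventuallyEq ?_
    filter_upwards [hf.continuousAt (u.open_source.mem_nhds hu)] with m hm
    refine (vert_verticalVector u hm (w m)).trans ?_
    rw [u.continuousLinearMapAt_apply ℝ, u.coe_linearMapAt_of_mem (u.mem_source.1 hm)]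

end VerticalLift

section WhitneySmooth

variable {B H : Type*} [NormedAddCommGroup B] [NormedSpace ℝ B] [TopologicalSpace H]
  {I : ModelWithCorners ℝ B H} {Q : Type*} [TopologicalSpace Q] [ChartedSpace H Q]
  {F : Type*} [NormedAddCommGroup F] [NormedSpace ℝ F]
  {V : Q → Type*} [TopologicalSpace (TotalSpace F V)] [∀ x, AddCommGroup (V x)]
  [∀ x, Module ℝ (V x)] [∀ x, TopologicalSpace (V x)] [FiberBundle F V] [VectorBundle ℝ F V]
  {E' H' : Type*} [NormedAddCommGroup E'] [NormedSpace ℝ E'] [TopologicalSpace H']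
  {J : ModelWithCorners ℝ E' H'} {N : Type*} [TopologicalSpace N] [ChartedSpace H' N]

/-- A map into a Whitney sum is smooth if its components are. -/
theorem WhitneySum.contMDiffAt_of_components {k : ℕ}
    {f : N → TotalSpace (Fin k → F) (WhitneySum k V)} {n : N}
    (hf : ContMDiffAt J I ∞ (fun m ↦ (f m).1) n)
    (h : ∀ a, ContMDiffAt J (I.prod 𝓘(ℝ, F)) ∞
      (fun m ↦ (⟨(f m).1, (f m).2 a⟩ : TotalSpace F V)) n) :
    ContMDiffAt J (I.prod 𝓘(ℝ, Fin k → F)) ∞ f n := by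
  refine contMDiffAt_totalSpace.2 ⟨hf, contMDiffAt_pi_space.2 fun a ↦ ?_⟩
  refine (contMDiffAt_totalSpace.1 (h a)).2.congr_of_eventuallyEq ?_
  filter_upwards [hf.continuousAt ((trivializationAt F V (f n).1).open_baseSet.mem_nhds
    (mem_baseSet_trivializationAt F V (f n).1))] with m hm
  exact congrFun ((trivializationAt F V (f n).1).coe_linearMapAt_of_mem (R := ℝ) hm) _

/-- The inclusion of the component `a` of a Whitney sum. -/
def WhitneySum.single {k : ℕ} (a : Fin k) (q : Q) : V q →L[ℝ] WhitneySum k V q :=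
  ContinuousLinearMap.single ℝ (fun _ ↦ V q) a

end WhitneySmooth

/-- The fibres of the dual of a vector bundle. -/
abbrev DualBundle {Q : Type*} (V : Q → Type*) [∀ x, AddCommGroup (V x)]
    [∀ x, Module ℝ (V x)] [∀ x, TopologicalSpace (V x)] (q : Q) : Type _ :=
  V q →L[ℝ] Bundle.Trivial Q ℝ q

section Legendre

variable {B H : Type*} [NormedAddCommGroup B] [NormedSpace ℝ B] [FiniteDimensional ℝ B]
  [TopologicalSpace H]
  {I : ModelWithCorners ℝ B H} {Q : Type*} [TopologicalSpace Q] [ChartedSpace H Q]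
  [IsManifold I ∞ Q] [T2Space Q]
  {F : Type*} [NormedAddCommGroup F] [NormedSpace ℝ F] [FiniteDimensional ℝ F]
  {V : Q → Type*} [TopologicalSpace (TotalSpace F V)] [∀ x, AddCommGroup (V x)]
  [∀ x, Module ℝ (V x)] [∀ x, TopologicalSpace (V x)] [FiberBundle F V] [VectorBundle ℝ F V]
  [ContMDiffVectorBundle ∞ F V I] (A : LieAlgebroid I F V) {k : ℕ}

/-- The endomorphism `J^a` of the prolongation over the Whitney sum of `k` copies of the
algebroid: it maps `(e, v)` to `(0, w)`, where `w` is the vertical lift of `e` in the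
component `a`. -/
noncomputable def verticalEndo (a : Fin k) (b : TotalSpace (Fin k → F) (WhitneySum k V)) :
    Prolong (Fin k → F) (WhitneySum k V) A b →ₗ[ℝ] Prolong (Fin k → F) (WhitneySum k V) A b where
  toFun z := Prolong.mk 0 (verticalLift I b (WhitneySum.single a b.1 z.fst))
    ((map_zero _).trans (mfderiv_proj_verticalVector b _).symm)
  map_add' z z' := Prolong.ext (add_zero _).symm <| by
    simp only [Prolong.snd_mk, map_add]
  map_smul' r z := Prolong.ext (smul_zero r : r • (0 : V b.1) = 0).symm <| by
    simp only [Prolong.snd_mk, map_smul, RingHom.id_apply]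

variable (L : C^∞⟮I.prod 𝓘(ℝ, Fin k → F), TotalSpace (Fin k → F) (WhitneySum k V); 𝓘(ℝ), ℝ⟯)

/-- The Poincaré-Cartan one-section of the component `a`: the derivative of the Lagrangian in the
direction of the anchor of `J^a z`. -/
noncomputable def poincareCartanOne (a : Fin k) (b : TotalSpace (Fin k → F) (WhitneySum k V)) :
    Prolong (Fin k → F) (WhitneySum k V) A b [⋀^Fin 1]→ₗ[ℝ] ℝ :=
  oneForm ((mvfderiv (I.prod 𝓘(ℝ, Fin k → F)) L b).toLinearMap ∘ₗ
    ((prolongation (Fin k → F) (WhitneySum k V) A).anchor b).toLinearMap ∘ₗ verticalEndo A a b)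

/-- The Poincaré-Cartan two-section: minus the exterior derivative of the one-section. -/
noncomputable def poincareCartanTwo (a : Fin k) (b : TotalSpace (Fin k → F) (WhitneySum k V))
    (v : Fin 2 → Prolong (Fin k → F) (WhitneySum k V) A b) : ℝ :=
  - (prolongation (Fin k → F) (WhitneySum k V) A).extDeriv (poincareCartanOne A L a) b v

/-- The Liouville one-section of the component `a`: it maps `(e, v)` at the point
`(β 0, …, β (k - 1))` to the number `β a e`. -/
noncomputable def liouvilleOne (a : Fin k)
    (β : TotalSpace (Fin k → (F →L[ℝ] ℝ)) (WhitneySum k (DualBundle V))) :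
    Prolong (Fin k → (F →L[ℝ] ℝ)) (WhitneySum k (DualBundle V)) A β [⋀^Fin 1]→ₗ[ℝ] ℝ :=
  oneForm ((β.2 a : V β.1 →L[ℝ] ℝ).toLinearMap ∘ₗ Prolong.fst.toLinearMap)

/-- The Liouville two-section: minus the exterior derivative of the one-section. -/
noncomputable def liouvilleTwo (a : Fin k)
    (β : TotalSpace (Fin k → (F →L[ℝ] ℝ)) (WhitneySum k (DualBundle V)))
    (v : Fin 2 → Prolong (Fin k → (F →L[ℝ] ℝ)) (WhitneySum k (DualBundle V)) A β) : ℝ :=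
  - (prolongation (Fin k → (F →L[ℝ] ℝ)) (WhitneySum k (DualBundle V)) A).extDeriv
    (liouvilleOne A a) β v

theorem deriv_lagrangian (a : Fin k) (b : TotalSpace (Fin k → F) (WhitneySum k V)) (e : V b.1) :
    deriv (fun s : ℝ ↦ L ⟨b.1, b.2 + s • WhitneySum.single a b.1 e⟩) 0 =
      mvfderiv (I.prod 𝓘(ℝ, Fin k → F)) L b
        (verticalLift I b (WhitneySum.single a b.1 e)) :=
  (mvfderiv_verticalVector (L.contMDiff.mdiffAt b) (WhitneySum.single a b.1 e)).symm

/-- The component `a` of the Legendre transformation at `b`: the derivative of the Lagrangian along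
the lines in the component `a` of the fibre. -/
noncomputable def legendreForm (b : TotalSpace (Fin k → F) (WhitneySum k V)) (a : Fin k) :
    V b.1 →L[ℝ] ℝ where
  toFun e := deriv (fun s : ℝ ↦ L ⟨b.1, b.2 + s • WhitneySum.single a b.1 e⟩) 0
  map_add' e e' := by
    rw [deriv_lagrangian, deriv_lagrangian, deriv_lagrangian, map_add, map_add, map_add]
  map_smul' r e := by
    rw [deriv_lagrangian, deriv_lagrangian, map_smul, map_smul, map_smul, RingHom.id_apply]
  cont := by
    simp only [deriv_lagrangian]
    exact (((mvfderiv (I.prod 𝓘(ℝ, Fin k → F)) L b).comp (verticalLift I b)).comp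
      (WhitneySum.single a b.1)).continuous

/-- The Legendre transformation. -/
noncomputable def legendre (b : TotalSpace (Fin k → F) (WhitneySum k V)) :
    TotalSpace (Fin k → (F →L[ℝ] ℝ)) (WhitneySum k (DualBundle V)) :=
  ⟨b.1, fun a ↦ legendreForm L b a⟩

theorem contMDiff_legendre : ContMDiff (I.prod 𝓘(ℝ, Fin k → F))
    (I.prod 𝓘(ℝ, Fin k → (F →L[ℝ] ℝ))) ∞ (legendre L) := by
  intro b₀
  have hproj : ContMDiff (I.prod 𝓘(ℝ, Fin k → F)) I ∞ (π (Fin k → F) (WhitneySum k V)) :=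
    contMDiff_proj _
  refine WhitneySum.contMDiffAt_of_components (f := legendre L) (hproj b₀) fun a ↦ ?_
  refine (contMDiffAt_hom_bundle _).2 ⟨hproj b₀, ?_⟩
  set t := trivializationAt F V b₀.1
  have hopen : IsOpen (π (Fin k → F) (WhitneySum k V) ⁻¹' t.baseSet) :=
    t.open_baseSet.preimage (FiberBundle.continuous_proj _ _)
  have hb₀ : b₀.1 ∈ t.baseSet := mem_baseSet_trivializationAt F V b₀.1
  have key : ContMDiffOn (I.prod 𝓘(ℝ, Fin k → F)) 𝓘(ℝ, F →L[ℝ] ℝ) ∞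
      (fun b : TotalSpace (Fin k → F) (WhitneySum k V) ↦
        (legendreForm L b a).comp (t.symmL ℝ b.1))
      (π (Fin k → F) (WhitneySum k V) ⁻¹' t.baseSet) := by
    refine contMDiffOn_clm_of_apply fun y b hb ↦ ContMDiffAt.contMDiffWithinAt ?_
    have h1 : ContMDiffAt (I.prod 𝓘(ℝ, Fin k → F)) (I.prod 𝓘(ℝ, Fin k → F)) ∞
        (fun b : TotalSpace (Fin k → F) (WhitneySum k V) ↦
          (⟨b.1, WhitneySum.single a b.1 (t.symmL ℝ b.1 y)⟩ :
            TotalSpace (Fin k → F) (WhitneySum k V))) b := by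
      refine WhitneySum.contMDiffAt_of_components (hproj b) fun a' ↦ ?_
      have h2 : ContMDiffAt (I.prod 𝓘(ℝ, Fin k → F)) (I.prod 𝓘(ℝ, F)) ∞
          (fun b : TotalSpace (Fin k → F) (WhitneySum k V) ↦
            (⟨b.1, t.symmL ℝ b.1 (Pi.single (M := fun _ : Fin k ↦ F) a y a')⟩ :
              TotalSpace F V)) b :=
        Prolong.contMDiffAt_symm t (hproj b) contMDiffAt_const hb
      refine h2.congr_of_eventuallyEq (.of_forall fun b ↦ congrArg (TotalSpace.mk b.1) ?_)
      change Pi.single (M := fun _ : Fin k ↦ V b.1) a (t.symmL ℝ b.1 y) a' = _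
      by_cases h : a' = a
      · subst h
        simp
      · simp [h]
    have h3 := contMDiffAt_verticalLift contMDiffAt_id h1
    have h4 := (contMDiff_mvfderiv_apply L.contMDiff
      (contMDiff_id (I := (I.prod 𝓘(ℝ, Fin k → F)).tangent) (n := ∞)
        (M := TangentBundle (I.prod 𝓘(ℝ, Fin k → F))
          (TotalSpace (Fin k → F) (WhitneySum k V))))).contMDiffAt.comp b h3
    refine h4.congr_of_eventuallyEq (.of_forall fun b ↦ ?_)
    exact deriv_lagrangian L a b _
  refine (key.contMDiffAt (hopen.mem_nhds hb₀)).congr_of_eventuallyEq ?_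
  refine .of_forall fun b ↦ ?_
  refine ContinuousLinearMap.ext fun y ↦ ?_
  simp [ContinuousLinearMap.inCoordinates, t]
  rfl

/-- The prolongation of the Legendre transformation: it maps `(e, v)` to the pair of `e` and the
image of `v` under the derivative of the Legendre transformation. -/
noncomputable def prolongLegendre (b : TotalSpace (Fin k → F) (WhitneySum k V)) :
    Prolong (Fin k → F) (WhitneySum k V) A b →ₗ[ℝ]
      Prolong (Fin k → (F →L[ℝ] ℝ)) (WhitneySum k (DualBundle V)) A (legendre L b) where
  toFun z := Prolong.mk (p := legendre L b) z.fst
    (mfderiv (I.prod 𝓘(ℝ, Fin k → F)) (I.prod 𝓘(ℝ, Fin k → (F →L[ℝ] ℝ))) (legendre L) b z.snd) <| by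
      have h := mfderiv_comp (I'' := I) b
        ((contMDiff_proj (WhitneySum k (DualBundle V)) (n := ∞)
          (legendre L b)).mdifferentiableAt (by norm_num))
        ((contMDiff_legendre L b).mdifferentiableAt (by norm_num))
      exact (Prolong.anchor_fst z).trans (DFunLike.congr_fun h z.snd)
  map_add' z z' := Prolong.ext (map_add (Prolong.fst (p := b)) z z')
    (map_add ((mfderiv (I.prod 𝓘(ℝ, Fin k → F)) (I.prod 𝓘(ℝ, Fin k → (F →L[ℝ] ℝ)))
      (legendre L) b).comp Prolong.snd) z z')
  map_smul' r z := Prolong.ext (map_smul (Prolong.fst (p := b)) r z)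
    (map_smul ((mfderiv (I.prod 𝓘(ℝ, Fin k → F)) (I.prod 𝓘(ℝ, Fin k → (F →L[ℝ] ℝ)))
      (legendre L) b).comp Prolong.snd) r z)

end Legendre

/-! A bundle map Φ over φ commutes with the exterior derivatives as soon as it respects anchors and
brackets. The images Φσ of sections are only sections along φ and need not come from sections of the
target, so "respects brackets" has to be given a meaning. The coordinate formula for a Lie algebroid
bracket supplies one: it is a part depending on the two values alone, plus the difference of the
derivatives of the coordinates, and each of these makes sense along a map.

The criterion is `isLieAlgebroidMorphism_of_bracket`. Extend vectors v_i at x to sections σ_i, and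
compare the Koszul formula for these with the Koszul formula on the target for sections through Φv_i
that are constant in a frame. Let D i j be the derivative of the coordinates of Φσ_j in the
direction of the anchor of v_i. By the product rule `IsSmoothForm.mvfderiv_along`, each derivative
term on the source is the corresponding term on the target plus terms with one argument replaced by
an entry of D. Each bracket term is the corresponding term on the target plus one with the argument
D i j - D j i. What is left over cancels for every alternating form and every matrix D; this is the
purely algebraic identity `AlternatingMap.sum_update_add_sum_update_sub`.

For the prolongation of a fibre preserving map over the identity, compatibility with the anchors is
built in, and compatibility with the brackets can be tested on the two components of an element. The
component in E is not changed by the map, and the bracket formula for it involves only components in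
E and the directions of differentiation, which are the same on both sides. The tangent component is
the anchor, and after applying the anchor the bracket condition is automatic
(`LieAlgebroid.anchor_bracketAlong`): anchors are homomorphisms of Lie algebras, so both sides act
on a function h as the commutator of two derivatives of h ∘ φ. The Legendre transformation is such a
map.

The form Θ^A sees only the component in E, so its pullback sends (e, v) to Leg(b)^A(e). This is the
derivative of L along the vertical lift of e, which is Θ_L^A. The statement for Ω^A follows by
applying the morphism property to the one-form Θ^A. -/

/-! ### The algebraic cancellation in the Koszul formula -/

/-- The terms with derivatives of the arguments cancel in the Koszul formula. -/
theorem AlternatingMap.sum_update_add_sum_update_sub {E : Type*} [AddCommGroup E] [Module ℝ E]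
    {l : ℕ} (m : E [⋀^Fin l]→ₗ[ℝ] ℝ) (u : Fin (l + 1) → E) (D : Fin (l + 1) → Fin (l + 1) → E) :
    ∑ i : Fin (l + 1), (-1) ^ (i : ℕ) *
        ∑ a : Fin l, m (Function.update (fun b ↦ u (i.succAbove b)) a (D i (i.succAbove a))) +
      ∑ i : Fin (l + 1), ∑ j ∈ Finset.Ioi i, (-1) ^ (j : ℕ) *
        m (fun a ↦ Function.update u i (D i j - D j i) (j.succAbove a)) = 0 := by
  -- Drop the argument i and put D i j in the slot j. The first sum is the sum of all T i j with i ≠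
  -- j, and the pair i < j in the second sum contributes - T i j - T j i.
  let T : Fin (l + 1) → Fin (l + 1) → ℝ := fun i j ↦
    (-1) ^ (i : ℕ) * m (fun b ↦ Function.update u j (D i j) (i.succAbove b))
  have h1 : ∀ i : Fin (l + 1), (-1) ^ (i : ℕ) *
      ∑ a : Fin l, m (Function.update (fun b ↦ u (i.succAbove b)) a (D i (i.succAbove a))) =
      ∑ j ∈ Finset.Ioi i, T i j + ∑ j ∈ Finset.Iio i, T i j := by
    intro i
    have h : ∑ j ∈ Finset.Ioi i, T i j + ∑ j ∈ Finset.Iio i, T i j = ∑ a, T i (i.succAbove a) := by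
      have h2 : Finset.Ioi i ∪ Finset.Iio i = Finset.univ.erase i := by
        ext j
        simp [lt_or_lt_iff_ne, eq_comm]
      rw [← Finset.sum_union (Finset.disjoint_left.2 fun j ↦ by simp; exact fun h ↦ h.le), h2]
      -- The meaningless diagonal term T i i is added to both sides, so that both become the full
      -- sum over j.
      refine add_left_cancel (a := T i i) ?_
      rw [Finset.add_sum_erase _ _ (Finset.mem_univ i), Fin.sum_univ_succAbove _ i]
    rw [h, Finset.mul_sum]
    refine Finset.sum_congr rfl fun a _ ↦ ?_
    simp only [T]
    congr 2
    exact (Function.update_comp_eq_of_injective u i.succAbove_right_injective a _).symm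
  have h2 : ∀ i : Fin (l + 1), ∀ j ∈ Finset.Ioi i, (-1) ^ (j : ℕ) *
      m (fun a ↦ Function.update u i (D i j - D j i) (j.succAbove a)) = - T i j - T j i := by
    intro i j hj
    have hij : i < j := Finset.mem_Ioi.1 hj
    obtain ⟨a, rfl⟩ := Fin.exists_succAbove_eq hij.ne
    have hup : ∀ e, (fun b ↦ Function.update u (j.succAbove a) e (j.succAbove b)) =
        Function.update (fun b ↦ u (j.succAbove b)) a e := fun e ↦
      Function.update_comp_eq_of_injective u j.succAbove_right_injective a e
    -- The family with D i j in both of the slots i and j has two equal entries. For an alternating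
    -- form, dropping either one of them gives the same value up to the sign (-1)^(i+j+1). This
    -- turns the term with j dropped into - T i j, in which i is dropped. Here i is written as
    -- `j.succAbove a`.
    have h3 := m.neg_one_pow_smul_map_removeNth_add_eq_zero_of_eq
      (v := Function.update (Function.update u (j.succAbove a) (D (j.succAbove a) j)) j
        (D (j.succAbove a) j)) (i := j.succAbove a) (j := j)
      (by simp [hij.ne]) hij.ne
    have h4 : (j.succAbove a).removeNth (Function.update (Function.update u (j.succAbove a)
        (D (j.succAbove a) j)) j (D (j.succAbove a) j)) =
        fun b ↦ Function.update u j (D (j.succAbove a) j) ((j.succAbove a).succAbove b) := by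
      rw [Function.update_comm hij.ne, Fin.removeNth_update]
      rfl
    rw [h4, Fin.removeNth_update] at h3
    have h5 : (j.removeNth (Function.update u (j.succAbove a) (D (j.succAbove a) j))) =
      fun b ↦ Function.update u (j.succAbove a) (D (j.succAbove a) j) (j.succAbove b) := rfl
    rw [h5, zsmul_eq_mul, zsmul_eq_mul] at h3
    push_cast at h3
    simp only [T]
    rw [hup, m.map_update_sub, ← hup, ← hup]
    linarith
  simp_rw [h1]
  rw [Finset.sum_congr rfl fun i _ ↦ Finset.sum_congr rfl (h2 i)]
  simp only [Finset.sum_add_distrib, Finset.sum_sub_distrib, Finset.sum_neg_distrib]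
  -- Exchanging the roles of i and j turns the terms T j i with i < j into the half of the first sum
  -- below the diagonal.
  have h3 : ∑ i : Fin (l + 1), ∑ j ∈ Finset.Ioi i, T j i = ∑ i, ∑ j ∈ Finset.Iio i, T i j :=
    Finset.sum_comm' (by simp)
  rw [h3]
  ring

/-! ### Differentiation of a form along a map -/

section FormAlong

variable {B H : Type*} [NormedAddCommGroup B] [NormedSpace ℝ B]
  [TopologicalSpace H]
  {I : ModelWithCorners ℝ B H} {M : Type*} [TopologicalSpace M] [ChartedSpace H M]
  {B' H' : Type*} [NormedAddCommGroup B'] [NormedSpace ℝ B'] [FiniteDimensional ℝ B']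
  [TopologicalSpace H']
  {I' : ModelWithCorners ℝ B' H'} {M' : Type*} [TopologicalSpace M'] [ChartedSpace H' M']
  [IsManifold I' ∞ M'] [T2Space M']
  {F' : Type*} [NormedAddCommGroup F'] [NormedSpace ℝ F'] [FiniteDimensional ℝ F']
  {V' : M' → Type*} [TopologicalSpace (TotalSpace F' V')] [∀ x, AddCommGroup (V' x)]
  [∀ x, Module ℝ (V' x)] [∀ x, TopologicalSpace (V' x)] [FiberBundle F' V'] [VectorBundle ℝ F' V']
  [ContMDiffVectorBundle ∞ F' V' I']

-- The bump function which cuts off the frame does not depend on the coordinates c, so one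
-- neighbourhood serves all c at once. This uniformity is needed when the coordinates vary together
-- with the point.
variable (I' F') in
theorem constSection_eventually_forall (x : M') :
    ∀ᶠ y in 𝓝 x, y ∈ (trivializationAt F' V' x).baseSet ∧
      ∀ c, constSection I' F' V' x c y = (trivializationAt F' V' x).symm y c := by
  filter_upwards [(bundleBump I' F' V' x).eventuallyEq_one,
    (trivializationAt F' V' x).open_baseSet.mem_nhds
      (mem_baseSet_trivializationAt F' V' x)] with y hy hy'
  refine ⟨hy', fun c ↦ ?_⟩
  change bundleBump I' F' V' x y • (trivializationAt F' V' x).symm y c = _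
  rw [hy]
  exact one_smul _ _

variable (I' F') in
/-- The coordinates at `z` of an alternating form with respect to the sections which are constant
near `y`, as a multilinear map. -/
noncomputable def constSectionForm {l : ℕ} (μ : ∀ y, V' y [⋀^Fin l]→ₗ[ℝ] ℝ) (y z : M') :
    MultilinearMap ℝ (fun _ : Fin l ↦ F') ℝ :=
  (μ z).toMultilinearMap.compLinearMap fun _ ↦
    { toFun := fun c ↦ constSection I' F' V' y c z
      map_add' := fun c d ↦ by rw [constSection_add]; rfl
      map_smul' := fun r c ↦ by rw [constSection_smul]; rfl }

/-- Smoothness of a form is tested on fixed sections only, whereas the product rule needs joint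
smoothness in the coordinates and the point. Expanding the coordinates in a basis of the
finite-dimensional fibre writes the function as a finite sum of polynomials in the coordinates times
values of the form on fixed sections. -/
theorem IsSmoothForm.contMDiff_constSectionForm {l : ℕ} {μ : ∀ y, V' y [⋀^Fin l]→ₗ[ℝ] ℝ}
    (hμ : IsSmoothForm I' F' μ) (y : M') :
    ContMDiff (𝓘(ℝ, Fin l → F').prod I') 𝓘(ℝ) ∞
      fun p : (Fin l → F') × M' ↦ constSectionForm I' F' μ y p.2 p.1 := by
  set b := Module.finBasis ℝ F'
  have h : (fun p : (Fin l → F') × M' ↦ constSectionForm I' F' μ y p.2 p.1) =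
      fun p ↦ ∑ r : Fin l → Fin (Module.finrank ℝ F'), (∏ i, b.coord (r i) (p.1 i)) *
        constSectionForm I' F' μ y p.2 fun i ↦ b (r i) := by
    funext p
    have h1 : p.1 = fun i ↦ ∑ j, b.coord j (p.1 i) • b j := funext fun i ↦ (b.sum_repr (p.1 i)).symm
    conv_lhs => rw [h1, MultilinearMap.map_sum]
    refine Finset.sum_congr rfl fun r _ ↦ ?_
    rw [MultilinearMap.map_smul_univ, smul_eq_mul]
  rw [h]
  refine contMDiff_finsetSum fun r _ ↦ ContMDiff.mul (contMDiff_finsetProd fun i _ ↦ ?_) ?_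
  · exact ((LinearMap.toContinuousLinearMap (b.coord (r i))).comp
      (ContinuousLinearMap.proj (R := ℝ) (φ := fun _ : Fin l ↦ F') i)).contMDiff.comp contMDiff_fst
  · exact (hμ fun i ↦ constSection I' F' V' y (b (r i))).comp contMDiff_snd

/-- The derivative of the function obtained by applying a smooth form to sections along a map. -/
theorem IsSmoothForm.mvfderiv_along {l : ℕ} {μ : ∀ y, V' y [⋀^Fin l]→ₗ[ℝ] ℝ}
    (hμ : IsSmoothForm I' F' μ) {φ : M → M'} {s : Fin l → ∀ x, V' (φ x)} {x : M}
    (hφ : MDifferentiableAt I I' φ x)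
    (hs : ∀ i, ContMDiff I (I'.prod 𝓘(ℝ, F')) ∞ fun m ↦ (⟨φ m, s i m⟩ : TotalSpace F' V'))
    (w : TangentSpace I x) :
    mvfderiv I (fun m ↦ μ (φ m) fun i ↦ s i m) x w =
      mvfderiv I' (fun y ↦ μ y fun i ↦ sectionThrough I' F' (s i x) y) (φ x)
        (mfderiv I I' φ x w) +
      ∑ a, μ (φ x) (Function.update (fun i ↦ s i x) a
        ((trivializationAt F' V' (φ x)).symmL ℝ (φ x) (coordDeriv F' I φ (s a) x w))) := by
  set t := trivializationAt F' V' (φ x)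
  have hx : φ x ∈ t.baseSet := mem_baseSet_trivializationAt F' V' (φ x)
  -- Near x the function to be differentiated is K (c m, φ m), where c collects the coordinates of
  -- the sections along φ and K is the form in the frame of constant sections. The rest is the chain
  -- rule for K.
  let c : M → Fin l → F' := fun m i ↦ (t ⟨φ m, s i m⟩).2
  let K : (Fin l → F') × M' → ℝ := fun p ↦ constSectionForm I' F' μ (φ x) p.2 p.1
  have hK : ContMDiff (𝓘(ℝ, Fin l → F').prod I') 𝓘(ℝ) ∞ K := hμ.contMDiff_constSectionForm (φ x)
  have hc : MDifferentiableAt I 𝓘(ℝ, Fin l → F') c x :=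
    (contMDiffAt_pi_space.2 fun i ↦ (contMDiffAt_totalSpace.1 (hs i x)).2).mdifferentiableAt
      (by norm_num : (∞ : WithTop ℕ∞) ≠ 0)
  have h1 : (fun m ↦ μ (φ m) fun i ↦ s i m) =ᶠ[𝓝 x] K ∘ fun m ↦ (c m, φ m) := by
    filter_upwards [hφ.continuousAt.eventually
      (constSection_eventually_forall I' F' (V' := V') (φ x))] with m hm
    refine congrArg (μ (φ m)) (funext fun i ↦ ?_)
    exact ((hm.2 _).trans (t.symm_apply_apply_mk hm.1 (s i m))).symm
  have h2 : mvfderiv I (fun m ↦ μ (φ m) fun i ↦ s i m) x w =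
      mvfderiv (𝓘(ℝ, Fin l → F').prod I') K (c x, φ x)
        (mvfderiv I c x w, mfderiv I I' φ x w) := by
    have h3 : mvfderiv I (fun m ↦ μ (φ m) fun i ↦ s i m) x =
      mvfderiv I (K ∘ fun m ↦ (c m, φ m)) x := h1.mfderiv_eq
    rw [h3, mvfderiv_comp_apply x (hK.mdiffAt _) (hc.prodMk hφ), hc.mfderiv_prod hφ]
    rfl
  -- The two partial derivatives of K give the two parts of the claim: with frozen coordinates, the
  -- form is differentiated on constant sections; at a frozen point, a multilinear map is
  -- differentiated.
  have h3 : mvfderiv (𝓘(ℝ, Fin l → F').prod I') K (c x, φ x)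
        (mvfderiv I c x w, mfderiv I I' φ x w) =
      mvfderiv 𝓘(ℝ, Fin l → F') (fun z ↦ K (z, φ x)) (c x) (mvfderiv I c x w) +
      mvfderiv I' (fun y ↦ K (c x, y)) (φ x) (mfderiv I I' φ x w) :=
    mfderiv_prod_eq_add_apply (hK.mdiffAt _)
  -- At the frozen point, K is multilinear in the coordinates. Its continuity comes from the
  -- smoothness of K.
  let f : ContinuousMultilinearMap ℝ (fun _ : Fin l ↦ F') ℝ :=
    ⟨constSectionForm I' F' μ (φ x) (φ x),
      hK.continuous.comp (continuous_id.prodMk continuous_const)⟩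
  have h4 : ∀ d : Fin l → F', mvfderiv 𝓘(ℝ, Fin l → F') (fun z ↦ K (z, φ x)) (c x) d =
      ∑ a, f (Function.update (c x) a (d a)) := by
    intro d
    have h5 : mfderiv 𝓘(ℝ, Fin l → F') 𝓘(ℝ) f (c x) = fderiv ℝ f (c x) := mfderiv_eq_fderiv
    have h6 : fderiv ℝ f (c x) d = _ := DFunLike.congr_fun (f.hasFDerivAt (c x)).fderiv d
    exact (DFunLike.congr_fun h5 d).trans (h6.trans (f.linearDeriv_apply (c x) d))
  have h5 : ∀ d, t.symm (φ x) d = t.symmL ℝ (φ x) d := fun d ↦ (t.symmL_apply hx d).symm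
  have h6 : ∀ i, t.symmL ℝ (φ x) (c x i) = s i x := fun i ↦ by
    rw [← h5]
    exact t.symm_apply_apply_mk hx (s i x)
  have h7 : ∀ d, constSection I' F' V' (φ x) d (φ x) = t.symmL ℝ (φ x) d := fun d ↦
    ((constSection_eventually_forall I' F' (V' := V') (φ x)).self_of_nhds.2 d).trans (h5 d)
  have h8 : ∀ a, (mvfderiv I c x w : Fin l → F') a = coordDeriv F' I φ (s a) x w := by
    intro a
    let pr : (Fin l → F') →L[ℝ] F' := ContinuousLinearMap.proj (R := ℝ) (φ := fun _ ↦ F') a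
    have h9 : mfderiv I 𝓘(ℝ, F') (pr ∘ c) x w =
        mfderiv 𝓘(ℝ, Fin l → F') 𝓘(ℝ, F') pr (c x) (mfderiv I 𝓘(ℝ, Fin l → F') c x w) :=
      mfderiv_comp_apply x (pr.contMDiff.mdiffAt _) hc w
    rw [pr.mfderiv_eq] at h9
    exact h9.symm
  rw [h2, h3, add_comm, h4]
  -- The first summands agree by definition: the section through `s i x` is the constant section
  -- with the coordinates `c x i`.
  refine congrArg₂ (· + ·) rfl (Finset.sum_congr rfl fun a _ ↦ ?_)
  refine congrArg (μ (φ x)) (funext fun i ↦ ?_)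
  refine (h7 _).trans ?_
  rcases eq_or_ne i a with rfl | hi
  · rw [Function.update_self, Function.update_self, h8]
  · rw [Function.update_of_ne hi, Function.update_of_ne hi, h6]

end FormAlong

/-! ### Morphisms in terms of anchors and brackets -/

section MorphismCriterion

variable {B H : Type*} [NormedAddCommGroup B] [NormedSpace ℝ B] [FiniteDimensional ℝ B]
  [TopologicalSpace H]
  {I : ModelWithCorners ℝ B H} {M : Type*} [TopologicalSpace M] [ChartedSpace H M]
  [IsManifold I ∞ M] [T2Space M]
  {F : Type*} [NormedAddCommGroup F] [NormedSpace ℝ F] [FiniteDimensional ℝ F]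
  {V : M → Type*} [TopologicalSpace (TotalSpace F V)] [∀ x, AddCommGroup (V x)]
  [∀ x, Module ℝ (V x)] [∀ x, TopologicalSpace (V x)] [FiberBundle F V] [VectorBundle ℝ F V]
  [ContMDiffVectorBundle ∞ F V I]
  {B' H' : Type*} [NormedAddCommGroup B'] [NormedSpace ℝ B'] [FiniteDimensional ℝ B']
  [TopologicalSpace H']
  {I' : ModelWithCorners ℝ B' H'} {M' : Type*} [TopologicalSpace M'] [ChartedSpace H' M']
  [IsManifold I' ∞ M'] [T2Space M']
  {F' : Type*} [NormedAddCommGroup F'] [NormedSpace ℝ F'] [FiniteDimensional ℝ F']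
  {V' : M' → Type*} [TopologicalSpace (TotalSpace F' V')] [∀ x, AddCommGroup (V' x)]
  [∀ x, Module ℝ (V' x)] [∀ x, TopologicalSpace (V' x)] [FiberBundle F' V'] [VectorBundle ℝ F' V']
  [ContMDiffVectorBundle ∞ F' V' I']
  {A : LieAlgebroid I F V} {A' : LieAlgebroid I' F' V'} {φ : M → M'}
  {Φ : ∀ x, V x →ₗ[ℝ] V' (φ x)}

/-- The bracket along the map `φ` of the images of two sections under a bundle map `Φ`. -/
noncomputable def LieAlgebroid.bracketAlong (A : LieAlgebroid I F V) (A' : LieAlgebroid I' F' V')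
    (Φ : ∀ x, V x →ₗ[ℝ] V' (φ x)) (σ τ : Cₛ^∞⟮I; F, V⟯) (x : M) : V' (φ x) :=
  A'.constBracket (Φ x (σ x)) (Φ x (τ x)) + (trivializationAt F' V' (φ x)).symmL ℝ (φ x)
    (coordDeriv F' I φ (fun y ↦ Φ y (τ y)) x (A.anchor x (σ x)) -
      coordDeriv F' I φ (fun y ↦ Φ y (σ y)) x (A.anchor x (τ x)))

/-- A smooth bundle map which is compatible with the anchors and with the brackets is a morphism
of Lie algebroids. -/
theorem isLieAlgebroidMorphism_of_bracket (hφ : ContMDiff I I' ∞ φ)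
    (hΦ : ContMDiff (I.prod 𝓘(ℝ, F)) (I'.prod 𝓘(ℝ, F')) ∞
      (fun e : TotalSpace F V ↦ (⟨φ e.1, Φ e.1 e.2⟩ : TotalSpace F' V')))
    (hanchor : ∀ x v, A'.anchor (φ x) (Φ x v) = mfderiv I I' φ x (A.anchor x v))
    (hbracket : ∀ (σ τ : Cₛ^∞⟮I; F, V⟯) x,
      Φ x (A.bracket σ τ x) = A.bracketAlong A' Φ σ τ x) :
    IsLieAlgebroidMorphism A A' Φ := by
  refine ⟨hΦ, fun l μ hμ x v ↦ ?_⟩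
  have hs : ∀ σ : Cₛ^∞⟮I; F, V⟯, ContMDiff I (I'.prod 𝓘(ℝ, F')) ∞
      fun y ↦ (⟨φ y, Φ y (σ y)⟩ : TotalSpace F' V') := fun σ ↦ hΦ.comp σ.contMDiff
  set σ : Fin (l + 1) → Cₛ^∞⟮I; F, V⟯ := fun i ↦ sectionThrough I F (v i)
  have hσ : ∀ i, σ i x = v i := fun i ↦ sectionThrough_apply I F (v i)
  set u : Fin (l + 1) → V' (φ x) := fun i ↦ Φ x (v i)
  have hu : ∀ i, sectionThrough I' F' (u i) (φ x) = u i := fun i ↦ sectionThrough_apply I' F' (u i)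
  -- D measures to first order how far Φσ_j is from being constant in the frame, in the direction of
  -- the anchor of v_i. All discrepancies between the two Koszul formulas are expressed by it.
  let D : Fin (l + 1) → Fin (l + 1) → V' (φ x) := fun i j ↦
    (trivializationAt F' V' (φ x)).symmL ℝ (φ x)
      (coordDeriv F' I φ (fun y ↦ Φ y (σ j y)) x (A.anchor x (v i)))
  -- The product rule along φ gives the derivative term of the target and one correction for each
  -- argument. Compatibility with the anchors identifies the direction of differentiation on the
  -- target.
  have h1 : ∀ i : Fin (l + 1), mvfderiv I (fun y ↦ pullbackForm Φ μ y fun a ↦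
      σ (i.succAbove a) y) x (A.anchor x (σ i x)) =
      mvfderiv I' (fun y ↦ μ y fun a ↦ sectionThrough I' F' (u (i.succAbove a)) y) (φ x)
        (A'.anchor (φ x) (sectionThrough I' F' (u i) (φ x))) +
      ∑ a : Fin l, μ (φ x) (Function.update (fun b ↦ u (i.succAbove b)) a
        (D i (i.succAbove a))) := by
    intro i
    have h := hμ.mvfderiv_along (s := fun a y ↦ Φ y (σ (i.succAbove a) y))
      ((hφ x).mdifferentiableAt (by norm_num)) (fun a ↦ hs _) (A.anchor x (v i))
    simp only [hσ] at h
    rw [hσ, hu, hanchor]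
    exact h
  -- Since i ≠ j, the slot i, which holds the bracket, survives when j is dropped. The bracket
  -- hypothesis and additivity in that slot separate the bracket of the frame sections on the target
  -- from the correction D i j - D j i.
  have h2 : ∀ i j : Fin (l + 1), i ≠ j → pullbackForm Φ μ x (fun a ↦
      Function.update σ i (A.bracket (σ i) (σ j)) (j.succAbove a) x) =
      μ (φ x) (fun a ↦ Function.update (fun i ↦ sectionThrough I' F' (u i)) i
        (A'.bracket (sectionThrough I' F' (u i)) (sectionThrough I' F' (u j)))
          (j.succAbove a) (φ x)) +
      μ (φ x) (fun a ↦ Function.update u i (D i j - D j i) (j.succAbove a)) := by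
    intro i j hij
    obtain ⟨a, rfl⟩ := Fin.exists_succAbove_eq hij
    have hup : ∀ e, (fun b ↦ Function.update u (j.succAbove a) e (j.succAbove b)) =
        Function.update (fun b ↦ u (j.succAbove b)) a e := fun e ↦
      Function.update_comp_eq_of_injective u j.succAbove_right_injective a e
    have h3 : (fun b ↦ Φ x (Function.update σ (j.succAbove a)
        (A.bracket (σ (j.succAbove a)) (σ j)) (j.succAbove b) x)) =
        Function.update (fun b ↦ u (j.succAbove b)) a
          (A'.constBracket (u (j.succAbove a)) (u j) + (D (j.succAbove a) j -
            D j (j.succAbove a))) := by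
      funext b
      rcases eq_or_ne b a with rfl | hb
      · rw [Function.update_self, Function.update_self, hbracket, LieAlgebroid.bracketAlong, hσ,
          hσ, map_sub]
      · rw [Function.update_of_ne hb, Function.update_of_ne (by simpa using hb), hσ]
    have h4 : (fun b ↦ Function.update (fun i ↦ sectionThrough I' F' (u i)) (j.succAbove a)
        (A'.bracket (sectionThrough I' F' (u (j.succAbove a))) (sectionThrough I' F' (u j)))
          (j.succAbove b) (φ x)) =
        Function.update (fun b ↦ u (j.succAbove b)) a
          (A'.constBracket (u (j.succAbove a)) (u j)) := by
      funext b
      rcases eq_or_ne b a with rfl | hb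
      · rw [Function.update_self, Function.update_self, LieAlgebroid.constBracket]
      · rw [Function.update_of_ne hb, Function.update_of_ne (by simpa using hb), hu]
    refine (congrArg (μ (φ x)) h3).trans ?_
    rw [h4, hup, AlternatingMap.map_update_add]
  -- The corrections from both kinds of terms are exactly the two sums in this identity, applied to
  -- the value of the form at φ x.
  have h3 := (μ (φ x)).sum_update_add_sum_update_sub u D
  rw [LieAlgebroid.extDeriv, LieAlgebroid.extDeriv, LieAlgebroid.koszul, LieAlgebroid.koszul]
  rw [Finset.sum_congr rfl fun i _ ↦ congrArg _ (h1 i), Finset.sum_congr rfl fun i _ ↦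
    Finset.sum_congr rfl fun j hj ↦ congrArg _ (h2 i j (Finset.mem_Ioi.1 hj).ne)]
  simp only [mul_add, Finset.sum_add_distrib]
  rw [add_add_add_comm, h3, add_zero]

/-- A smooth bundle map which is compatible with the anchors is compatible with the brackets, up
to the kernel of the anchor. -/
theorem LieAlgebroid.anchor_bracketAlong (hφ : ContMDiff I I' ∞ φ)
    (hΦ : ContMDiff (I.prod 𝓘(ℝ, F)) (I'.prod 𝓘(ℝ, F')) ∞
      (fun e : TotalSpace F V ↦ (⟨φ e.1, Φ e.1 e.2⟩ : TotalSpace F' V')))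
    (hanchor : ∀ x v, A'.anchor (φ x) (Φ x v) = mfderiv I I' φ x (A.anchor x v))
    (σ τ : Cₛ^∞⟮I; F, V⟯) (x : M) :
    A'.anchor (φ x) (A.bracketAlong A' Φ σ τ x) =
      mfderiv I I' φ x (A.anchor x (A.bracket σ τ x)) := by
  have hφ' : ∀ x, MDifferentiableAt I I' φ x := fun x ↦ (hφ x).mdifferentiableAt (by norm_num)
  -- Tangent vectors are compared by their action on smooth functions h of the target.
  refine sub_eq_zero.1 (tangent_eq_zero fun h ↦ ?_)
  rw [map_sub, sub_eq_zero]
  let hφf : C^∞⟮I, M; 𝓘(ℝ), ℝ⟯ := ⟨h ∘ φ, h.contMDiff.comp hφ⟩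
  -- This is the differential of h in the target algebroid. Compatibility with the anchors says that
  -- its value on Φτ is the derivative of h ∘ φ along τ, so the product rule for θ computes second
  -- derivatives of h ∘ φ.
  let θ : ∀ y, V' y [⋀^Fin 1]→ₗ[ℝ] ℝ := fun y ↦
    oneForm (((mvfderiv I' h y).comp (A'.anchor y)).toLinearMap)
  have hθ : IsSmoothForm I' F' θ := fun s ↦ (A'.deriv (s 0) h).contMDiff
  have hcomp : ∀ y v, mvfderiv I hφf y (A.anchor y v) =
      mvfderiv I' h (φ y) (A'.anchor (φ y) (Φ y v)) := by
    intro y v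
    rw [hanchor]
    exact mvfderiv_comp_apply y (h.contMDiff.mdiffAt _) (hφ' y) _
  -- A second derivative of h ∘ φ is the second derivative of h along frame sections, plus the
  -- action on h of the derivative of the coordinates of Φτ. Antisymmetrization produces the two
  -- parts of the bracket along φ.
  have key : ∀ σ τ : Cₛ^∞⟮I; F, V⟯, A.deriv σ (A.deriv τ hφf) x =
      A'.deriv (sectionThrough I' F' (Φ x (σ x)))
        (A'.deriv (sectionThrough I' F' (Φ x (τ x))) h) (φ x) +
      mvfderiv I' h (φ x) (A'.anchor (φ x) ((trivializationAt F' V' (φ x)).symmL ℝ (φ x)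
        (coordDeriv F' I φ (fun y ↦ Φ y (τ y)) x (A.anchor x (σ x))))) := by
    intro σ τ
    have h1 := hθ.mvfderiv_along (s := fun _ y ↦ Φ y (τ y)) (hφ' x)
      (fun _ ↦ hΦ.comp τ.contMDiff) (A.anchor x (σ x))
    rw [← hanchor, ← sectionThrough_apply I' F' (Φ x (σ x)), Fin.sum_univ_one] at h1
    have h2 : (fun y ↦ A.deriv τ hφf y) = fun y ↦ θ (φ y) fun _ ↦ Φ y (τ y) :=
      funext fun y ↦ hcomp y (τ y)
    refine (congrArg (fun g ↦ mvfderiv I g x (A.anchor x (σ x))) h2).trans (h1.trans ?_)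
    refine congrArg₂ (· + ·) rfl ?_
    exact congrArg (fun e ↦ mvfderiv I' h (φ x) (A'.anchor (φ x) e)) (Function.update_self ..)
  -- The anchor homomorphism property is used twice: on the source for h ∘ φ, and on the target for
  -- h with the frame sections.
  have h1 := A.deriv_bracket σ τ hφf x
  rw [key, key] at h1
  have h2 := A'.deriv_bracket (sectionThrough I' F' (Φ x (σ x))) (sectionThrough I' F' (Φ x (τ x)))
    h (φ x)
  have h3 : A.deriv (A.bracket σ τ) hφf x =
      mvfderiv I' h (φ x) (mfderiv I I' φ x (A.anchor x (A.bracket σ τ x))) :=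
    mvfderiv_comp_apply x (h.contMDiff.mdiffAt _) (hφ' x) _
  have h4 : A'.deriv (A'.bracket (sectionThrough I' F' (Φ x (σ x)))
      (sectionThrough I' F' (Φ x (τ x)))) h (φ x) =
      mvfderiv I' h (φ x) (A'.anchor (φ x) (A'.constBracket (Φ x (σ x)) (Φ x (τ x)))) := rfl
  rw [← h3, h1, LieAlgebroid.bracketAlong]
  simp only [map_add, map_sub]
  rw [← h4, h2]
  ring

end MorphismCriterion

/-! ### Prolongations of fibre preserving maps over the identity -/

section ProlongMorphism

variable {B H : Type*} [NormedAddCommGroup B] [NormedSpace ℝ B] [FiniteDimensional ℝ B]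
  [TopologicalSpace H]
  {I : ModelWithCorners ℝ B H} {Q : Type*} [TopologicalSpace Q] [ChartedSpace H Q]
  [IsManifold I ∞ Q] [T2Space Q]
  {F : Type*} [NormedAddCommGroup F] [NormedSpace ℝ F] [FiniteDimensional ℝ F]
  {V : Q → Type*} [TopologicalSpace (TotalSpace F V)] [∀ x, AddCommGroup (V x)]
  [∀ x, Module ℝ (V x)] [∀ x, TopologicalSpace (V x)] [FiberBundle F V] [VectorBundle ℝ F V]
  [ContMDiffVectorBundle ∞ F V I]
  {G : Type*} [NormedAddCommGroup G] [NormedSpace ℝ G] [FiniteDimensional ℝ G]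
  {W : Q → Type*} [TopologicalSpace (TotalSpace G W)] [∀ x, AddCommGroup (W x)]
  [∀ x, Module ℝ (W x)] [∀ x, TopologicalSpace (W x)] [FiberBundle G W] [VectorBundle ℝ G W]
  [ContMDiffVectorBundle ∞ G W I]
  {G' : Type*} [NormedAddCommGroup G'] [NormedSpace ℝ G'] [FiniteDimensional ℝ G']
  {W' : Q → Type*} [TopologicalSpace (TotalSpace G' W')] [∀ x, AddCommGroup (W' x)]
  [∀ x, Module ℝ (W' x)] [∀ x, TopologicalSpace (W' x)] [FiberBundle G' W'] [VectorBundle ℝ G' W']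
  [ContMDiffVectorBundle ∞ G' W' I]
  {A : LieAlgebroid I F V}

namespace Prolong

/-- The preferred trivialization of the prolongation has that of the algebroid as its first
coordinate. Hence frame sections of the prolongation are projectable where both bump functions are
1, which explains why this holds only near p. -/
theorem fst_sectionThrough {p : TotalSpace G W} (z : Prolong G W A p) : ∀ᶠ p' in 𝓝 p,
    (sectionThrough (I.prod 𝓘(ℝ, G)) (F × G) z p').fst = sectionThrough I F z.fst p'.1 := by
  have h : (trivializationAt (F × G) (Prolong G W A) p ⟨p, z⟩).2.1 =
      (trivializationAt F V p.1 ⟨p.1, z.fst⟩).2 :=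
    congrFun ((trivializationAt F V p.1).coe_linearMapAt_of_mem (R := ℝ)
      (mem_baseSet_trivializationAt F V p.1)) z.fst
  rw [sectionThrough, sectionThrough, ← h]
  exact fst_constSection p _

/-- This and `fst_coordDeriv` transfer the coordinate part of the bracket formula from the
prolongation to the algebroid; both rest on the product form of the trivialization. -/
theorem fst_symmL (p : TotalSpace G W) (c : F × G) :
    ((trivializationAt (F × G) (Prolong G W A) p).symmL ℝ p c).fst =
      (trivializationAt F V p.1).symmL ℝ p.1 c.1 := by
  have h := (trivializationAt (F × G) (Prolong G W A) p).continuousLinearMapAt_symmL (R := ℝ)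
    (mem_baseSet_trivializationAt (F × G) (Prolong G W A) p) c
  rw [Trivialization.continuousLinearMapAt_apply, Trivialization.coe_linearMapAt_of_mem _
    (mem_baseSet_trivializationAt (F × G) (Prolong G W A) p)] at h
  beta_reduce at h
  rw [trivializationAt_apply] at h
  -- A vector is recovered from its coordinates at the centre of the trivialization, so it suffices
  -- to compare coordinates in F.
  rw [← symmL_continuousLinearMapAt_self (F := F) (Prolong.fst _)]
  exact congrArg _ (congrArg Prod.fst h)

/-- Projection to the first coordinate is linear, so it commutes with differentiation; it takes the
coordinates in the prolongation to those of the component in the algebroid. -/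
theorem fst_coordDeriv {E' H' : Type*} [NormedAddCommGroup E'] [NormedSpace ℝ E']
    [TopologicalSpace H'] {J : ModelWithCorners ℝ E' H'} {N : Type*} [TopologicalSpace N]
    [ChartedSpace H' N] {f : N → TotalSpace G W} {s : ∀ n, Prolong G W A (f n)} {n : N}
    (hs : ContMDiff J ((I.prod 𝓘(ℝ, G)).prod 𝓘(ℝ, F × G)) ∞
      fun n ↦ (⟨f n, s n⟩ : TotalSpace (F × G) (Prolong G W A))) (v : TangentSpace J n) :
    (coordDeriv (F × G) J f s n v).1 = coordDeriv F J (fun m ↦ (f m).1) (fun m ↦ (s m).fst) n v := by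
  let pr : F × G →L[ℝ] F := ContinuousLinearMap.fst ℝ F G
  let c : N → F × G := fun m ↦ (trivializationAt (F × G) (Prolong G W A) (f n) ⟨f m, s m⟩).2
  have hc : MDifferentiableAt J 𝓘(ℝ, F × G) c n := mdifferentiableAt_coord hs
  have h1 : mfderiv J 𝓘(ℝ, F) (pr ∘ c) n v =
      mfderiv 𝓘(ℝ, F × G) 𝓘(ℝ, F) pr (c n) (mfderiv J 𝓘(ℝ, F × G) c n v) :=
    mfderiv_comp_apply n (pr.contMDiff.mdiffAt _) hc v
  rw [pr.mfderiv_eq] at h1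
  have h2 : (pr ∘ c) =ᶠ[𝓝 n] fun m ↦ (trivializationAt F V (f n).1 ⟨(f m).1, (s m).fst⟩).2 := by
    have hb : ContinuousAt (fun m ↦ (f m).1) n :=
      (FiberBundle.continuous_proj G W).continuousAt.comp
        (contMDiffAt_totalSpace.1 (hs n)).1.continuousAt
    filter_upwards [hb ((trivializationAt F V (f n).1).open_baseSet.mem_nhds
      (mem_baseSet_trivializationAt F V (f n).1))] with m hm
    exact congrFun ((trivializationAt F V (f n).1).coe_linearMapAt_of_mem (R := ℝ) hm) (s m).fst
  rw [h2.mfderiv_eq] at h1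
  exact h1.symm

/-- Near p, frame sections of the prolongation project to frame sections of the algebroid, and the
bracket of projectable sections projects to the bracket. -/
theorem fst_constBracket {p : TotalSpace G W} (z w : Prolong G W A p) :
    ((prolongation G W A).constBracket z w).fst = A.constBracket z.fst w.fst :=
  bracketFst_of_projectable (sectionThrough (I.prod 𝓘(ℝ, G)) (F × G) z)
    (sectionThrough (I.prod 𝓘(ℝ, G)) (F × G) w) (σ := sectionThrough I F z.fst)
    (σ' := sectionThrough I F w.fst) (fst_sectionThrough z) (fst_sectionThrough w)

variable {g : ∀ p : TotalSpace G W, W' p.1}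
  {Φ : ∀ p, Prolong G W A p →ₗ[ℝ] Prolong G' W' A (⟨p.1, g p⟩ : TotalSpace G' W')}

/-- The prolongation of a smooth fibre preserving map over the identity is smooth. -/
theorem contMDiff_of_fst_snd
    (hg : ContMDiff (I.prod 𝓘(ℝ, G)) (I.prod 𝓘(ℝ, G')) ∞
      fun p : TotalSpace G W ↦ (⟨p.1, g p⟩ : TotalSpace G' W'))
    (hfst : ∀ p z, (Φ p z).fst = z.fst)
    (hsnd : ∀ p z, (Φ p z).snd = mfderiv (I.prod 𝓘(ℝ, G)) (I.prod 𝓘(ℝ, G'))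
      (fun p : TotalSpace G W ↦ (⟨p.1, g p⟩ : TotalSpace G' W')) p z.snd) :
    ContMDiff ((I.prod 𝓘(ℝ, G)).prod 𝓘(ℝ, F × G)) ((I.prod 𝓘(ℝ, G')).prod 𝓘(ℝ, F × G')) ∞
      fun z : TotalSpace (F × G) (Prolong G W A) ↦
        (⟨⟨z.1.1, g z.1⟩, Φ z.1 z.2⟩ : TotalSpace (F × G') (Prolong G' W' A)) := by
  intro z
  obtain ⟨h1, h2⟩ := contMDiffAt_iff.1 (contMDiffAt_id (x := z)
    (I := (I.prod 𝓘(ℝ, G)).prod 𝓘(ℝ, F × G)) (n := ∞))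
  refine contMDiffAt_iff.2 ⟨h1.congr_of_eventuallyEq (.of_forall fun z ↦ ?_), ?_⟩
  · exact congrArg (TotalSpace.mk z.1.1) (hfst z.1 z.2)
  -- The tangent component of the image is the tangent map of the base map applied to the tangent
  -- component, so it varies smoothly.
  · refine ((hg.contMDiff_tangentMap (m := ∞) (by norm_num)).contMDiffAt.comp z
      h2).congr_of_eventuallyEq (.of_forall fun z ↦ ?_)
    exact congrArg (TotalSpace.mk (⟨z.1.1, g z.1⟩ : TotalSpace G' W')) (hsnd z.1 z.2)

/-- The prolongation of a smooth fibre preserving map over the identity is a morphism of Lie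
algebroids. -/
theorem isLieAlgebroidMorphism
    (hg : ContMDiff (I.prod 𝓘(ℝ, G)) (I.prod 𝓘(ℝ, G')) ∞
      fun p : TotalSpace G W ↦ (⟨p.1, g p⟩ : TotalSpace G' W'))
    (hfst : ∀ p z, (Φ p z).fst = z.fst)
    (hsnd : ∀ p z, (Φ p z).snd = mfderiv (I.prod 𝓘(ℝ, G)) (I.prod 𝓘(ℝ, G'))
      (fun p : TotalSpace G W ↦ (⟨p.1, g p⟩ : TotalSpace G' W')) p z.snd) :
    IsLieAlgebroidMorphism (prolongation G W A) (prolongation G' W' A) Φ := by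
  have hΦ := contMDiff_of_fst_snd hg hfst hsnd
  -- The anchor of a prolongation is its tangent component, so `hsnd` is literally compatibility
  -- with the anchors.
  refine isLieAlgebroidMorphism_of_bracket hg hΦ hsnd fun Z Z' p ↦ ?_
  refine ext ?_ ?_
  -- On components in the algebroid, the bracket along the map reduces to the formula `bracketFst`
  -- that defines the bracket on the source: Φ preserves these components, and the derivatives are
  -- taken along the same tangent vectors.
  · rw [hfst, LieAlgebroid.bracketAlong, map_add, fst_constBracket, hfst, hfst, fst_symmL]
    change bracketFst Z Z' p = _
    rw [bracketFst]
    have key : ∀ (Z : Cₛ^∞⟮I.prod 𝓘(ℝ, G); F × G, Prolong G W A⟯) v,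
        (coordDeriv (F × G') (I.prod 𝓘(ℝ, G))
          (fun p : TotalSpace G W ↦ (⟨p.1, g p⟩ : TotalSpace G' W')) (fun y ↦ Φ y (Z y)) p v).1 =
        coordDeriv F (I.prod 𝓘(ℝ, G)) (π G W) (fun p' ↦ (Z p').fst) p v := by
      intro Z v
      refine (fst_coordDeriv (hΦ.comp Z.contMDiff) v).trans ?_
      exact congrArg (fun s ↦ coordDeriv F (I.prod 𝓘(ℝ, G)) (π G W) s p v)
        (funext fun y ↦ hfst y (Z y))
    rw [Prod.fst_sub, key, key]
    rfl
  -- On tangent components the equality holds only after applying the anchor, but here the anchor is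
  -- the tangent component, so nothing is lost.
  · exact (hsnd p _).trans (LieAlgebroid.anchor_bracketAlong (A := prolongation G W A)
      (A' := prolongation G' W' A) hg hΦ hsnd Z Z' p).symm

end Prolong

end ProlongMorphism

/-! ### The Legendre transformation -/

section LegendreMorphism

variable {B H : Type*} [NormedAddCommGroup B] [NormedSpace ℝ B] [FiniteDimensional ℝ B]
  [TopologicalSpace H]
  {I : ModelWithCorners ℝ B H} {Q : Type*} [TopologicalSpace Q] [ChartedSpace H Q]
  [IsManifold I ∞ Q] [T2Space Q]
  {F : Type*} [NormedAddCommGroup F] [NormedSpace ℝ F] [FiniteDimensional ℝ F]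
  {V : Q → Type*} [TopologicalSpace (TotalSpace F V)] [∀ x, AddCommGroup (V x)]
  [∀ x, Module ℝ (V x)] [∀ x, TopologicalSpace (V x)] [FiberBundle F V] [VectorBundle ℝ F V]
  [ContMDiffVectorBundle ∞ F V I] (A : LieAlgebroid I F V) {k : ℕ}

/-- The components of a point of a Whitney sum depend smoothly on the point. -/
theorem WhitneySum.contMDiff_component (a : Fin k) :
    ContMDiff (I.prod 𝓘(ℝ, Fin k → F)) (I.prod 𝓘(ℝ, F)) ∞
      fun b : TotalSpace (Fin k → F) (WhitneySum k V) ↦ (⟨b.1, b.2 a⟩ : TotalSpace F V) := by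
  intro b
  obtain ⟨h1, h2⟩ := contMDiffAt_totalSpace.1 (contMDiffAt_id (x := b)
    (I := I.prod 𝓘(ℝ, Fin k → F)) (n := ∞))
  refine contMDiffAt_totalSpace.2 ⟨h1, (contMDiffAt_pi_space.1 h2 a).congr_of_eventuallyEq ?_⟩
  filter_upwards [h1.continuousAt ((trivializationAt F V b.1).open_baseSet.mem_nhds
    (mem_baseSet_trivializationAt F V b.1))] with b' hb'
  exact (congrFun ((trivializationAt F V b.1).coe_linearMapAt_of_mem (R := ℝ) hb') _).symm

/-- The value on a section is the pairing of a smooth covector along the projection with a smooth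
vector along it. The result is needed because a morphism is required to respect the differentials of
smooth forms only. -/
theorem isSmoothForm_liouvilleOne (a : Fin k) :
    IsSmoothForm (I.prod 𝓘(ℝ, Fin k → (F →L[ℝ] ℝ))) (F × (Fin k → (F →L[ℝ] ℝ)))
      (liouvilleOne A a) := by
  intro Z β
  have h1 := WhitneySum.contMDiff_component (I := I) (V := DualBundle V) a β
  have h2 := Prolong.contMDiff_fst (Z 0) β
  have h3 := ContMDiffAt.clm_bundle_apply (IB := I) (E₁ := V) (E₂ := Bundle.Trivial Q ℝ) h1 h2
  exact (contMDiffAt_totalSpace.1 h3).2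

/-- Prolongation leaves the component e alone, so the pullback evaluates the covector Leg(b)^a on e.
The fibre derivative of L that defines this covector is the derivative of L along the vertical lift
of e, the tangent component of J^a. -/
theorem pullbackForm_liouvilleOne
    (L : C^∞⟮I.prod 𝓘(ℝ, Fin k → F), TotalSpace (Fin k → F) (WhitneySum k V); 𝓘(ℝ), ℝ⟯)
    (a : Fin k) (b : TotalSpace (Fin k → F) (WhitneySum k V)) :
    pullbackForm (prolongLegendre A L) (liouvilleOne A a) b = poincareCartanOne A L a b :=
  AlternatingMap.ext fun z ↦ deriv_lagrangian L a b (z 0).fst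

end LegendreMorphism

/-- Everything is reduced to two facts: the Legendre transformation is smooth and fibre preserving
over the identity, and it pulls the Liouville one-sections back to the Poincaré–Cartan one-sections.
-/
theorem theorem4 {B H : Type*} [NormedAddCommGroup B] [NormedSpace ℝ B] [FiniteDimensional ℝ B]
    [TopologicalSpace H] {I : ModelWithCorners ℝ B H}
    {Q : Type*} [TopologicalSpace Q] [ChartedSpace H Q] [IsManifold I ∞ Q] [T2Space Q]
    {F : Type*} [NormedAddCommGroup F] [NormedSpace ℝ F] [FiniteDimensional ℝ F]
    {V : Q → Type*} [TopologicalSpace (TotalSpace F V)] [∀ q, AddCommGroup (V q)]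
    [∀ q, Module ℝ (V q)] [∀ q, TopologicalSpace (V q)] [FiberBundle F V] [VectorBundle ℝ F V]
    [ContMDiffVectorBundle ∞ F V I] (A : LieAlgebroid I F V) (k : ℕ)
    (L : C^∞⟮I.prod 𝓘(ℝ, Fin k → F), TotalSpace (Fin k → F) (WhitneySum k V); 𝓘(ℝ), ℝ⟯) :
    IsLieAlgebroidMorphism (prolongation (Fin k → F) (WhitneySum k V) A)
        (prolongation (Fin k → (F →L[ℝ] ℝ)) (WhitneySum k (DualBundle V)) A)
        (φ := legendre L) (prolongLegendre A L) ∧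
      ∀ a : Fin k,
        (∀ b, pullbackForm (prolongLegendre A L) (liouvilleOne A a) b =
          poincareCartanOne A L a b) ∧
        ∀ (b : TotalSpace (Fin k → F) (WhitneySum k V))
          (v : Fin 2 → Prolong (Fin k → F) (WhitneySum k V) A b),
          liouvilleTwo A a (legendre L b) (fun i ↦ prolongLegendre A L b (v i)) =
            poincareCartanTwo A L a b v := by
  have hmor : IsLieAlgebroidMorphism (prolongation (Fin k → F) (WhitneySum k V) A)
      (prolongation (Fin k → (F →L[ℝ] ℝ)) (WhitneySum k (DualBundle V)) A)
      (φ := legendre L) (prolongLegendre A L) :=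
    -- The map g is the fibre part of the Legendre transformation; the two component conditions hold
    -- by the construction of its prolongation.
    Prolong.isLieAlgebroidMorphism (A := A) (W := WhitneySum k V) (W' := WhitneySum k (DualBundle V))
      (g := fun b a ↦ legendreForm L b a) (Φ := prolongLegendre A L) (contMDiff_legendre L)
      (fun b z ↦ Prolong.fst_mk (p := legendre L b) z.fst _ _)
      (fun b z ↦ Prolong.snd_mk (p := legendre L b) z.fst _ _)
  refine ⟨hmor, fun a ↦ ⟨pullbackForm_liouvilleOne A L a, fun b v ↦ ?_⟩⟩
  have h := hmor.2 1 _ (isSmoothForm_liouvilleOne A a) b v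
  -- The exterior derivative depends on the form near b and not just on its value there, so the
  -- equality of one-forms is used as an equality of whole families.
  rw [funext (pullbackForm_liouvilleOne A L a)] at h
  exact congrArg Neg.neg h.symm
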